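/- Let $M\in\mathbb N$, $\vec N=(N_1,\dots,N_M)\in\mathbb N^M$ with all $N_k\ge 1$, $X=\prod_{k}\{0,\dots,N_k\}$, $|\vec N|=\sum_k N_k$ and $|\eta|=\sum_k\eta_k$ for $\eta\in X$. Write $\eta^{k,l}$ for $\eta$ with one particle moved from site $k$ to site $l$. **Processes.** $\mathrm{SEP}(\vec N)$ is the Markov jump process on $X$ with generator $$L_{\vec N}f(\eta)=\sum_{k=1}^{M-1}\eta_k(N_{k+1}-\eta_{k+1})[f(\eta^{k,k+1})-f(\eta)]+\eta_{k+1}(N_k-\eta_k)[f(\eta^{k+1,k})-f(\eta)].$$ For $\rho\in\mathbb R$ let $h^+_k(\xi)=\rho+\sum_{j\ge k}(2\xi_j-N_j)$. $\mathrm{SSEP}_{\mathsf R}(\vec N,\rho)$ has generator $L^{\mathsf R}_{\vec N,\rho}$, in which a particle jumps from $k$ to $k+1$ at rate $$\frac{\xi_k(N_{k+1}-\xi_{k+1})(h^+_k-\xi_k)(h^+_{k+1}-\xi_{k+1})}{h^+_{k+1}(h^+_{k+1}+1)}$$ and from $k$ to $k-1$ at rate $$\frac{\xi_k(N_{k-1}-\xi_{k-1})(h^+_k+\xi_{k-1})(h^+_{k+1}+\xi_k)}{h^+_k(h^+_k-1)}.$$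 Let $h^-_{k,0}(\eta)=\sum_{j\le k}(2\eta_j-N_j)$. A function $D:X\times X\to\mathbb R$ is a duality function between processes with generators $L$ and $L'$ if $[L D(\cdot,\xi)](\eta)=[L' D(\eta,\cdot)](\xi)$ for all $\eta,\xi$. A (possibly signed) measure is called reversible if it satisfies detailed balance. **Functions.** Let $(a)_n=a(a+1)\cdots(a+n-1)$. The Hahn and Krawtchouk polynomials are $$\hat P_n(x;\alpha,\beta,N)={}_3F_2\!\left(\begin{smallmatrix}-n,\;n+\alpha+\beta+1,\;-x\\ \alpha+1,\;-N\end{smallmatrix};1\right),\qquad \hat K_n(x;p,N)={}_2F_1\!\left(\begin{smallmatrix}-n,\;-x\\ -N\end{smallmatrix};\tfrac1p\right).$$ Put $$\hat p(n,x;\lambda,\rho,v,N)=\frac{(\frac12(\rho+\lambda-N+v+1))_x\,(n+\frac12(\lambda-\rho-N+1+v))_N}{(-x+\frac12(\lambda-\rho+N+1+v))_{x+n}}\,\hat P_x\big(n;\tfrac12(\rho+\lambda-N+v-1),\tfrac12(\rho-\lambda-N-v-1),N\big),$$ $$\hat P^v_{\mathsf R}(\eta,\xi)=\prod_{k=1}^M\hat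 p(\eta_k,\xi_k;h^-_{k-1,0}(\eta),h^+_{k+1}(\xi),v,N_k),\qquad \hat K^v(\eta,\xi)=\prod_{k=1}^M v^{-\eta_k/2}\hat K_{\eta_k}\big(\xi_k;\tfrac1{1+v},N_k\big),$$ $$\hat w(\eta)=\prod_k\binom{N_k}{\eta_k},\qquad \hat W_{\mathsf R}(\xi)=\prod_k\hat W(\xi_k;N_k,h^+_{k+1}(\xi)),\qquad \hat W(x;N,\rho)=(-1)^x\frac{2x+\rho-N}{\rho-N}\,\frac{(\rho-N)_x}{(\rho+1)_x(-\rho)_N}\binom Nx,$$ $$\hat\omega^{\mathrm p}(x)=\frac{(-1)^x(\frac12(\rho-|\vec N|+v+1))_x}{(x+\frac12(v-\rho-|\vec N|+1))_{|\vec N|-x}},\qquad \hat\omega^{\mathrm p}_{\mathsf R}(x)=\frac{(-x+\frac12(v-\rho+|\vec N|+1))_x}{(\frac12(v+\rho-|\vec N|+1))_x},\qquad \hat\omega^{\mathrm k}(x)=\frac{v^{-x}}{(1+\frac1v)^{|\vec N|}}.$$ The functions before the limit, for $q>0$, $q\ne1$, are as follows. Let $(a;q)_n=\prod_{i=0}^{n-1}(1-aq^i)$,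 let $\binom{N}{x}_{q}=\frac{(q;q)_N}{(q;q)_x(q;q)_{N-x}}$, and let ${}_3\varphi_2$ be the usual $q$-hypergeometric series. With the $q$-Hahn polynomial $P_n(x;\alpha,\beta,N;q)={}_3\varphi_2(q^{-n},\alpha\beta q^{n+1},q^{-x};\alpha q,q^{-N};q,q)$ and the $q$-Krawtchouk polynomial $K_n(x;c,N;q)={}_3\varphi_2(q^{-n},q^{-x},-cq^{x-N};q^{-N},0;q,q)$ put $$p(n,x;\lambda,\rho,v,N;q)=v^n\frac{(-vq^{\rho+\lambda-N+1};q^2)_x(vq^{2n-\rho+\lambda-N+1};q^2)_N}{q^{n(n+\rho+\lambda-N)}(vq^{-2x-\rho+\lambda+N+1};q^2)_{x+n}}P_x(n;-vq^{\rho+\lambda-N-1},v^{-1}q^{\rho-\lambda-N-1},N;q^2),$$ $$P^v_{\mathsf R}(\eta,\xi)=\prod_k p(\eta_k,\xi_k;h^-_{k-1,0}(\eta),h^+_{k+1}(\xi),v,N_k;q),$$ $$K_{\mathsf R}(\eta,\xi)=q^{-\frac12\sum_k(\eta_kN_k-2\eta_k\sum_{j\le k}N_j)}\prod_k(-1)^{\eta_k}q^{-\eta_kh^+_{k+1}(\xi)}q^{\frac12\eta_k(N_k-1)}K_{\eta_k}(\xi_k;q^{2h^+_{k+1}(\xi)},N_k;q^2),$$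 $$W(x;N,\rho;q)=\frac{1+q^{4x+2\rho-2N}}{1+q^{2\rho-2N}}\,\frac{(-q^{2\rho-2N};q^2)_x}{(-q^{2\rho+2};q^2)_x}\,\frac{q^{-x(2\rho+1+x-2N)}}{(-q^{-2\rho};q^2)_N}\binom{N}{x}_{q^2},\qquad W_{\mathsf R}(\xi)=\prod_kW(\xi_k;N_k,h^+_{k+1}(\xi);q).$$ **(i)** Let $\rho,v\in\mathbb R$ be such that no denominator vanishes in the one-site functions $\hat p$ occurring in $\hat P^v_{\mathsf R}$ and in $\hat\omega^{\mathrm p},\hat\omega^{\mathrm p}_{\mathsf R}$, i.e. $v+\rho-|\vec N|+1+2j\ne0$ for integers $0\le j<|\vec N|$, and $v-\rho-|\vec N|+1+2j\neq0$ for integers $0\le j<|\vec N|+\max_kN_k$. Then: * $\hat P^v_{\mathsf R}(\eta,\xi)=\lim_{q\to1}(1-q^2)^{|\eta|-|\vec N|}P^{iq^v}_{\mathsf R}(\eta,\xi)$ for all $\eta,\xi\in X$, where $\rho$ is replaced by $\rho+\frac{i\pi}{2\ln q}$ in $P^{iq^v}_{\mathsf R}$. * If the rates of $\mathrm{SSEP}_{\mathsf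 R}(\vec N,\rho)$ have no vanishing denominator for any jump that can occur (as is the case if $|\rho|>|\vec N|$), then $\hat P^v_{\mathsf R}$ is a duality function between $\mathrm{SEP}(\vec N)$ and $\mathrm{SSEP}_{\mathsf R}(\vec N,\rho)$. * If $\rho\notin\{-|\vec N|,-|\vec N|+1,\dots,|\vec N|\}$ (so that no denominator or factor of $\hat W_{\mathsf R}$ vanishes), then $\hat W_{\mathsf R}=\lim_{q\to1}(1-q^2)^{|\vec N|}W_{\mathsf R}$ with $\rho$ replaced by $\rho+\frac{i\pi}{2\ln q}$ in $W_{\mathsf R}$; the measures $\hat\omega^{\mathrm p}(|\eta|)\hat w(\eta)$ and $\hat\omega^{\mathrm p}_{\mathsf R}(|\xi|)\hat W_{\mathsf R}(\xi)$ are reversible for $\mathrm{SEP}(\vec N)$ and $\mathrm{SSEP}_{\mathsf R}(\vec N,\rho)$, respectively; and $$\sum_{\eta\in X}\hat P^v_{\mathsf R}(\eta,\xi)\hat P^v_{\mathsf R}(\eta,\xi')\,\hat\omega^{\mathrm p}(|\eta|)\hat w(\eta)=\frac{\delta_{\xi,\xi'}}{\hat\omega^{\mathrm p}_{\mathsf R}(|\xi|)\hat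 W_{\mathsf R}(\xi)},\qquad \sum_{\xi\in X}\hat P^v_{\mathsf R}(\eta,\xi)\hat P^v_{\mathsf R}(\eta',\xi)\,\hat\omega^{\mathrm p}_{\mathsf R}(|\xi|)\hat W_{\mathsf R}(\xi)=\frac{\delta_{\eta,\eta'}}{\hat\omega^{\mathrm p}(|\eta|)\hat w(\eta)}.$$ **(ii)** Let $v>0$. Then: * $\hat K^v(\eta,\xi)=\lim_{q\to1}(-1)^{|\eta|}K_{\mathsf R}(\eta,\xi)$ for all $\eta,\xi\in X$, where $\rho=\frac12\log_q(v)$ in $K_{\mathsf R}$. * $\hat K^v$ is a self-duality function for $\mathrm{SEP}(\vec N)$. * The measures $\hat w(\eta)$ and $\hat\omega^{\mathrm k}(|\xi|)\hat w(\xi)$ are reversible for $\mathrm{SEP}(\vec N)$, and $$\sum_{\eta\in X}\hat K^v(\eta,\xi)\hat K^v(\eta,\xi')\hat w(\eta)=\frac{\delta_{\xi,\xi'}}{\hat\omega^{\mathrm k}(|\xi|)\hat w(\xi)},\qquad \sum_{\xi\in X}\hat K^v(\eta,\xi)\hat K^v(\eta',\xi)\hat\omega^{\mathrm k}(|\xi|)\hat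 w(\xi)=\frac{\delta_{\eta,\eta'}}{\hat w(\eta)}.$$ -/

import Mathlib

open scoped Topology

noncomputable section

namespace ExclusionDuality

/-! ## Configurations and heights

The `M` sites are indexed by `Fin M`, that is by `0, …, M - 1`. -/

/-- The state space `{0, …, N_1} × ⋯ × {0, …, N_M}`. -/
abbrev Conf {M : ℕ} (N : Fin M → ℕ) : Type := (k : Fin M) → Fin (N k + 1)

/-- The total number of particles `|η|`. -/
def total {M : ℕ} {N : Fin M → ℕ} (η : Conf N) : ℕ := ∑ k, (η k : ℕ)

/-- The total capacity `|N|`. -/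
def capacity {M : ℕ} (N : Fin M → ℕ) : ℕ := ∑ k, N k

/-- The right height function: `ρ` plus the sum of `2 ξ_j - N_j` over the sites `j` with (0-based)
index at least `k`. So `hPlus ρ ξ k` is the height at the site `k : Fin M`, `hPlus ρ ξ (k + 1)` is
the height at its right neighbour, and `hPlus ρ ξ M = ρ`. -/
def hPlus {R : Type*} [Ring R] {M : ℕ} {N : Fin M → ℕ} (ρ : R) (ξ : Conf N) (k : ℕ) : R :=
  ρ + ∑ j : Fin M, if k ≤ (j : ℕ) then 2 * ((ξ j : ℕ) : R) - (N j : R) else 0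

/-- The left height function: `lam` plus the sum of `2 η_j - N_j` over the first `k` sites. So for
a site `k : Fin M`, `hMinus lam η k` is the height at its left neighbour, and
`hMinus lam η 0 = lam`. -/
def hMinus {R : Type*} [Ring R] {M : ℕ} {N : Fin M → ℕ} (lam : R) (η : Conf N) (k : ℕ) : R :=
  lam + ∑ j : Fin M, if (j : ℕ) < k then 2 * ((η j : ℕ) : R) - (N j : R) else 0

/-! ## The processes -/

/-- The configuration after one particle has moved from site `k` to site `l` (`k ≠ l`). It is
used only with a jump rate that vanishes if site `k` is empty or site `l` is full. -/
def move {M : ℕ} {N : Fin M → ℕ} (η : Conf N) (k l : Fin M) : Conf N := fun j =>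
  if j = k then ⟨(η j : ℕ) - 1, lt_of_le_of_lt (Nat.sub_le _ _) (η j).isLt⟩
  else if j = l then ⟨min ((η j : ℕ) + 1) (N j), Nat.lt_succ_of_le (min_le_right _ _)⟩
  else η j

/-- The Markov generator of the nearest neighbour particle system in which, for neighbouring sites
`l = k + 1`, a particle jumps from `k` to `l` at rate `right η k l` and from `l` to `k` at rate
`left η k l`. -/
def jumpGenerator {M : ℕ} {N : Fin M → ℕ} (right left : Conf N → Fin M → Fin M → ℝ)
    (f : Conf N → ℝ) (η : Conf N) : ℝ :=
  ∑ k : Fin M, ∑ l : Fin M,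
    if (l : ℕ) = (k : ℕ) + 1 then
      right η k l * (f (move η k l) - f η) + left η k l * (f (move η l k) - f η)
    else 0

/-- The generator of the symmetric exclusion process `SEP(N)`. -/
def sepGenerator {M : ℕ} (N : Fin M → ℕ) : (Conf N → ℝ) → Conf N → ℝ :=
  jumpGenerator
    (fun η k l => ((η k : ℕ) : ℝ) * ((N l : ℝ) - ((η l : ℕ) : ℝ)))
    (fun η k l => ((η l : ℕ) : ℝ) * ((N k : ℝ) - ((η k : ℕ) : ℝ)))

/-- The rate of `SSEP_R(N, ρ)` for a jump to the right, from `k` to `l = k + 1`. -/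
def dynRight {M : ℕ} {N : Fin M → ℕ} (ρ : ℝ) (ξ : Conf N) (k l : Fin M) : ℝ :=
  ((ξ k : ℕ) : ℝ) * ((N l : ℝ) - ((ξ l : ℕ) : ℝ)) *
    (hPlus ρ ξ k - ((ξ k : ℕ) : ℝ)) * (hPlus ρ ξ l - ((ξ l : ℕ) : ℝ)) /
    (hPlus ρ ξ l * (hPlus ρ ξ l + 1))

/-- The rate of `SSEP_R(N, ρ)` for a jump to the left, from `l = k + 1` to `k`. -/
def dynLeft {M : ℕ} {N : Fin M → ℕ} (ρ : ℝ) (ξ : Conf N) (k l : Fin M) : ℝ :=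
  ((ξ l : ℕ) : ℝ) * ((N k : ℝ) - ((ξ k : ℕ) : ℝ)) *
    (hPlus ρ ξ l + ((ξ k : ℕ) : ℝ)) * (hPlus ρ ξ ((l : ℕ) + 1) + ((ξ l : ℕ) : ℝ)) /
    (hPlus ρ ξ l * (hPlus ρ ξ l - 1))

/-- The generator of the dynamic symmetric exclusion process `SSEP_R(N, ρ)`. -/
def dynGenerator {M : ℕ} (N : Fin M → ℕ) (ρ : ℝ) : (Conf N → ℝ) → Conf N → ℝ :=
  jumpGenerator (dynRight ρ) (dynLeft ρ)

/-- The rates of `SSEP_R(N, ρ)` have no vanishing denominator for any jump that can occur. -/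
def DynRatesDefined {M : ℕ} (N : Fin M → ℕ) (ρ : ℝ) : Prop :=
  ∀ (ξ : Conf N) (k l : Fin M), (l : ℕ) = (k : ℕ) + 1 →
    (0 < (ξ k : ℕ) → (ξ l : ℕ) < N l → hPlus ρ ξ l ≠ 0 ∧ hPlus ρ ξ l + 1 ≠ 0) ∧
    (0 < (ξ l : ℕ) → (ξ k : ℕ) < N k → hPlus ρ ξ l ≠ 0 ∧ hPlus ρ ξ l - 1 ≠ 0)

/-- `D` is a duality function between the processes with generators `L` and `L'`. -/
def IsDuality {Ω Ω' : Type*} (L : (Ω → ℝ) → Ω → ℝ) (L' : (Ω' → ℝ) → Ω' → ℝ)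
    (D : Ω → Ω' → ℝ) : Prop :=
  ∀ η ξ, L (fun η' => D η' ξ) η = L' (fun ξ' => D η ξ') ξ

/-- Detailed balance: `μ` is a reversible (possibly signed) measure for the generator `L`. For
`η ≠ η'` the number `L (Pi.single η' 1) η` is the rate of the jumps from `η` to `η'`. -/
def IsReversible {Ω : Type*} [DecidableEq Ω] (L : (Ω → ℝ) → Ω → ℝ) (μ : Ω → ℝ) : Prop :=
  ∀ η η', μ η * L (Pi.single η' 1) η = μ η' * L (Pi.single η 1) η'

/-! ## Hypergeometric ingredients -/

/-- The shifted factorial `(a)_n = a (a + 1) ⋯ (a + n - 1)`. -/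
def poch (a : ℝ) (n : ℕ) : ℝ := (ascPochhammer ℝ n).eval a

/-- The Hahn polynomial, the terminating series
`₃F₂(-n, n + α + β + 1, -x; α + 1, -N; 1)`, for `n ≤ N`. -/
def hahn (n : ℕ) (x α β : ℝ) (N : ℕ) : ℝ :=
  ∑ j ∈ Finset.range (n + 1),
    poch (-(n : ℝ)) j * poch (n + α + β + 1) j * poch (-x) j /
      (poch (α + 1) j * poch (-(N : ℝ)) j * (j.factorial : ℝ))

/-- The Krawtchouk polynomial, the terminating series `₂F₁(-n, -x; -N; 1 / p)`, for `n ≤ N`. -/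
def krawtchouk (n : ℕ) (x p : ℝ) (N : ℕ) : ℝ :=
  ∑ j ∈ Finset.range (n + 1),
    poch (-(n : ℝ)) j * poch (-x) j / (poch (-(N : ℝ)) j * (j.factorial : ℝ)) * (1 / p) ^ j

/-- The `q`-shifted factorial `(a; q)_n`. -/
def qPoch {F : Type*} [Field F] (a q : F) (n : ℕ) : F := ∏ i ∈ Finset.range n, (1 - a * q ^ i)

/-- The `q`-binomial coefficient. -/
def qBinom {F : Type*} [Field F] (q : F) (n k : ℕ) : F :=
  qPoch q q n / (qPoch q q k * qPoch q q (n - k))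

/-- The `q`-Hahn polynomial `P_n(x; α, β, N; q)`, the terminating series
`₃φ₂(q^{-n}, α β q^{n+1}, q^{-x}; α q, q^{-N}; q, q)`, for `n ≤ N`. -/
def qHahn {F : Type*} [Field F] (n x : ℕ) (α β : F) (N : ℕ) (q : F) : F :=
  ∑ j ∈ Finset.range (n + 1),
    qPoch (q ^ (-(n : ℤ))) q j * qPoch (α * β * q ^ (n + 1)) q j * qPoch (q ^ (-(x : ℤ))) q j /
      (qPoch (α * q) q j * qPoch (q ^ (-(N : ℤ))) q j * qPoch q q j) * q ^ j

/-- The (dual) `q`-Krawtchouk polynomial `K_n(x; c, N; q)`, the terminating series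
`₃φ₂(q^{-n}, q^{-x}, -c q^{x-N}; q^{-N}, 0; q, q)`, for `n ≤ N`. -/
def qKrawtchouk {F : Type*} [Field F] (n x : ℕ) (c : F) (N : ℕ) (q : F) : F :=
  ∑ j ∈ Finset.range (n + 1),
    qPoch (q ^ (-(n : ℤ))) q j * qPoch (q ^ (-(x : ℤ))) q j *
        qPoch (-c * q ^ ((x : ℤ) - (N : ℤ))) q j /
      (qPoch (q ^ (-(N : ℤ))) q j * qPoch (0 : F) q j * qPoch q q j) * q ^ j

/-! ## Duality functions and weights before the limit `q → 1` -/

/-- The one-site duality function `p(n, x; lam, ρ, v, N; q)`, for complex parameters. -/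
def pSite (n x : ℕ) (lam ρ v : ℂ) (N : ℕ) (q : ℝ) : ℂ :=
  v ^ n *
    (qPoch (-v * (q : ℂ) ^ (ρ + lam - N + 1)) ((q : ℂ) ^ 2) x *
      qPoch (v * (q : ℂ) ^ (2 * n - ρ + lam - N + 1)) ((q : ℂ) ^ 2) N) /
    ((q : ℂ) ^ ((n : ℂ) * (n + ρ + lam - N)) *
      qPoch (v * (q : ℂ) ^ (-2 * x - ρ + lam + N + 1)) ((q : ℂ) ^ 2) (x + n)) *
    qHahn x n (-v * (q : ℂ) ^ (ρ + lam - N - 1)) (v⁻¹ * (q : ℂ) ^ (ρ - lam - N - 1)) N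
      ((q : ℂ) ^ 2)

/-- The duality function `P_R^v` between `ASEP(q, N)` and `ASEP_R(q, N, ρ)`, a nested product of
`q`-Hahn polynomials, for complex parameters. -/
def PR {M : ℕ} (N : Fin M → ℕ) (ρ v : ℂ) (q : ℝ) (η ξ : Conf N) : ℂ :=
  ∏ k : Fin M, pSite (η k) (ξ k) (hMinus (0 : ℂ) η k) (hPlus ρ ξ ((k : ℕ) + 1)) v (N k) q

/-- The exponent `u(η; N) = ∑_k (η_k N_k - 2 η_k ∑_{j ≤ k} N_j)`. -/
def uExp {M : ℕ} {N : Fin M → ℕ} (η : Conf N) : ℝ :=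
  ∑ k : Fin M, (((η k : ℕ) : ℝ) * (N k : ℝ) -
    2 * ((η k : ℕ) : ℝ) * ∑ j : Fin M, if j ≤ k then (N j : ℝ) else 0)

/-- The one-site duality function `k(n, x; ρ, N; q)`. -/
def kSite (n x : ℕ) (ρ : ℝ) (N : ℕ) (q : ℝ) : ℝ :=
  (-1) ^ n * q ^ (-(n : ℝ) * ρ) * q ^ ((n : ℝ) * ((N : ℝ) - 1) / 2) *
    qKrawtchouk n x (q ^ (2 * ρ)) N (q ^ 2)

/-- The duality function `K_R` between `ASEP(q, N)` and `ASEP_R(q, N, ρ)`, a nested product of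
`q`-Krawtchouk polynomials. -/
def KR {M : ℕ} (N : Fin M → ℕ) (ρ q : ℝ) (η ξ : Conf N) : ℝ :=
  q ^ (-uExp η / 2) *
    ∏ k : Fin M, kSite (η k) (ξ k) (hPlus ρ ξ ((k : ℕ) + 1)) (N k) q

/-- The one-site weight `W(x; N, ρ; q)`, for complex `ρ`. -/
def WSite (x N : ℕ) (ρ : ℂ) (q : ℝ) : ℂ :=
  (1 + (q : ℂ) ^ (4 * x + 2 * ρ - 2 * N)) / (1 + (q : ℂ) ^ (2 * ρ - 2 * N)) *
    (qPoch (-(q : ℂ) ^ (2 * ρ - 2 * N)) ((q : ℂ) ^ 2) x /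
      qPoch (-(q : ℂ) ^ (2 * ρ + 2)) ((q : ℂ) ^ 2) x) *
    ((q : ℂ) ^ (-(x : ℂ) * (2 * ρ + 1 + x - 2 * N)) /
      qPoch (-(q : ℂ) ^ (-2 * ρ)) ((q : ℂ) ^ 2) N) *
    qBinom ((q : ℂ) ^ 2) N x

/-- The reversible measure `W_R` of `ASEP_R(q, N, ρ)`, for complex `ρ`. -/
def WR {M : ℕ} (N : Fin M → ℕ) (ρ : ℂ) (q : ℝ) (ξ : Conf N) : ℂ :=
  ∏ k : Fin M, WSite (ξ k) (N k) (hPlus ρ ξ ((k : ℕ) + 1)) q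

/-- The shifted dynamic parameter `ρ + i π / (2 log q)`. It replaces `q^{2ρ}` by `-q^{2ρ}`. -/
def shiftedRho (ρ q : ℝ) : ℂ := (ρ : ℂ) + Complex.I * Real.pi / (2 * Real.log q)

/-! ## Duality functions and weights in the symmetric case -/

/-- The one-site Hahn duality function. -/
def pHat (n x : ℕ) (lam ρ v : ℝ) (N : ℕ) : ℝ :=
  poch ((ρ + lam - N + v + 1) / 2) x * poch (n + (lam - ρ - N + 1 + v) / 2) N /
      poch (-x + (lam - ρ + N + 1 + v) / 2) (x + n) *
    hahn x n ((ρ + lam - N + v - 1) / 2) ((ρ - lam - N - v - 1) / 2) N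

/-- The nested product of Hahn polynomials. -/
def PHat {M : ℕ} (N : Fin M → ℕ) (ρ v : ℝ) (η ξ : Conf N) : ℝ :=
  ∏ k : Fin M, pHat (η k) (ξ k) (hMinus (0 : ℝ) η k) (hPlus ρ ξ ((k : ℕ) + 1)) v (N k)

/-- The one-site Krawtchouk duality function. -/
def kHat (n x : ℕ) (v : ℝ) (N : ℕ) : ℝ :=
  v ^ (-(n : ℝ) / 2) * krawtchouk n x (1 / (1 + v)) N

/-- The product of Krawtchouk polynomials. -/
def KHat {M : ℕ} (N : Fin M → ℕ) (v : ℝ) (η ξ : Conf N) : ℝ :=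
  ∏ k : Fin M, kHat (η k) (ξ k) v (N k)

/-- The product of binomial coefficients, the reversible measure of `SEP(N)`. -/
def wHat {M : ℕ} (N : Fin M → ℕ) (η : Conf N) : ℝ :=
  ∏ k : Fin M, ((N k).choose (η k : ℕ) : ℝ)

/-- The one-site weight of the dynamic process. -/
def WHatSite (x N : ℕ) (ρ : ℝ) : ℝ :=
  (-1) ^ x * ((2 * x + ρ - N) / (ρ - N)) *
    (poch (ρ - N) x / (poch (ρ + 1) x * poch (-ρ) N)) * (N.choose x : ℝ)

/-- The reversible measure of `SSEP_R(N, ρ)`. -/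
def WHatR {M : ℕ} (N : Fin M → ℕ) (ρ : ℝ) (ξ : Conf N) : ℝ :=
  ∏ k : Fin M, WHatSite (ξ k) (N k) (hPlus ρ ξ ((k : ℕ) + 1))

/-- The factor in front of `wHat` in the Hahn case, as a function of the number `x` of particles
and of the capacity `S`. -/
def omegaP (S : ℕ) (ρ v : ℝ) (x : ℕ) : ℝ :=
  (-1) ^ x * poch ((ρ - S + v + 1) / 2) x / poch (x + (v - ρ - S + 1) / 2) (S - x)

/-- The factor in front of `WHatR` in the Hahn case. -/
def omegaPR (S : ℕ) (ρ v : ℝ) (x : ℕ) : ℝ :=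
  poch (-x + (v - ρ + S + 1) / 2) x / poch ((v + ρ - S + 1) / 2) x

/-- The factor in front of `wHat` in the Krawtchouk case. -/
def omegaK (S : ℕ) (v : ℝ) (x : ℕ) : ℝ := v ^ (-(x : ℤ)) / (1 + 1 / v) ^ S

/-- The parameters are such that no denominator vanishes in the one-site Hahn duality functions
and in the factors `omegaP`, `omegaPR`. -/
def HahnGeneric {M : ℕ} (N : Fin M → ℕ) (ρ v : ℝ) : Prop :=
  (∀ j : ℕ, j < capacity N → v + ρ - capacity N + 1 + 2 * j ≠ 0) ∧
  ∀ (k : Fin M) (j : ℕ), j < capacity N + N k → v - ρ - capacity N + 1 + 2 * j ≠ 0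

end ExclusionDuality

end

open ExclusionDuality

/-!
In the Bernstein basis of degree `N` the Hahn polynomials are the coefficients of a Jacobi
polynomial and the Krawtchouk polynomials those of `(1 - (1 + v) X) ^ x`, and the number of
particles at a site becomes a first order differential operator. Differential relations of these
polynomials thus give the relations between the Hahn polynomials of neighbouring parameters that
make the duality hold for two sites, and the general case follows bond by bond, since the
remaining factors depend only on the number of particles on the bond.

The difference equation of the Hahn or Krawtchouk polynomials is that of a reversible birth and
death chain. Its Dirichlet form lowers both degrees, which gives the orthogonality for one site by
induction, and for several sites by summing over the last site first. Orthogonality and duality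
together imply reversibility of the dynamic process, and the second orthogonality relation is the
first one for the transposed matrix. In the limit `q → 1` the shift of `ρ` by `i π / (2 log q)`
turns the factors `1 + q ^ a` into `1 - q ^ a`.
-/

noncomputable section

namespace ExclusionDuality

/-! ## Shifted factorials -/

@[simp] lemma poch_zero (a : ℝ) : poch a 0 = 1 := by simp [poch]

@[simp] lemma poch_one (a : ℝ) : poch a 1 = a := by simp [poch]

lemma poch_succ (a : ℝ) (n : ℕ) : poch a (n + 1) = poch a n * (a + n) := by
  simp [poch, ascPochhammer_succ_eval]

lemma poch_add (a : ℝ) (m n : ℕ) : poch a (m + n) = poch a m * poch (a + m) n := by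
  induction n with
  | zero => simp
  | succ n ih => rw [← add_assoc, poch_succ, poch_succ, ih]; push_cast; ring

lemma poch_succ_left (a : ℝ) (n : ℕ) : poch a (n + 1) = a * poch (a + 1) n := by
  rw [add_comm n 1, poch_add]; simp

lemma poch_eq_prod (a : ℝ) (n : ℕ) : poch a n = ∏ i ∈ Finset.range n, (a + i) := by
  induction n with
  | zero => simp
  | succ n ih => rw [poch_succ, Finset.prod_range_succ, ih]

lemma poch_ne_zero {a : ℝ} {n : ℕ} (h : ∀ i < n, a + (i : ℝ) ≠ 0) : poch a n ≠ 0 := by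
  rw [poch_eq_prod]
  exact Finset.prod_ne_zero_iff.2 fun i hi => h i (Finset.mem_range.1 hi)

lemma continuous_poch (n : ℕ) : Continuous fun a : ℝ => poch a n :=
  (ascPochhammer ℝ n).continuous

/-! ## Bernstein coefficients -/

section Bernstein

open Polynomial

/-- The coefficients of a polynomial `p` of degree at most `N` with respect to the Bernstein basis:
`p = ∑ n, bernsteinCoeff N n p * C(N, n) X ^ n (1 - X) ^ (N - n)`. The monomial `X ^ j` has the
coefficients `C(n, j) / C(N, j)`; those with `N < j` are sent to `0`. -/
def bernsteinCoeff (N n : ℕ) : ℝ[X] →ₗ[ℝ] ℝ :=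
  lsum fun j => ((n.choose j : ℝ) / N.choose j) • LinearMap.id

lemma bernsteinCoeff_monomial (N n j : ℕ) (r : ℝ) :
    bernsteinCoeff N n (monomial j r) = (n.choose j : ℝ) / N.choose j * r := by
  simp [bernsteinCoeff, lsum_apply]

lemma bernsteinCoeff_one (N n : ℕ) : bernsteinCoeff N n 1 = 1 := by
  simpa using bernsteinCoeff_monomial N n 0 1

lemma bernsteinCoeff_X_pow (N n j : ℕ) :
    bernsteinCoeff N n (X ^ j) = (n.choose j : ℝ) / N.choose j := by
  simpa [X_pow_eq_monomial] using bernsteinCoeff_monomial N n j 1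

lemma choose_succ_mul_succ (n j : ℕ) :
    (n.choose (j + 1) : ℝ) * (j + 1) = n.choose j * ((n : ℝ) - j) := by
  rcases lt_or_ge n j with h | h
  · simp [Nat.choose_eq_zero_of_lt h, Nat.choose_eq_zero_of_lt (Nat.lt_succ_of_lt h)]
  · rw [← Nat.cast_sub h]
    exact_mod_cast Nat.choose_succ_right_eq n j

lemma mul_choose_pred (n j : ℕ) : (n : ℝ) * (n - 1).choose j = ((n : ℝ) - j) * n.choose j := by
  cases n with
  | zero => cases j <;> simp
  | succ n =>
    have hmul : ((n : ℝ) + 1) * n.choose j = (n + 1).choose (j + 1) * (j + 1) := by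
      exact_mod_cast Nat.add_one_mul_choose_eq n j
    rw [choose_succ_mul_succ] at hmul
    push_cast at hmul ⊢
    rw [hmul, mul_comm]

lemma sub_mul_choose_div_choose {N n : ℕ} (hn : n ≤ N) (j : ℕ) :
    ((N : ℝ) - j) * (n.choose (j + 1) / N.choose (j + 1)) =
      ((n : ℝ) - j) * (n.choose j / N.choose j) := by
  rcases lt_trichotomy j N with hj | rfl | hj
  · have hN := choose_succ_mul_succ N j
    have h0 : (N.choose j : ℝ) ≠ 0 := by exact_mod_cast (Nat.choose_pos hj.le).ne'
    have h1 : (N.choose (j + 1) : ℝ) ≠ 0 := by exact_mod_cast (Nat.choose_pos hj).ne'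
    have hj1 : (j : ℝ) + 1 ≠ 0 := by positivity
    rw [← mul_div_assoc, ← mul_div_assoc, div_eq_div_iff h1 h0]
    apply mul_left_cancel₀ hj1
    linear_combination ((N - j) * (N.choose j : ℝ)) * choose_succ_mul_succ n j -
      (n.choose j : ℝ) * (n - j) * hN
  · rcases hn.eq_or_lt with rfl | hn
    · simp
    · simp [Nat.choose_eq_zero_of_lt hn]
  · simp [Nat.choose_eq_zero_of_lt hj, Nat.choose_eq_zero_of_lt (Nat.lt_succ_of_lt hj)]

lemma X_mul_derivative_monomial (j : ℕ) (r : ℝ) :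
    X * derivative (monomial j r) = monomial j (j * r) := by
  cases j <;> simp [X_mul_monomial, mul_comm]

lemma bernsteinCoeff_X_mul_derivative (N n : ℕ) (p : ℝ[X]) :
    bernsteinCoeff N n (X * derivative p) =
      n * (bernsteinCoeff N n p - bernsteinCoeff N (n - 1) p) := by
  induction p using Polynomial.induction_on' with
  | add p q hp hq => simp only [map_add, mul_add, hp, hq]; ring
  | monomial j r =>
    rw [X_mul_derivative_monomial]
    simp only [bernsteinCoeff_monomial]
    linear_combination (r / N.choose j) * mul_choose_pred n j

lemma bernsteinCoeff_X_mul_sub {N n : ℕ} (hn : n ≤ N) (p : ℝ[X]) :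
    bernsteinCoeff N n (X * ((N : ℝ) • p - X * derivative p)) =
      n * bernsteinCoeff N (n - 1) p := by
  induction p using Polynomial.induction_on' with
  | add p q hp hq =>
    rw [map_add (bernsteinCoeff N (n - 1)), mul_add (n : ℝ), ← hp, ← hq, ← map_add, derivative_add]
    congr 1
    algebra
  | monomial j r =>
    rw [X_mul_derivative_monomial, smul_monomial, ← map_sub, X_mul_monomial]
    simp only [bernsteinCoeff_monomial]
    linear_combination r * sub_mul_choose_div_choose hn j -
      (r / N.choose j) * mul_choose_pred n j

lemma bernsteinCoeff_succ_sub (N n : ℕ) (p : ℝ[X]) :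
    (N + 1) * (bernsteinCoeff (N + 1) (n + 1) p - bernsteinCoeff (N + 1) n p) =
      bernsteinCoeff N n (derivative p) := by
  induction p using Polynomial.induction_on' with
  | add p q hp hq => simp only [map_add, ← hp, ← hq]; ring
  | monomial j r =>
    rw [derivative_monomial]
    simp only [bernsteinCoeff_monomial]
    cases j with
    | zero => simp
    | succ j =>
      have hN : ((N : ℝ) + 1) * N.choose j = (N + 1).choose (j + 1) * (j + 1) := by
        exact_mod_cast Nat.add_one_mul_choose_eq N j
      rcases le_or_gt j N with hj | hj
      · have h0 : (N.choose j : ℝ) ≠ 0 := by exact_mod_cast (Nat.choose_pos hj).ne'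
        have h1 : ((N + 1).choose (j + 1) : ℝ) ≠ 0 := by
          exact_mod_cast (Nat.choose_pos (Nat.succ_le_succ hj)).ne'
        simp only [Nat.choose_succ_succ n j, Nat.add_sub_cancel]
        push_cast
        field_simp
        linear_combination r * n.choose j * hN
      · simp [Nat.choose_eq_zero_of_lt hj, Nat.choose_eq_zero_of_lt (Nat.succ_lt_succ hj)]

lemma bernsteinCoeff_one_sub_X_mul_derivative {N : ℕ} {p : ℝ[X]} (hp : p.natDegree ≤ N) (n : ℕ) :
    bernsteinCoeff N n ((1 - X) * derivative p) =
      (N - n) * (bernsteinCoeff N (n + 1) p - bernsteinCoeff N n p) := by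
  refine induction_with_natDegree_le (fun p => bernsteinCoeff N n ((1 - X) * derivative p) =
    (N - n) * (bernsteinCoeff N (n + 1) p - bernsteinCoeff N n p)) N (by simp) ?_ ?_ p hp
  · intro j r _ hj
    rw [sub_mul, one_mul, C_mul_X_pow_eq_monomial, X_mul_derivative_monomial, derivative_monomial,
      map_sub]
    simp only [bernsteinCoeff_monomial]
    cases j with
    | zero => simp
    | succ j =>
      have h0 : (N.choose j : ℝ) ≠ 0 := by exact_mod_cast (Nat.choose_pos (by omega)).ne'
      have h1 : (N.choose (j + 1) : ℝ) ≠ 0 := by exact_mod_cast (Nat.choose_pos hj).ne'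
      have hinv : ((j : ℝ) + 1) / N.choose j = (N - j) / N.choose (j + 1) := by
        rw [div_eq_div_iff h0 h1]
        linear_combination choose_succ_mul_succ N j
      rw [Nat.choose_succ_succ n j, Nat.add_sub_cancel]
      push_cast
      linear_combination r * n.choose j * hinv - r / N.choose (j + 1) * choose_succ_mul_succ n j
  · intro p q _ _ hp hq
    simp only [map_add, mul_add, hp, hq]; ring

lemma bernsteinCoeff_derivative {N : ℕ} {p : ℝ[X]} (hp : p.natDegree ≤ N) (n : ℕ) :
    bernsteinCoeff N n (derivative p) =
      (N - n) * (bernsteinCoeff N (n + 1) p - bernsteinCoeff N n p) +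
        n * (bernsteinCoeff N n p - bernsteinCoeff N (n - 1) p) := by
  rw [← bernsteinCoeff_one_sub_X_mul_derivative hp, ← bernsteinCoeff_X_mul_derivative, ← map_add]
  congr 1
  ring

lemma bernsteinCoeff_X_mul_add {N n : ℕ} (hn : n ≤ N) (p : ℝ[X]) :
    bernsteinCoeff N n (X * ((N : ℝ) • p + (1 - X) * derivative p)) =
      n * bernsteinCoeff N n p := by
  have hpred := bernsteinCoeff_X_mul_sub hn p
  have hX := bernsteinCoeff_X_mul_derivative N n p
  rw [show X * ((N : ℝ) • p + (1 - X) * derivative p) =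
    X * ((N : ℝ) • p - X * derivative p) + X * derivative p by algebra, map_add, hpred, hX]
  ring

lemma bernsteinCoeff_one_sub_X_mul_add {N n : ℕ} (hn : n ≤ N) {p : ℝ[X]}
    (hp : p.natDegree ≤ N) :
    bernsteinCoeff N n ((1 - X) * ((N : ℝ) • p + (1 - X) * derivative p)) =
      (N - n) * bernsteinCoeff N (n + 1) p := by
  have hX := bernsteinCoeff_X_mul_add hn p
  have hder := bernsteinCoeff_one_sub_X_mul_derivative hp n
  rw [show (1 - X) * ((N : ℝ) • p + (1 - X) * derivative p) =
    (N : ℝ) • p + (1 - X) * derivative p - X * ((N : ℝ) • p + (1 - X) * derivative p) by algebra,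
    map_sub, map_add, map_smul, smul_eq_mul, hX, hder]
  ring

end Bernstein

/-! ## Jacobi polynomials -/

section Jacobi

open Polynomial

/-- The Jacobi polynomial `(a)_x ₂F₁(-x, x + c; a; X)`, where `a = α + 1` and `c = α + β + 1`. In
this normalization it is polynomial in the parameters. -/
def jacobi (x : ℕ) (c a : ℝ) : ℝ[X] :=
  ∑ j ∈ Finset.range (x + 1),
    monomial j ((-1) ^ j * x.choose j * poch (x + c) j * poch (a + j) (x - j))

variable (x : ℕ) (c a : ℝ)

@[simp] lemma jacobi_coeff (j : ℕ) :
    (jacobi x c a).coeff j = (-1) ^ j * x.choose j * poch (x + c) j * poch (a + j) (x - j) := by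
  simp only [jacobi, finsetSum_coeff, coeff_monomial, Finset.sum_ite_eq', Finset.mem_range]
  split_ifs with h
  · rfl
  · simp [Nat.choose_eq_zero_of_lt (by omega : x < j)]

lemma natDegree_jacobi_le : (jacobi x c a).natDegree ≤ x :=
  natDegree_le_iff_coeff_eq_zero.2 fun j hj => by simp [Nat.choose_eq_zero_of_lt hj]

lemma jacobi_zero : jacobi 0 c a = 1 := by simp [jacobi]

lemma coeff_X_mul_derivative (p : ℝ[X]) (j : ℕ) : (X * derivative p).coeff j = j * p.coeff j := by
  cases j with
  | zero => simp
  | succ j => rw [coeff_X_mul, coeff_derivative]; push_cast; ring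

lemma derivative_jacobi :
    derivative (jacobi x c a) = -((x * (x + c)) • jacobi (x - 1) (c + 2) (a + 1)) := by
  ext j
  rw [coeff_derivative, coeff_neg, coeff_smul, smul_eq_mul, jacobi_coeff, jacobi_coeff]
  cases x with
  | zero => simp
  | succ x =>
    have hmul : ((x + 1).choose (j + 1) : ℝ) * (j + 1) = (x + 1) * x.choose j := by
      exact_mod_cast (Nat.add_one_mul_choose_eq x j).symm
    rw [poch_succ_left, Nat.add_sub_cancel, Nat.add_sub_add_right]
    push_cast
    rw [show (x : ℝ) + 1 + c + 1 = x + (c + 2) by ring, show a + (j + 1) = a + 1 + j by ring]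
    linear_combination -((-1) ^ j * (x + 1 + c) * poch (x + (c + 2)) j *
      poch (a + 1 + j) (x - j)) * hmul

lemma jacobi_lower :
    (x : ℝ) • jacobi x c a - X * derivative (jacobi x c a) =
      (x * (a + x - 1)) • jacobi (x - 1) (c + 1) a := by
  ext j
  rw [coeff_sub, coeff_X_mul_derivative, coeff_smul, coeff_smul, smul_eq_mul, smul_eq_mul,
    jacobi_coeff, jacobi_coeff]
  rcases x with _ | x
  · cases j <;> simp
  have hchoose := mul_choose_pred (x + 1) j
  rw [Nat.add_sub_cancel] at hchoose ⊢
  rcases lt_or_ge x j with hj | hj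
  · rw [Nat.choose_eq_zero_of_lt hj] at hchoose ⊢
    push_cast at hchoose ⊢
    linear_combination -(-1) ^ j * poch (x + 1 + c) j * poch (a + j) (x + 1 - j) * hchoose
  · rw [Nat.succ_sub hj, poch_succ, Nat.cast_sub hj]
    push_cast at hchoose ⊢
    rw [show (x : ℝ) + 1 + c = x + (c + 1) by ring]
    linear_combination
      -(-1) ^ j * poch (x + (c + 1)) j * poch (a + j) (x - j) * (a + x) * hchoose

lemma jacobi_add_one_sub :
    jacobi x (c + 1) a - jacobi x c a = -((x : ℝ) • (X * jacobi (x - 1) (c + 2) (a + 1))) := by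
  ext j
  rw [coeff_sub, coeff_neg, coeff_smul, smul_eq_mul]
  cases j with
  | zero => simp
  | succ j =>
    rw [coeff_X_mul]
    simp only [jacobi_coeff]
    cases x with
    | zero => simp
    | succ x =>
      have hmul : ((x + 1).choose (j + 1) : ℝ) * (j + 1) = (x + 1) * x.choose j := by
        exact_mod_cast (Nat.add_one_mul_choose_eq x j).symm
      rw [poch_succ, poch_succ_left (_ + c), Nat.add_sub_cancel, Nat.add_sub_add_right]
      push_cast
      rw [show (x : ℝ) + 1 + (c + 1) = x + (c + 2) by ring,
        show (x : ℝ) + 1 + c + 1 = x + (c + 2) by ring, show a + (j + 1) = a + 1 + j by ring]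
      linear_combination -((-1) ^ j * poch (x + (c + 2)) j * poch (a + 1 + j) (x - j)) * hmul

lemma poch_add_one_sub (b : ℝ) (m : ℕ) : poch (b + 1) m - poch b m = m * poch (b + 1) (m - 1) := by
  cases m with
  | zero => simp
  | succ m => rw [poch_succ, poch_succ_left b, Nat.add_sub_cancel]; push_cast; ring

lemma jacobi_param_add_one_sub :
    jacobi x c (a + 1) - jacobi x c a = (x : ℝ) • jacobi (x - 1) (c + 1) (a + 1) := by
  ext j
  rw [coeff_sub, coeff_smul, smul_eq_mul]
  simp only [jacobi_coeff]
  rcases lt_or_ge x j with hj | hj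
  · simp [Nat.choose_eq_zero_of_lt hj, Nat.choose_eq_zero_of_lt (show x - 1 < j by omega)]
  have hpoch := poch_add_one_sub (a + j) (x - j)
  rw [Nat.cast_sub hj, add_right_comm, Nat.sub_right_comm] at hpoch
  have hx : (x : ℝ) * poch (((x - 1 : ℕ) : ℝ) + (c + 1)) j = x * poch (x + c) j := by
    cases x with
    | zero => simp
    | succ x => rw [Nat.add_sub_cancel]; push_cast; ring_nf
  linear_combination (-1) ^ j * x.choose j * poch (x + c) j * hpoch -
    (-1) ^ j * poch (x + c) j * poch (a + 1 + j) (x - 1 - j) * mul_choose_pred x j -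
    (-1) ^ j * (x - 1).choose j * poch (a + 1 + j) (x - 1 - j) * hx

lemma jacobi_succ_sub :
    jacobi (x + 1) c a - (a + x) • jacobi x c a =
      -((2 * x + c + 1) • (X * jacobi x (c + 1) (a + 1))) := by
  ext j
  rw [coeff_sub, coeff_neg, coeff_smul, coeff_smul, smul_eq_mul, smul_eq_mul]
  cases j with
  | zero => simp [poch_succ]; ring
  | succ j =>
    rw [coeff_X_mul]
    simp only [jacobi_coeff]
    have hpoch : (x.choose (j + 1) : ℝ) * (poch (a + (j + 1)) (x - (j + 1)) * (a + x)) =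
        x.choose (j + 1) * poch (a + 1 + j) (x - j) := by
      rcases lt_or_ge x (j + 1) with hj | hj
      · simp [Nat.choose_eq_zero_of_lt hj]
      · rw [show x - j = x - (j + 1) + 1 by omega, poch_succ, Nat.cast_sub hj]
        push_cast; ring_nf
    rw [poch_succ, poch_succ_left (x + c), Nat.add_sub_add_right, Nat.choose_succ_succ x j]
    push_cast
    rw [show (x : ℝ) + 1 + c = x + (c + 1) by ring, show (x : ℝ) + c + 1 = x + (c + 1) by ring,
      show a + (j + 1) = a + 1 + j by ring] at *
    linear_combination (-1) ^ j * (x + c) * poch (x + (c + 1)) j * hpoch -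
      (-1) ^ j * poch (x + (c + 1)) j * poch (a + 1 + j) (x - j) * choose_succ_mul_succ x j

lemma jacobi_raise :
    X * (1 - X) * derivative (jacobi x c a) + ((a - 1) • 1 - (c - 1) • X) * jacobi x c a =
      jacobi (x + 1) (c - 2) (a - 1) := by
  ext j
  rw [show X * (1 - X) * derivative (jacobi x c a) + ((a - 1) • 1 - (c - 1) • X) * jacobi x c a =
    X * derivative (jacobi x c a) + (a - 1) • jacobi x c a -
      X * (X * derivative (jacobi x c a) + (c - 1) • jacobi x c a) by algebra]
  cases j with
  | zero => simp [poch_succ_left]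
  | succ j =>
    simp only [coeff_sub, coeff_add, coeff_X_mul, coeff_smul, smul_eq_mul, coeff_derivative,
      coeff_X_mul_derivative, jacobi_coeff]
    have hpoch : (x.choose (j + 1) : ℝ) * ((a + j) * poch (a + (j + 1 : ℕ)) (x - (j + 1))) =
        x.choose (j + 1) * poch (a + j) (x - j) := by
      rcases lt_or_ge x (j + 1) with hj | hj
      · simp [Nat.choose_eq_zero_of_lt hj]
      · rw [show x - j = x - (j + 1) + 1 by omega, poch_succ_left]
        push_cast; ring_nf
    rw [poch_succ, poch_succ_left (_ + (c - 2)), Nat.add_sub_add_right, Nat.choose_succ_succ x j]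
    push_cast at hpoch ⊢
    rw [show (x : ℝ) + 1 + (c - 2) = x + c - 1 by ring, sub_add_cancel,
      show a - 1 + ((j : ℝ) + 1) = a + j by ring]
    linear_combination -(-1) ^ j * poch (x + c) j * (x + c + j) * hpoch -
      (-1) ^ j * poch (x + c) j * poch (a + j) (x - j) * choose_succ_mul_succ x j

lemma jacobi_ode :
    X * (1 - X) * derivative (derivative (jacobi x c a)) +
      (a • 1 - (c + 1) • X) * derivative (jacobi x c a) = -((x * (x + c)) • jacobi x c a) := by
  rcases x with _ | x
  · simp [jacobi_zero]
  have hraise := jacobi_raise x (c + 2) (a + 1)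
  rw [add_sub_cancel_right, add_sub_cancel_right, show c + 2 - 1 = c + 1 by ring] at hraise
  rw [derivative_jacobi, Nat.add_sub_cancel, derivative_neg, derivative_smul]
  linear_combination (norm := algebra) -(((x + 1 : ℕ) : ℝ) * ((x + 1 : ℕ) + c)) • hraise

lemma smul_jacobi_add_one :
    (x + c) • jacobi x (c + 1) a = (x + c) • jacobi x c a + X * derivative (jacobi x c a) := by
  have h := jacobi_add_one_sub x c a
  rw [derivative_jacobi]
  linear_combination (norm := algebra) (x + c) • h

lemma smul_jacobi_sub_smul :
    (x + a) • jacobi x c a - (x + c) • jacobi x (c + 1) (a + 1) =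
      (a - c - x) • jacobi x c (a + 1) := by
  have hlower := jacobi_lower x c (a + 1)
  have hparam := jacobi_param_add_one_sub x c a
  have hc := smul_jacobi_add_one x c (a + 1)
  linear_combination (norm := algebra) -(x + a) • hparam + hlower - hc

lemma two_mul_add_smul_jacobi :
    (2 * x + c) • jacobi x c a =
      (x + c) • jacobi x (c + 1) a + (x * (a + x - 1)) • jacobi (x - 1) (c + 1) a := by
  have hc := smul_jacobi_add_one x c a
  have hlower := jacobi_lower x c a
  linear_combination (norm := algebra) hlower - hc

lemma two_mul_add_smul_jacobi' :
    (2 * x + c) • jacobi x c a =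
      (x + c) • jacobi x (c + 1) (a + 1) -
        (x * (c - a + x)) • jacobi (x - 1) (c + 1) (a + 1) := by
  rcases x with _ | x
  · simp [jacobi_zero]
  have hlower := two_mul_add_smul_jacobi (x + 1) c a
  have hparam := jacobi_param_add_one_sub (x + 1) (c + 1) a
  have hsub := smul_jacobi_sub_smul x (c + 1) a
  rw [Nat.add_sub_cancel] at *
  push_cast at *
  rw [show c + 1 + 1 = c + 2 by ring] at *
  linear_combination (norm := algebra) hlower - (x + 1 + c) • hparam + ((x : ℝ) + 1) • hsub

lemma jacobi_succ_sub' :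
    jacobi (x + 1) c a - (a - c - x - 1) • jacobi x c a =
      (2 * x + c + 1) • ((1 - X) * jacobi x (c + 1) a) := by
  have hsucc := jacobi_succ_sub x c a
  have hc := jacobi_add_one_sub x c a
  have hparam := jacobi_param_add_one_sub x (c + 1) a
  rw [show c + 1 + 1 = c + 2 by ring] at hparam
  linear_combination (norm := algebra) hsucc - (2 * x + c + 1) • hc -
    (2 * x + c + 1) • (X * hparam)

variable {c} in
lemma smul_sub_X_mul_derivative_jacobi (N : ℝ) (h : 2 * x + c ≠ 0) :
    N • jacobi x c (a + 1) - X * derivative (jacobi x c (a + 1)) =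
      ((N - x) * (x + c) / (2 * x + c)) • jacobi x (c + 1) (a + 1) +
        (x * (x + c + N) / (2 * x + c) * (a + x)) • jacobi (x - 1) (c + 1) (a + 1) := by
  have hc := smul_jacobi_add_one x c (a + 1)
  have hlower := jacobi_lower x c (a + 1)
  apply smul_right_injective _ h
  simp only [smul_add, smul_smul, ← mul_assoc, mul_div_cancel₀ _ h]
  linear_combination (norm := algebra) (x + c + N) • hlower + (x - N) • hc

variable {c} in
lemma smul_add_one_sub_X_mul_derivative_jacobi (N : ℝ) (h : 2 * x + c ≠ 0) :
    N • jacobi x c a + (1 - X) * derivative (jacobi x c a) =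
      ((N - x) * (x + c) / (2 * x + c)) • jacobi x (c + 1) (a + 1) +
        (x * (x + c + N) / (2 * x + c) * (a - c - x)) • jacobi (x - 1) (c + 1) (a + 1) := by
  have htwo := two_mul_add_smul_jacobi' x c a
  have hc := smul_jacobi_add_one x c a
  have hparam := jacobi_param_add_one_sub x (c + 1) a
  have hder := derivative_jacobi x c a
  rw [show c + 1 + 1 = c + 2 by ring] at hparam
  apply smul_right_injective _ h
  simp only [smul_add, smul_smul, ← mul_assoc, mul_div_cancel₀ _ h]
  linear_combination (norm := algebra) (2 * x + c) • hder + (2 * x + c) • hc +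
    (N + x + c) • htwo + ((2 * x + c) * (x + c)) • hparam

end Jacobi

/-! ## Hahn polynomials -/

/-- The Hahn polynomials as functions on `{0, …, N}`, normalized so as to be polynomial in the
parameters: up to a factor independent of `n` this is
`₃F₂(-x, x + c, -n; a, -N; 1)`. They are the Bernstein coefficients of the Jacobi polynomials. -/
def hahnQ (N n x : ℕ) (c a : ℝ) : ℝ := bernsteinCoeff N n (jacobi x c a)

/-- The coefficient of the degree raising term in the relations `mul_hahnQ`, `mul_hahnQ_pred` and
`sub_mul_hahnQ_succ`. -/
def coeffUp (N x c : ℝ) : ℝ := -((N - x) * (x + c)) / ((2 * x + c) * (2 * x + c + 1))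

/-- The coefficient of the degree lowering term in the same relations. -/
def coeffDown (N x c : ℝ) : ℝ := x * (x + c + N) / ((2 * x + c) * (2 * x + c - 1))

lemma coeffUp_mul (N : ℝ) {x c : ℝ} (hup : 2 * x + c + 1 ≠ 0) :
    coeffUp N x c * (2 * x + c + 1) = -((N - x) * (x + c) / (2 * x + c)) := by
  rw [coeffUp, div_mul_eq_mul_div, mul_div_mul_right _ _ hup, neg_div]

lemma coeffDown_mul (N : ℝ) {x c : ℝ} (hdown : 2 * x + c - 1 ≠ 0) :
    coeffDown N x c * (2 * x + c - 1) = x * (x + c + N) / (2 * x + c) := by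
  rw [coeffDown, div_mul_eq_mul_div, mul_div_mul_right _ _ hdown]

lemma coeff_relation (N : ℝ) {x c : ℝ} (h : 2 * x + c ≠ 0) (hup : 2 * x + c + 1 ≠ 0)
    (hdown : 2 * x + c - 1 ≠ 0) :
    coeffDown N x c * (2 * x + c - 1) - coeffUp N x c * (2 * x + c + 1) = N := by
  rw [coeffUp_mul N hup, coeffDown_mul N hdown, sub_neg_eq_add, ← add_div, div_eq_iff h]
  ring

lemma hahnQ_eq_sum (N n x : ℕ) (c a : ℝ) :
    hahnQ N n x c a = ∑ j ∈ Finset.range (x + 1), (n.choose j : ℝ) / N.choose j *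
      ((-1) ^ j * x.choose j * poch (x + c) j * poch (a + j) (x - j)) := by
  simp only [hahnQ, jacobi, map_sum, bernsteinCoeff_monomial]

lemma hahnQ_zero (N n : ℕ) (c a : ℝ) : hahnQ N n 0 c a = 1 := by
  simp [hahnQ, jacobi_zero, bernsteinCoeff_one]

section Relations

open Polynomial

variable {N n x : ℕ} {c : ℝ} (a : ℝ)

lemma coeffUp_smul_jacobi (N : ℝ) (hup : 2 * x + c + 1 ≠ 0) :
    coeffUp N x c • (jacobi (x + 1) c a - (a + x) • jacobi x c a) =
      ((N - x) * (x + c) / (2 * x + c)) • (X * jacobi x (c + 1) (a + 1)) := by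
  rw [jacobi_succ_sub, smul_neg, smul_smul, coeffUp_mul N hup, neg_smul, neg_neg]

lemma coeffUp_smul_jacobi' (N : ℝ) (hup : 2 * x + c + 1 ≠ 0) :
    coeffUp N x c • (jacobi (x + 1) c a - (a - c - x - 1) • jacobi x c a) =
      -(((N - x) * (x + c) / (2 * x + c)) • ((1 - X) * jacobi x (c + 1) a)) := by
  rw [jacobi_succ_sub', smul_smul, coeffUp_mul N hup, neg_smul]

lemma coeffDown_smul_jacobi (N : ℝ) (hdown : 2 * x + c - 1 ≠ 0) :
    coeffDown N x c • ((a + x - 1) • jacobi (x - 1) c a - jacobi x c a) =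
      (x * (x + c + N) / (2 * x + c)) • (X * jacobi (x - 1) (c + 1) (a + 1)) := by
  rw [← coeffDown_mul N hdown]
  rcases x with _ | x
  · simp [coeffDown]
  have hsucc := jacobi_succ_sub x c a
  rw [Nat.add_sub_cancel]
  push_cast
  linear_combination (norm := algebra) -coeffDown N (x + 1) c • hsucc

lemma coeffDown_smul_jacobi' (N : ℝ) (hdown : 2 * x + c - 1 ≠ 0) :
    coeffDown N x c • ((a - c - x) • jacobi (x - 1) c a - jacobi x c a) =
      -((x * (x + c + N) / (2 * x + c)) • ((1 - X) * jacobi (x - 1) (c + 1) a)) := by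
  rw [← coeffDown_mul N hdown]
  rcases x with _ | x
  · simp [coeffDown]
  have hsucc := jacobi_succ_sub' x c a
  rw [Nat.add_sub_cancel]
  push_cast
  linear_combination (norm := algebra) -coeffDown N (x + 1) c • hsucc

lemma mul_hahnQ (hn : n ≤ N) (h : 2 * x + c ≠ 0) (hup : 2 * x + c + 1 ≠ 0)
    (hdown : 2 * x + c - 1 ≠ 0) :
    n * hahnQ N n x c a =
      coeffUp N x c * (hahnQ N n (x + 1) c a - (a + x) * hahnQ N n x c a) +
        coeffDown N x c * (a - c - x) *
          ((a + x - 1) * hahnQ N n (x - 1) c a - hahnQ N n x c a) := by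
  have hjacobi : X * ((N : ℝ) • jacobi x c a + (1 - X) * derivative (jacobi x c a)) =
      coeffUp N x c • (jacobi (x + 1) c a - (a + x) • jacobi x c a) +
        (coeffDown N x c * (a - c - x)) •
          ((a + x - 1) • jacobi (x - 1) c a - jacobi x c a) := by
    rw [smul_add_one_sub_X_mul_derivative_jacobi _ _ _ h, coeffUp_smul_jacobi a _ hup, mul_comm,
      mul_smul (coeffDown _ _ _), smul_comm, coeffDown_smul_jacobi a _ hdown]
    algebra
  simpa only [hahnQ, map_add, map_sub, map_smul, smul_eq_mul, bernsteinCoeff_X_mul_add hn]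
    using congrArg (bernsteinCoeff N n) hjacobi

lemma mul_hahnQ_pred (hn : n ≤ N) (h : 2 * x + c ≠ 0) (hup : 2 * x + c + 1 ≠ 0)
    (hdown : 2 * x + c - 1 ≠ 0) :
    n * hahnQ N (n - 1) x c (a + 1) =
      coeffUp N x c * (hahnQ N n (x + 1) c a - (a + x) * hahnQ N n x c a) +
        coeffDown N x c * (a + x) *
          ((a + x - 1) * hahnQ N n (x - 1) c a - hahnQ N n x c a) := by
  have hjacobi : X * ((N : ℝ) • jacobi x c (a + 1) - X * derivative (jacobi x c (a + 1))) =
      coeffUp N x c • (jacobi (x + 1) c a - (a + x) • jacobi x c a) +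
        (coeffDown N x c * (a + x)) •
          ((a + x - 1) • jacobi (x - 1) c a - jacobi x c a) := by
    rw [smul_sub_X_mul_derivative_jacobi _ _ _ h, coeffUp_smul_jacobi a _ hup, mul_comm,
      mul_smul (coeffDown _ _ _), smul_comm, coeffDown_smul_jacobi a _ hdown]
    algebra
  simpa only [hahnQ, map_add, map_sub, map_smul, smul_eq_mul, bernsteinCoeff_X_mul_sub hn]
    using congrArg (bernsteinCoeff N n) hjacobi

lemma sub_mul_hahnQ_succ (hn : n ≤ N) (hx : x ≤ N) (h : 2 * x + c ≠ 0) (hup : 2 * x + c + 1 ≠ 0)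
    (hdown : 2 * x + c - 1 ≠ 0) :
    (N - n) * hahnQ N (n + 1) x c (a - 1) =
      coeffDown N x c * (a - c - x - 1) *
          (hahnQ N n x c a - (a - c - x) * hahnQ N n (x - 1) c a) -
        coeffUp N x c * (hahnQ N n (x + 1) c a - (a - c - x - 1) * hahnQ N n x c a) := by
  have hjacobi : (1 - X) *
        ((N : ℝ) • jacobi x c (a - 1) + (1 - X) * derivative (jacobi x c (a - 1))) =
      (coeffDown N x c * (a - c - x - 1)) •
          (jacobi x c a - (a - c - x) • jacobi (x - 1) c a) -
        coeffUp N x c • (jacobi (x + 1) c a - (a - c - x - 1) • jacobi x c a) := by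
    have hdown' := coeffDown_smul_jacobi' a N hdown
    rw [smul_add_one_sub_X_mul_derivative_jacobi _ _ _ h, coeffUp_smul_jacobi' a _ hup,
      sub_add_cancel]
    linear_combination (norm := algebra) (a - c - x - 1) • hdown'
  simpa only [hahnQ, map_sub, map_smul, smul_eq_mul,
    bernsteinCoeff_one_sub_X_mul_add hn ((natDegree_jacobi_le x c (a - 1)).trans hx)]
    using congrArg (bernsteinCoeff N n) hjacobi

lemma hahnQ_lower (hx : x ≤ N) (n : ℕ) (c : ℝ) :
    (N - n) * (hahnQ N (n + 1) x c a - hahnQ N n x c a) +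
        n * (hahnQ N n x c a - hahnQ N (n - 1) x c a) =
      -(x * (x + c) * hahnQ N n (x - 1) (c + 2) (a + 1)) := by
  simp only [hahnQ]
  rw [← bernsteinCoeff_derivative ((natDegree_jacobi_le x c a).trans hx), derivative_jacobi,
    map_neg, map_smul, smul_eq_mul]

lemma hahnQ_difference (hn : n ≤ N) (hx : x ≤ N) (c : ℝ) :
    (a + n) * (N - n) * (hahnQ N (n + 1) x c a - hahnQ N n x c a) +
        n * (c + N + 1 - a - n) * (hahnQ N (n - 1) x c a - hahnQ N n x c a) =
      -(x * (x + c) * hahnQ N n x c a) := by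
  set p := jacobi x c a with hp
  have hode := congrArg (bernsteinCoeff N n) (jacobi_ode x c a)
  have hup := bernsteinCoeff_one_sub_X_mul_derivative ((natDegree_jacobi_le x c a).trans hx) n
  have hdown := bernsteinCoeff_X_mul_derivative N n p
  have hup' := bernsteinCoeff_X_mul_add hn ((1 - X) * derivative p)
  have hdown' := bernsteinCoeff_X_mul_add hn (X * derivative p)
  have hsum : X * (1 - X) * derivative (derivative p) + (a • 1 - (c + 1) • X) * derivative p =
      a • ((1 - X) * derivative p) +
        X * ((N : ℝ) • ((1 - X) * derivative p) + (1 - X) * derivative ((1 - X) * derivative p)) -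
        (c + N + 1 - a) • (X * derivative p) +
        X * ((N : ℝ) • (X * derivative p) + (1 - X) * derivative (X * derivative p)) := by
    simp only [derivative_mul, derivative_sub, derivative_one, derivative_X]
    algebra
  rw [← hp, hsum] at hode
  simp only [map_add, map_sub, map_neg, map_smul, smul_eq_mul, hup', hdown', hdown] at hode
  rw [hup] at hode
  simp only [hahnQ, ← hp] at *
  linear_combination hode

lemma hahnQ_raise (hn : n ≤ N) (x : ℕ) (c : ℝ) :
    (N - x) * (c + N + x) * hahnQ N n (x + 1) (c - 2) (a - 1) =
      (N - x) * (c + N + x) * (a + n - 1) * hahnQ N n x c a -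
        (c + N - 1) * n * ((a + n - 1) * hahnQ N n x c a -
          (a + n - 1 - c - N) * hahnQ N (n - 1) x c a) := by
  set p := jacobi x c a with hp
  have hX : ((N - x) * (c + N + x)) • (X * p) =
      X * ((N : ℝ) • ((c + N) • p + X * derivative p) -
        X * derivative ((c + N) • p + X * derivative p)) +
      (X * derivative (X * derivative p) + (a - 1) • (X * derivative p)) := by
    have hode := jacobi_ode x c a
    rw [← hp] at hode
    simp only [derivative_mul, derivative_add, derivative_smul, derivative_X]
    linear_combination (norm := algebra) -(X * hode)
  have hbern := congrArg (bernsteinCoeff N n) hX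
  have hraise := congrArg (bernsteinCoeff N n) (jacobi_raise x c a)
  have hmul := bernsteinCoeff_X_mul_add hn p
  rw [← hp, show X * (1 - X) * derivative p + ((a - 1) • 1 - (c - 1) • X) * p =
    X * ((N : ℝ) • p + (1 - X) * derivative p) + (a - 1) • p - (c + N - 1) • (X * p) by algebra,
    map_sub, map_add, hmul] at hraise
  rw [map_add, bernsteinCoeff_X_mul_sub hn] at hbern
  simp only [map_add, map_smul, smul_eq_mul, bernsteinCoeff_X_mul_derivative] at hbern hraise
  simp only [hahnQ, ← hp]
  linear_combination (-(N - x) * (c + N + x)) * hraise - (c + N - 1) * hbern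

end Relations

/-! ## Duality for two sites -/

/-- The duality function for two neighbouring sites, up to factors that depend only on the total
numbers of particles. Here `r` is the height to the right of the second site. -/
def twoSite (N₁ N₂ : ℕ) (A r : ℝ) (x₁ x₂ n₁ n₂ : ℕ) : ℝ :=
  hahnQ N₁ n₁ x₁ (r + 2 * x₂ - N₂ - N₁) (A + x₂) * hahnQ N₂ n₂ x₂ (r - N₂) (A + n₁)

/-- The rate of a jump from the first to the second of two sites of the dynamic process, in terms
of the height `h` at the second site. -/
def rateRight (N₁ N₂ x₁ x₂ h : ℝ) : ℝ :=
  x₁ * (N₂ - x₂) * (h + (2 * x₁ - N₁) - x₁) * (h - x₂) / (h * (h + 1))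

/-- The rate of a jump from the second to the first of two sites of the dynamic process, in terms
of the height `h` at the second site. -/
def rateLeft (N₁ N₂ x₁ x₂ h : ℝ) : ℝ :=
  x₂ * (N₁ - x₁) * (h + x₁) * (h - (2 * x₂ - N₂) + x₂) / (h * (h - 1))

lemma rateRight_eq_coeffUp (N₁ N₂ x₁ x₂ c : ℝ) :
    rateRight N₁ N₂ x₁ x₂ (2 * x₂ + c) =
      -coeffUp N₂ x₂ c * (x₁ * (x₁ + (2 * x₂ + c - N₁))) := by
  rw [rateRight, coeffUp, neg_div, neg_neg, div_mul_eq_mul_div]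
  ring_nf

lemma rateLeft_eq_coeffDown (N₁ N₂ x₁ x₂ c : ℝ) :
    rateLeft N₁ N₂ x₁ x₂ (2 * x₂ + c) =
      coeffDown N₂ x₂ c * ((N₁ - x₁) * (2 * x₂ + c - N₁ + N₁ + x₁)) := by
  rw [rateLeft, coeffDown, div_mul_eq_mul_div]
  ring_nf

section

variable {N₁ N₂ x₁ x₂ n₁ n₂ : ℕ}

lemma hahnQ_mul_hahnQ_duality (hx₁ : x₁ ≤ N₁) (hx₂ : x₂ ≤ N₂) (hn₁ : n₁ ≤ N₁) (hn₂ : n₂ ≤ N₂)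
    (A : ℝ) {c h : ℝ} (hh : h = 2 * x₂ + c) (h0 : h ≠ 0) (hup : h + 1 ≠ 0) (hdown : h - 1 ≠ 0) :
    n₁ * (N₂ - n₂) * (hahnQ N₁ (n₁ - 1) x₁ (h - N₁) (A + x₂) *
          hahnQ N₂ (n₂ + 1) x₂ c (A + n₁ - 1) -
        hahnQ N₁ n₁ x₁ (h - N₁) (A + x₂) * hahnQ N₂ n₂ x₂ c (A + n₁)) +
      n₂ * (N₁ - n₁) * (hahnQ N₁ (n₁ + 1) x₁ (h - N₁) (A + x₂) *
          hahnQ N₂ (n₂ - 1) x₂ c (A + n₁ + 1) -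
        hahnQ N₁ n₁ x₁ (h - N₁) (A + x₂) * hahnQ N₂ n₂ x₂ c (A + n₁)) =
    rateRight N₁ N₂ x₁ x₂ h * (hahnQ N₁ n₁ (x₁ - 1) (h - N₁ + 2) (A + x₂ + 1) *
          hahnQ N₂ n₂ (x₂ + 1) c (A + n₁) -
        hahnQ N₁ n₁ x₁ (h - N₁) (A + x₂) * hahnQ N₂ n₂ x₂ c (A + n₁)) +
      rateLeft N₁ N₂ x₁ x₂ h * (hahnQ N₁ n₁ (x₁ + 1) (h - N₁ - 2) (A + x₂ - 1) *
          hahnQ N₂ n₂ (x₂ - 1) c (A + n₁) -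
        hahnQ N₁ n₁ x₁ (h - N₁) (A + x₂) * hahnQ N₂ n₂ x₂ c (A + n₁)) := by
  subst hh
  rw [rateRight_eq_coeffUp, rateLeft_eq_coeffDown]
  have hcoeff := coeff_relation (N₂ : ℝ) h0 hup hdown
  have hmul := mul_hahnQ (A + n₁) hn₂ h0 hup hdown
  have hpred := mul_hahnQ_pred (A + n₁) hn₂ h0 hup hdown
  have hsucc := sub_mul_hahnQ_succ (A + n₁) hn₂ hx₂ h0 hup hdown
  have hlower := hahnQ_lower (A + x₂) hx₁ n₁ (2 * x₂ + c - N₁)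
  have hdifference := hahnQ_difference (A + x₂) hn₁ hx₁ (2 * x₂ + c - N₁)
  have hraise := hahnQ_raise (A + x₂) hn₁ x₁ (2 * x₂ + c - N₁)
  set U := coeffUp N₂ x₂ c
  set K := coeffDown N₂ x₂ c
  set q := hahnQ N₁ n₁ x₁ (2 * x₂ + c - N₁) (A + x₂)
  set qDown := hahnQ N₁ (n₁ - 1) x₁ (2 * x₂ + c - N₁) (A + x₂)
  set qUp := hahnQ N₁ (n₁ + 1) x₁ (2 * x₂ + c - N₁) (A + x₂)
  set p := hahnQ N₂ n₂ x₂ c (A + n₁)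
  set pUp := hahnQ N₂ n₂ (x₂ + 1) c (A + n₁)
  set pDown := hahnQ N₂ n₂ (x₂ - 1) c (A + n₁)
  linear_combination n₁ * qDown * hsucc + (N₁ - n₁) * qUp * hpred - (N₁ - 2 * n₁) * q * hmul +
    U * pUp * hlower - K * pDown * hraise +
    (K * pDown * (A + n₁ + x₂ - 1) - (U + K) * p) * hdifference + n₁ * p * q * hcoeff

lemma twoSite_duality_of_ne_zero (hx₁ : x₁ ≤ N₁) (hx₂ : x₂ ≤ N₂) (hn₁ : n₁ ≤ N₁)
    (hn₂ : n₂ ≤ N₂) (A : ℝ) {r h : ℝ} (hh : h = r + 2 * x₂ - N₂) (h0 : h ≠ 0) (hup : h + 1 ≠ 0)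
    (hdown : h - 1 ≠ 0) :
    n₁ * (N₂ - n₂) * (twoSite N₁ N₂ A r x₁ x₂ (n₁ - 1) (n₂ + 1) -
        twoSite N₁ N₂ A r x₁ x₂ n₁ n₂) +
      n₂ * (N₁ - n₁) * (twoSite N₁ N₂ A r x₁ x₂ (n₁ + 1) (n₂ - 1) -
        twoSite N₁ N₂ A r x₁ x₂ n₁ n₂) =
    rateRight N₁ N₂ x₁ x₂ h * (twoSite N₁ N₂ A r (x₁ - 1) (x₂ + 1) n₁ n₂ -
        twoSite N₁ N₂ A r x₁ x₂ n₁ n₂) +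
      rateLeft N₁ N₂ x₁ x₂ h * (twoSite N₁ N₂ A r (x₁ + 1) (x₂ - 1) n₁ n₂ -
        twoSite N₁ N₂ A r x₁ x₂ n₁ n₂) := by
  have hprod := hahnQ_mul_hahnQ_duality hx₁ hx₂ hn₁ hn₂ A (c := r - N₂)
    (by rw [hh]; ring) h0 hup hdown
  have hn₁_pred : (n₁ : ℝ) * twoSite N₁ N₂ A r x₁ x₂ (n₁ - 1) (n₂ + 1) =
      n₁ * (hahnQ N₁ (n₁ - 1) x₁ (h - N₁) (A + x₂) *
        hahnQ N₂ (n₂ + 1) x₂ (r - N₂) (A + n₁ - 1)) := by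
    rcases n₁ with _ | n₁
    · simp
    · rw [twoSite, hh, Nat.add_sub_cancel, Nat.cast_succ, ← add_assoc, add_sub_cancel_right]
  have hx₂_pred : rateLeft N₁ N₂ x₁ x₂ h * twoSite N₁ N₂ A r (x₁ + 1) (x₂ - 1) n₁ n₂ =
      rateLeft N₁ N₂ x₁ x₂ h * (hahnQ N₁ n₁ (x₁ + 1) (h - N₁ - 2) (A + x₂ - 1) *
        hahnQ N₂ n₂ (x₂ - 1) (r - N₂) (A + n₁)) := by
    rcases x₂ with _ | x₂
    · simp [rateLeft]
    · rw [twoSite, hh, Nat.add_sub_cancel]; push_cast; ring_nf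
  have hn₁_succ : twoSite N₁ N₂ A r x₁ x₂ (n₁ + 1) (n₂ - 1) =
      hahnQ N₁ (n₁ + 1) x₁ (h - N₁) (A + x₂) *
        hahnQ N₂ (n₂ - 1) x₂ (r - N₂) (A + n₁ + 1) := by
    rw [twoSite, hh, Nat.cast_succ, add_assoc]
  have hx₂_succ : twoSite N₁ N₂ A r (x₁ - 1) (x₂ + 1) n₁ n₂ =
      hahnQ N₁ n₁ (x₁ - 1) (h - N₁ + 2) (A + x₂ + 1) *
        hahnQ N₂ n₂ (x₂ + 1) (r - N₂) (A + n₁) := by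
    rw [twoSite, hh]; push_cast; ring_nf
  have hself : twoSite N₁ N₂ A r x₁ x₂ n₁ n₂ =
      hahnQ N₁ n₁ x₁ (h - N₁) (A + x₂) * hahnQ N₂ n₂ x₂ (r - N₂) (A + n₁) := by
    rw [twoSite, hh]
  rw [hn₁_succ, hx₂_succ, hself]
  linear_combination hprod + (N₂ - n₂) * hn₁_pred - hx₂_pred

lemma continuous_hahnQ {X : Type*} [TopologicalSpace X] (N n x : ℕ) {c a : X → ℝ}
    (hc : Continuous c) (ha : Continuous a) : Continuous fun t => hahnQ N n x (c t) (a t) := by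
  simp only [hahnQ_eq_sum]
  exact continuous_finsetSum _ fun j _ => continuous_const.mul
    ((continuous_const.mul ((continuous_poch j).comp (continuous_const.add hc))).mul
      ((continuous_poch _).comp (ha.add continuous_const)))

lemma continuous_twoSite (N₁ N₂ : ℕ) (A : ℝ) (x₁ x₂ n₁ n₂ : ℕ) :
    Continuous fun r => twoSite N₁ N₂ A r x₁ x₂ n₁ n₂ :=
  (continuous_hahnQ _ _ _ (by fun_prop) continuous_const).mul
    (continuous_hahnQ _ _ _ (by fun_prop) continuous_const)

lemma continuousAt_rateRight (N₁ : ℝ) {h : ℝ} (hx₂ : x₂ ≤ N₂)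
    (hdef : 0 < x₁ → x₂ < N₂ → h ≠ 0 ∧ h + 1 ≠ 0) :
    ContinuousAt (rateRight N₁ N₂ x₁ x₂) h := by
  unfold rateRight
  rcases Nat.eq_zero_or_pos x₁ with rfl | hpos
  · simp [continuousAt_const]
  rcases hx₂.eq_or_lt with rfl | hlt
  · simp [continuousAt_const]
  obtain ⟨h0, hup⟩ := hdef hpos hlt
  exact ContinuousAt.div (by fun_prop) (by fun_prop) (mul_ne_zero h0 hup)

lemma continuousAt_rateLeft (N₂ : ℝ) {h : ℝ} (hx₁ : x₁ ≤ N₁)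
    (hdef : 0 < x₂ → x₁ < N₁ → h ≠ 0 ∧ h - 1 ≠ 0) :
    ContinuousAt (rateLeft N₁ N₂ x₁ x₂) h := by
  unfold rateLeft
  rcases Nat.eq_zero_or_pos x₂ with rfl | hpos
  · simp [continuousAt_const]
  rcases hx₁.eq_or_lt with rfl | hlt
  · simp [continuousAt_const]
  obtain ⟨h0, hdown⟩ := hdef hpos hlt
  exact ContinuousAt.div (by fun_prop) (by fun_prop) (mul_ne_zero h0 hdown)

/-- At the excluded heights the denominators that vanish belong to jumps of rate zero, so that
both sides of the relation are continuous there. -/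
lemma twoSite_duality (hx₁ : x₁ ≤ N₁) (hx₂ : x₂ ≤ N₂) (hn₁ : n₁ ≤ N₁) (hn₂ : n₂ ≤ N₂)
    (A : ℝ) {r h : ℝ} (hh : h = r + 2 * x₂ - N₂)
    (hright : 0 < x₁ → x₂ < N₂ → h ≠ 0 ∧ h + 1 ≠ 0)
    (hleft : 0 < x₂ → x₁ < N₁ → h ≠ 0 ∧ h - 1 ≠ 0) :
    n₁ * (N₂ - n₂) * (twoSite N₁ N₂ A r x₁ x₂ (n₁ - 1) (n₂ + 1) -
        twoSite N₁ N₂ A r x₁ x₂ n₁ n₂) +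
      n₂ * (N₁ - n₁) * (twoSite N₁ N₂ A r x₁ x₂ (n₁ + 1) (n₂ - 1) -
        twoSite N₁ N₂ A r x₁ x₂ n₁ n₂) =
    rateRight N₁ N₂ x₁ x₂ h * (twoSite N₁ N₂ A r (x₁ - 1) (x₂ + 1) n₁ n₂ -
        twoSite N₁ N₂ A r x₁ x₂ n₁ n₂) +
      rateLeft N₁ N₂ x₁ x₂ h * (twoSite N₁ N₂ A r (x₁ + 1) (x₂ - 1) n₁ n₂ -
        twoSite N₁ N₂ A r x₁ x₂ n₁ n₂) := by
  have hdiff (y₁ y₂ m₁ m₂ : ℕ) : ContinuousAt (fun r => twoSite N₁ N₂ A r y₁ y₂ m₁ m₂ -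
      twoSite N₁ N₂ A r x₁ x₂ n₁ n₂) r :=
    ((continuous_twoSite ..).sub (continuous_twoSite ..)).continuousAt
  have hheight : ContinuousAt (fun r : ℝ => r + 2 * x₂ - N₂) r := by fun_prop
  have hgeneric : ∀ᶠ s in 𝓝[≠] r,
      s ∉ ({(N₂ : ℝ) - 2 * x₂, (N₂ : ℝ) - 2 * x₂ - 1, (N₂ : ℝ) - 2 * x₂ + 1} : Set ℝ) :=
    nhdsNE_le_cofinite r (Set.toFinite _).eventually_cofinite_notMem
  subst hh
  have hrateRight := (continuousAt_rateRight N₁ hx₂ hright).comp_of_eq hheight rfl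
  have hrateLeft := (continuousAt_rateLeft N₂ hx₁ hleft).comp_of_eq hheight rfl
  refine ((ContinuousAt.eventuallyEq_nhds_iff_eventuallyEq_nhdsNE
    ((continuousAt_const.mul (hdiff ..)).add (continuousAt_const.mul (hdiff ..)))
    ((hrateRight.mul (hdiff ..)).add (hrateLeft.mul (hdiff ..)))).mp ?_).eq_of_nhds
  filter_upwards [hgeneric] with s hs
  simp only [Set.mem_insert_iff, Set.mem_singleton_iff, not_or] at hs
  exact twoSite_duality_of_ne_zero hx₁ hx₂ hn₁ hn₂ A rfl (fun h => hs.1 (by linarith))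
    (fun h => hs.2.1 (by linarith)) fun h => hs.2.2 (by linarith)

end

/-! ## Nearest neighbour particle systems -/

section LocalChanges

variable {M : ℕ} {N : Fin M → ℕ}

lemma conf_le (η : Conf N) (k : Fin M) : (η k : ℕ) ≤ N k := Nat.lt_succ_iff.1 (η k).isLt

lemma ne_of_val_eq_val_add_one {k l : Fin M} (hl : (l : ℕ) = k + 1) : k ≠ l := by
  rintro rfl
  omega

/-- A particle can jump from site `k` to site `l`. -/
def CanMove (η : Conf N) (k l : Fin M) : Prop := 0 < (η k : ℕ) ∧ (η l : ℕ) < N l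

/-- The configurations `η` and `η'` differ only in the distribution of the particles over the sites
`k` and `l`. -/
structure LocalChange (k l : Fin M) (η η' : Conf N) : Prop where
  eq_off : ∀ j, j ≠ k → j ≠ l → η' j = η j
  pair_sum : (η' k : ℕ) + η' l = (η k : ℕ) + η l

lemma LocalChange.refl (k l : Fin M) (η : Conf N) : LocalChange k l η η :=
  ⟨fun _ _ _ => rfl, rfl⟩

lemma LocalChange.comm {k l : Fin M} {η η' : Conf N} (h : LocalChange k l η η') :
    LocalChange l k η η' :=
  ⟨fun j hjl hjk => h.eq_off j hjk hjl, by rw [add_comm, h.pair_sum, add_comm]⟩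

lemma move_apply_source (η : Conf N) (k l : Fin M) : (move η k l k : ℕ) = η k - 1 := by
  simp [move]

lemma move_apply_target {η : Conf N} {k l : Fin M} (hkl : k ≠ l) (hl : (η l : ℕ) < N l) :
    (move η k l l : ℕ) = η l + 1 := by
  simp only [move, hkl.symm, if_false, if_true]
  exact min_eq_left hl

lemma CanMove.localChange {η : Conf N} {k l : Fin M} (h : CanMove η k l) (hkl : k ≠ l) :
    LocalChange k l η (move η k l) := by
  refine ⟨fun j hjk hjl => by simp [move, hjk, hjl], ?_⟩
  have := h.1
  rw [move_apply_source, move_apply_target hkl h.2]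
  omega

lemma CanMove.move {η : Conf N} {k l : Fin M} (h : CanMove η k l) (hkl : k ≠ l) :
    CanMove (move η k l) l k := by
  have := h.1
  have := conf_le η k
  rw [CanMove, move_apply_source, move_apply_target hkl h.2]
  omega

lemma CanMove.move_move {η : Conf N} {k l : Fin M} (h : CanMove η k l) (hkl : k ≠ l) :
    ExclusionDuality.move (ExclusionDuality.move η k l) l k = η := by
  have hpos := h.1
  funext j
  apply Fin.ext
  rcases eq_or_ne j l with rfl | hjl
  · rw [move_apply_source, move_apply_target hkl h.2, Nat.add_sub_cancel]
  rcases eq_or_ne j k with rfl | hjk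
  · rw [move_apply_target hkl.symm (h.move hkl).2, move_apply_source]
    omega
  · simp [ExclusionDuality.move, hjl, hjk]

lemma canMove_and_move_eq_iff {η η' : Conf N} {k l : Fin M} (hkl : k ≠ l) :
    CanMove η k l ∧ move η k l = η' ↔ CanMove η' l k ∧ move η' l k = η := by
  constructor
  · rintro ⟨h, rfl⟩
    exact ⟨h.move hkl, h.move_move hkl⟩
  · rintro ⟨h, rfl⟩
    exact ⟨h.move hkl.symm, h.move_move hkl.symm⟩

@[to_additive]
lemma prod_eq_mul_mul_prod_erase {R : Type*} [CommMonoid R] {k l : Fin M} (hkl : k ≠ l)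
    (f : Fin M → R) :
    ∏ j, f j = f k * f l * ∏ j ∈ (Finset.univ.erase k).erase l, f j := by
  rw [← Finset.mul_prod_erase _ f (Finset.mem_univ k),
    ← Finset.mul_prod_erase (Finset.univ.erase k) f
      (Finset.mem_erase.2 ⟨hkl.symm, Finset.mem_univ l⟩), mul_assoc]

lemma sum_eq_of_eq_off_pair {R : Type*} [AddCommMonoid R] {k l : Fin M} (hkl : k ≠ l)
    {f g : Fin M → R} (hoff : ∀ j, j ≠ k → j ≠ l → f j = g j) (hpair : f k + f l = g k + g l) :
    ∑ j, f j = ∑ j, g j := by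
  rw [sum_eq_add_add_sum_erase hkl f, sum_eq_add_add_sum_erase hkl g, hpair]
  refine congrArg _ (Finset.sum_congr rfl fun j hj => ?_)
  obtain ⟨hjl, hjk, -⟩ := by simpa only [Finset.mem_erase] using hj
  exact hoff j hjk hjl

lemma LocalChange.total_eq {k l : Fin M} (hkl : k ≠ l) {η η' : Conf N}
    (h : LocalChange k l η η') : total η' = total η :=
  sum_eq_of_eq_off_pair hkl (fun j hjk hjl => by rw [h.eq_off j hjk hjl]) h.pair_sum

end LocalChanges

section JumpProcesses

variable {M : ℕ} {N : Fin M → ℕ}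

/-- The rates `right η k l` of the jumps from `k` to `l` and `left η k l` of the jumps from `l` to
`k` vanish if the jump is impossible. -/
structure ProperRates (right left : Conf N → Fin M → Fin M → ℝ) : Prop where
  right_eq_zero : ∀ {η k l}, ¬CanMove η k l → right η k l = 0
  left_eq_zero : ∀ {η k l}, ¬CanMove η l k → left η k l = 0

lemma jump_term {k l : Fin M} (hkl : k ≠ l) (η : Conf N) {r : ℝ} {f : Conf N → ℝ}
    {t : ℕ → ℕ → ℝ} (hr : ¬CanMove η k l → r = 0)
    (ht : ∀ η', LocalChange k l η η' → f η' = t (η' k) (η' l)) :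
    r * (f (move η k l) - f η) = r * (t (η k - 1) (η l + 1) - t (η k) (η l)) := by
  by_cases h : CanMove η k l
  · rw [ht _ (h.localChange hkl), ht _ (LocalChange.refl k l η), move_apply_source,
      move_apply_target hkl h.2]
  · rw [hr h, zero_mul, zero_mul]

lemma isDuality_of_local {r₁ l₁ r₂ l₂ : Conf N → Fin M → Fin M → ℝ} {D : Conf N → Conf N → ℝ}
    (h₁ : ProperRates r₁ l₁) (h₂ : ProperRates r₂ l₂)
    (hD : ∀ (η ξ : Conf N) (k l : Fin M), (l : ℕ) = (k : ℕ) + 1 →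
      ∃ (C : ℝ) (t : ℕ → ℕ → ℕ → ℕ → ℝ),
        (∀ η' ξ', LocalChange k l η η' → LocalChange k l ξ ξ' →
          D η' ξ' = C * t (ξ' k) (ξ' l) (η' k) (η' l)) ∧
        r₁ η k l * (t (ξ k) (ξ l) (η k - 1) (η l + 1) - t (ξ k) (ξ l) (η k) (η l)) +
          l₁ η k l * (t (ξ k) (ξ l) (η k + 1) (η l - 1) - t (ξ k) (ξ l) (η k) (η l)) =
        r₂ ξ k l * (t (ξ k - 1) (ξ l + 1) (η k) (η l) - t (ξ k) (ξ l) (η k) (η l)) +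
          l₂ ξ k l * (t (ξ k + 1) (ξ l - 1) (η k) (η l) - t (ξ k) (ξ l) (η k) (η l))) :
    IsDuality (jumpGenerator r₁ l₁) (jumpGenerator r₂ l₂) D := by
  intro η ξ
  refine Finset.sum_congr rfl fun k _ => Finset.sum_congr rfl fun l _ => ?_
  split_ifs with hl
  swap
  · rfl
  have hkl := ne_of_val_eq_val_add_one hl
  obtain ⟨C, t, hC, ht⟩ := hD η ξ k l hl
  rw [jump_term (f := fun η' => D η' ξ) (t := fun m n => C * t (ξ k) (ξ l) m n) hkl η
      h₁.right_eq_zero fun η' h => hC η' ξ h (.refl k l ξ),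
    jump_term (f := fun η' => D η' ξ) (t := fun m n => C * t (ξ k) (ξ l) n m) hkl.symm η
      h₁.left_eq_zero fun η' h => hC η' ξ h.comm (.refl k l ξ),
    jump_term (f := fun ξ' => D η ξ') (t := fun m n => C * t m n (η k) (η l)) hkl ξ
      h₂.right_eq_zero fun ξ' h => hC η ξ' (.refl k l η) h,
    jump_term (f := fun ξ' => D η ξ') (t := fun m n => C * t n m (η k) (η l)) hkl.symm ξ
      h₂.left_eq_zero fun ξ' h => hC η ξ' (.refl k l η) h.comm]
  linear_combination C * ht

open Classical in
lemma ProperRates.jumpGenerator_single_of_ne {right left : Conf N → Fin M → Fin M → ℝ}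
    (hproper : ProperRates right left) {η η' : Conf N} (hη : η ≠ η') :
    jumpGenerator right left (Pi.single η' 1) η =
      ∑ k : Fin M, ∑ l : Fin M, if (l : ℕ) = (k : ℕ) + 1 then
        (if CanMove η k l ∧ move η k l = η' then right η k l else 0) +
          (if CanMove η l k ∧ move η l k = η' then left η k l else 0) else 0 := by
  refine Finset.sum_congr rfl fun k _ => Finset.sum_congr rfl fun l _ => ?_
  congr 1
  simp only [Pi.single_apply, hη, if_false, sub_zero, mul_ite, mul_one, mul_zero]
  congr 1
  · by_cases h : CanMove η k l <;> simp [h, hproper.right_eq_zero]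
  · by_cases h : CanMove η l k <;> simp [h, hproper.left_eq_zero]

lemma isReversible_of_detailed_balance {right left : Conf N → Fin M → Fin M → ℝ}
    (hproper : ProperRates right left) {μ : Conf N → ℝ}
    (hμ : ∀ (η : Conf N) (k l : Fin M), (l : ℕ) = (k : ℕ) + 1 → CanMove η k l →
      μ η * right η k l = μ (move η k l) * left (move η k l) k l) :
    IsReversible (jumpGenerator right left) μ := by
  classical
  have hswap (η η' : Conf N) {k l : Fin M} (hl : (l : ℕ) = k + 1) :
      μ η * (if CanMove η k l ∧ move η k l = η' then right η k l else 0) =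
        μ η' * (if CanMove η' l k ∧ move η' l k = η then left η' k l else 0) := by
    have hiff := canMove_and_move_eq_iff (η := η) (η' := η') (ne_of_val_eq_val_add_one hl)
    by_cases h : CanMove η k l ∧ move η k l = η'
    · rw [if_pos h, if_pos (hiff.1 h), ← h.2, hμ η k l hl h.1]
    · rw [if_neg h, if_neg (mt hiff.2 h), mul_zero, mul_zero]
  intro η η'
  rcases eq_or_ne η η' with rfl | hη
  · rfl
  rw [hproper.jumpGenerator_single_of_ne hη, hproper.jumpGenerator_single_of_ne hη.symm]
  simp only [Finset.mul_sum]
  refine Finset.sum_congr rfl fun k _ => Finset.sum_congr rfl fun l _ => ?_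
  by_cases hl : (l : ℕ) = k + 1
  · rw [if_pos hl, if_pos hl, mul_add, mul_add, hswap η η' hl, ← hswap η' η hl, add_comm]
  · rw [if_neg hl, if_neg hl, mul_zero, mul_zero]

lemma eq_zero_or_eq_of_not_canMove {η : Conf N} {k l : Fin M} (h : ¬CanMove η k l) :
    (η k : ℕ) = 0 ∨ (η l : ℕ) = N l := by
  have := conf_le η l
  rw [CanMove] at h
  omega

lemma properRates_sep (N : Fin M → ℕ) : ProperRates (N := N)
    (fun η k l => ((η k : ℕ) : ℝ) * ((N l : ℝ) - ((η l : ℕ) : ℝ)))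
    (fun η k l => ((η l : ℕ) : ℝ) * ((N k : ℝ) - ((η k : ℕ) : ℝ))) where
  right_eq_zero h := by rcases eq_zero_or_eq_of_not_canMove h with h | h <;> simp [h]
  left_eq_zero h := by rcases eq_zero_or_eq_of_not_canMove h with h | h <;> simp [h]

lemma properRates_dyn (N : Fin M → ℕ) (ρ : ℝ) :
    ProperRates (N := N) (dynRight ρ) (dynLeft ρ) where
  right_eq_zero h := by rcases eq_zero_or_eq_of_not_canMove h with h | h <;> simp [dynRight, h]
  left_eq_zero h := by rcases eq_zero_or_eq_of_not_canMove h with h | h <;> simp [dynLeft, h]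

end JumpProcesses

section PartialSums

variable {M : ℕ} {N : Fin M → ℕ}

/-- The sum over the sites with index smaller than `k`. -/
def sumLT (f : Fin M → ℕ) (k : ℕ) : ℕ := ∑ j : Fin M, if (j : ℕ) < k then f j else 0

/-- The sum over the sites with index at least `k`. -/
def sumGE (f : Fin M → ℕ) (k : ℕ) : ℕ := ∑ j : Fin M, if k ≤ (j : ℕ) then f j else 0

/-- The numbers of particles of a configuration, as natural numbers. -/
def Conf.val (η : Conf N) : Fin M → ℕ := fun k => η k

lemma Conf.val_apply (η : Conf N) (k : Fin M) : η.val k = η k := rfl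

lemma sumLT_succ (f : Fin M → ℕ) (k : Fin M) : sumLT f (k + 1) = sumLT f k + f k := by
  have hsingle : f k = ∑ j, if j = k then f j else 0 := by simp
  rw [sumLT, sumLT, hsingle, ← Finset.sum_add_distrib]
  refine Finset.sum_congr rfl fun j _ => ?_
  split_ifs <;> grind

lemma sumLT_add_sumGE (f : Fin M → ℕ) (k : ℕ) : sumLT f k + sumGE f k = ∑ j, f j := by
  rw [sumLT, sumGE, ← Finset.sum_add_distrib]
  refine Finset.sum_congr rfl fun j _ => ?_
  split_ifs <;> omega

lemma sumGE_eq (f : Fin M → ℕ) (k : Fin M) : sumGE f k = f k + sumGE f (k + 1) := by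
  have hk := sumLT_add_sumGE f k
  have hk_succ := sumLT_add_sumGE f (k + 1)
  rw [sumLT_succ] at hk_succ
  omega

lemma sumLT_zero (f : Fin M → ℕ) : sumLT f 0 = 0 := by simp [sumLT]

lemma sumGE_zero (f : Fin M → ℕ) : sumGE f 0 = ∑ j, f j := by simp [sumGE]

lemma sumGE_self (f : Fin M → ℕ) : sumGE f M = 0 :=
  Finset.sum_eq_zero fun j _ => if_neg (by omega)

lemma sumLT_self (f : Fin M → ℕ) : sumLT f M = ∑ j, f j := by
  rw [← sumLT_add_sumGE f M, sumGE_self, add_zero]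

lemma sumLT_mono {f g : Fin M → ℕ} (h : ∀ j, f j ≤ g j) (k : ℕ) : sumLT f k ≤ sumLT g k :=
  Finset.sum_le_sum fun j _ => by split_ifs; exacts [h j, le_rfl]

lemma sumGE_mono {f g : Fin M → ℕ} (h : ∀ j, f j ≤ g j) (k : ℕ) : sumGE f k ≤ sumGE g k :=
  Finset.sum_le_sum fun j _ => by split_ifs; exacts [h j, le_rfl]

lemma hPlus_eq (ρ : ℝ) (ξ : Conf N) (k : ℕ) :
    hPlus ρ ξ k = ρ + 2 * sumGE ξ.val k - sumGE N k := by
  simp only [hPlus, sumGE, Nat.cast_sum, Finset.mul_sum, add_sub_assoc, ← Finset.sum_sub_distrib]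
  refine congrArg _ (Finset.sum_congr rfl fun j _ => ?_)
  split_ifs <;> simp [Conf.val_apply]

lemma hMinus_eq (lam : ℝ) (η : Conf N) (k : ℕ) :
    hMinus lam η k = lam + 2 * sumLT η.val k - sumLT N k := by
  simp only [hMinus, sumLT, Nat.cast_sum, Finset.mul_sum, add_sub_assoc, ← Finset.sum_sub_distrib]
  refine congrArg _ (Finset.sum_congr rfl fun j _ => ?_)
  split_ifs <;> simp [Conf.val_apply]

lemma hPlus_succ (ρ : ℝ) (ξ : Conf N) (l : Fin M) :
    hPlus ρ ξ l = hPlus ρ ξ (l + 1) + (2 * ((ξ l : ℕ) : ℝ) - N l) := by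
  rw [hPlus_eq, hPlus_eq, sumGE_eq, sumGE_eq N, Conf.val_apply]
  push_cast
  ring

lemma LocalChange.sumGE_eq {k l : Fin M} (hl : (l : ℕ) = k + 1) {ξ ξ' : Conf N}
    (h : LocalChange k l ξ ξ') {i : ℕ} (hi : i ≠ l) : sumGE ξ'.val i = sumGE ξ.val i := by
  refine sum_eq_of_eq_off_pair (ne_of_val_eq_val_add_one hl)
    (fun j hjk hjl => by simp only [Conf.val_apply, h.eq_off j hjk hjl]) ?_
  have hiff : i ≤ l ↔ i ≤ k := by omega
  have := h.pair_sum
  simp only [Conf.val_apply, hiff]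
  split_ifs <;> omega

lemma LocalChange.sumLT_eq {k l : Fin M} (hl : (l : ℕ) = k + 1) {ξ ξ' : Conf N}
    (h : LocalChange k l ξ ξ') {i : ℕ} (hi : i ≠ l) : sumLT ξ'.val i = sumLT ξ.val i := by
  have hξ := sumLT_add_sumGE ξ.val i
  have hξ' := sumLT_add_sumGE ξ'.val i
  have htotal : ∑ j, ξ'.val j = ∑ j, ξ.val j := h.total_eq (ne_of_val_eq_val_add_one hl)
  rw [h.sumGE_eq hl hi] at hξ'
  omega

lemma LocalChange.hPlus_eq {k l : Fin M} (hl : (l : ℕ) = k + 1) {ξ ξ' : Conf N}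
    (h : LocalChange k l ξ ξ') (ρ : ℝ) {i : ℕ} (hi : i ≠ l) : hPlus ρ ξ' i = hPlus ρ ξ i := by
  rw [ExclusionDuality.hPlus_eq, ExclusionDuality.hPlus_eq, h.sumGE_eq hl hi]

end PartialSums

section HahnProduct

variable {M : ℕ} {N : Fin M → ℕ}

lemma dynRight_eq_rateRight (ρ : ℝ) (ξ : Conf N) {k l : Fin M} (hl : (l : ℕ) = k + 1) :
    dynRight ρ ξ k l = rateRight (N k) (N l) (ξ k : ℕ) (ξ l : ℕ) (hPlus ρ ξ l) := by
  rw [dynRight, rateRight, hPlus_succ ρ ξ k, hl]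

lemma dynLeft_eq_rateLeft (ρ : ℝ) (ξ : Conf N) (k l : Fin M) :
    dynLeft ρ ξ k l = rateLeft (N k) (N l) (ξ k : ℕ) (ξ l : ℕ) (hPlus ρ ξ l) := by
  rw [dynLeft, rateLeft, hPlus_succ ρ ξ l, add_sub_cancel_right]

/-- The factor of the site `k` in the nested product of Hahn polynomials. -/
def hahnFactor (ρ a : ℝ) (η ξ : Conf N) (k : Fin M) : ℝ :=
  hahnQ (N k) (η k) (ξ k) (hPlus ρ ξ (k + 1) - N k)
    (a + (sumLT η.val k + sumGE ξ.val (k + 1) : ℕ))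

/-- The nested product of Hahn polynomials with denominators cleared. -/
def hahnProd (ρ a : ℝ) (η ξ : Conf N) : ℝ := ∏ k, hahnFactor ρ a η ξ k

section

variable (ρ a : ℝ) {k l : Fin M} (hl : (l : ℕ) = k + 1) {η ξ η' ξ' : Conf N}
  (hη : LocalChange k l η η') (hξ : LocalChange k l ξ ξ')
include hl hη hξ

lemma LocalChange.hahnFactor_eq {j : Fin M} (hjk : j ≠ k) (hjl : j ≠ l) :
    hahnFactor ρ a η' ξ' j = hahnFactor ρ a η ξ j := by
  have hjk' : (j : ℕ) ≠ k := Fin.val_ne_of_ne hjk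
  rw [hahnFactor, hahnFactor, hη.eq_off j hjk hjl, hξ.eq_off j hjk hjl,
    hη.sumLT_eq hl (Fin.val_ne_of_ne hjl), hξ.sumGE_eq hl (by omega), hξ.hPlus_eq hl ρ (by omega)]

lemma LocalChange.hahnFactor_mul_hahnFactor :
    hahnFactor ρ a η' ξ' k * hahnFactor ρ a η' ξ' l =
      twoSite (N k) (N l) (a + (sumLT η.val k + sumGE ξ.val (l + 1) : ℕ)) (hPlus ρ ξ (l + 1))
        (ξ' k) (ξ' l) (η' k) (η' l) := by
  have hsumLT : sumLT η'.val l = sumLT η.val k + η' k := by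
    rw [hl, sumLT_succ, hη.sumLT_eq hl (by omega), Conf.val_apply]
  have hsumGE : sumGE ξ'.val (k + 1) = ξ' l + sumGE ξ.val (l + 1) := by
    rw [← hl, ExclusionDuality.sumGE_eq, hξ.sumGE_eq hl (by omega), Conf.val_apply]
  have hheight : hPlus ρ ξ' (k + 1) = hPlus ρ ξ (l + 1) + (2 * ((ξ' l : ℕ) : ℝ) - N l) := by
    rw [← hl, hPlus_succ, hξ.hPlus_eq hl ρ (by omega)]
  rw [hahnFactor, hahnFactor, twoSite, hsumLT, hsumGE, hheight, hη.sumLT_eq hl (by omega),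
    hξ.sumGE_eq hl (by omega), hξ.hPlus_eq hl ρ (by omega)]
  push_cast
  congr 2 <;> ring

lemma LocalChange.hahnProd_eq :
    hahnProd ρ a η' ξ' = (∏ j ∈ (Finset.univ.erase k).erase l, hahnFactor ρ a η ξ j) *
      twoSite (N k) (N l) (a + (sumLT η.val k + sumGE ξ.val (l + 1) : ℕ)) (hPlus ρ ξ (l + 1))
        (ξ' k) (ξ' l) (η' k) (η' l) := by
  rw [hahnProd, prod_eq_mul_mul_prod_erase (ne_of_val_eq_val_add_one hl), mul_comm,
    hη.hahnFactor_mul_hahnFactor ρ a hl hξ]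
  refine congrArg (· * _) (Finset.prod_congr rfl fun j hj => ?_)
  obtain ⟨hjl, hjk, -⟩ := by simpa only [Finset.mem_erase] using hj
  exact hη.hahnFactor_eq ρ a hl hξ hjk hjl

end

lemma isDuality_of_eq_hahnProd {ρ : ℝ} (a : ℝ) (hρ : DynRatesDefined N ρ)
    {D : Conf N → Conf N → ℝ} (f g : ℕ → ℝ)
    (hD : ∀ η ξ, D η ξ = f (total η) * g (total ξ) * hahnProd ρ a η ξ) :
    IsDuality (sepGenerator N) (dynGenerator N ρ) D := by
  refine isDuality_of_local (properRates_sep N) (properRates_dyn N ρ) fun η ξ k l hl => ?_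
  have hkl := ne_of_val_eq_val_add_one hl
  refine ⟨f (total η) * g (total ξ) * ∏ j ∈ (Finset.univ.erase k).erase l, hahnFactor ρ a η ξ j,
    twoSite (N k) (N l) (a + (sumLT η.val k + sumGE ξ.val (l + 1) : ℕ)) (hPlus ρ ξ (l + 1)),
    fun η' ξ' hη hξ => ?_, ?_⟩
  · rw [hD, hη.hahnProd_eq ρ a hl hξ, hη.total_eq hkl, hξ.total_eq hkl]
    ring
  · rw [dynRight_eq_rateRight ρ ξ hl, dynLeft_eq_rateLeft]
    exact twoSite_duality (conf_le ξ k) (conf_le ξ l) (conf_le η k) (conf_le η l) _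
      (by rw [hPlus_succ]; ring) (hρ ξ k l hl).1 (hρ ξ k l hl).2

end HahnProduct

/-! ## The Hahn duality function -/

section HahnReduction

lemma poch_neg_natCast (n j : ℕ) : poch (-n) j = (-1) ^ j * (j.factorial * n.choose j) := by
  rw [poch, ascPochhammer_eval_neg_eq_descPochhammer, descPochhammer_eval_eq_descFactorial,
    Nat.descFactorial_eq_factorial_mul_choose, Nat.cast_mul]

lemma poch_neg_div_poch_neg (N n j : ℕ) :
    poch (-n) j / poch (-N) j = (n.choose j : ℝ) / N.choose j := by
  have hj : (j.factorial : ℝ) ≠ 0 := Nat.cast_ne_zero.2 j.factorial_ne_zero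
  rw [poch_neg_natCast, poch_neg_natCast, mul_div_mul_left _ _ (by simp), mul_div_mul_left _ _ hj]

lemma poch_mul_hahn (N n : ℕ) {x : ℕ} {α : ℝ} (β : ℝ) (hα : poch (α + 1) x ≠ 0) :
    poch (α + 1) x * hahn x n α β N = hahnQ N n x (α + β + 1) (α + 1) := by
  rw [hahn, hahnQ_eq_sum, Finset.mul_sum]
  refine Finset.sum_congr rfl fun j hj => ?_
  have hj : (j.factorial : ℝ) ≠ 0 := Nat.cast_ne_zero.2 j.factorial_ne_zero
  have hsplit := poch_add (α + 1) j (x - j)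
  rw [Nat.add_sub_cancel' (by simpa [Nat.lt_succ_iff] using ‹j ∈ Finset.range (x + 1)›)] at hsplit
  rw [hsplit] at hα
  have hpoch := left_ne_zero_of_mul hα
  rw [← poch_neg_div_poch_neg, poch_neg_natCast x, hsplit,
    show (x : ℝ) + α + β + 1 = x + (α + β + 1) by ring]
  field_simp

lemma pHat_eq_hahnQ {N n x : ℕ} (hx : x ≤ N) {lam ρ v A B : ℝ}
    (hA : (ρ + lam - N + v + 1) / 2 = A) (hB : (lam - ρ - N + 1 + v) / 2 = B)
    (hA0 : poch A x ≠ 0) (hB0 : poch B (N + n) ≠ 0) :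
    pHat n x lam ρ v N = poch B (N - x) / poch B n * hahnQ N n x (ρ - N) A := by
  have hfront := poch_add B n N
  have hback := poch_add B (N - x) (x + n)
  rw [show N - x + (x + n) = N + n by omega, Nat.cast_sub hx] at hback
  rw [add_comm n N] at hfront
  have hn : poch B n ≠ 0 := left_ne_zero_of_mul (hfront ▸ hB0)
  have hxn : poch (B + (N - x)) (x + n) ≠ 0 := right_ne_zero_of_mul (hback ▸ hB0)
  have hratio : poch (B + n) N / poch (B + (N - x)) (x + n) = poch B (N - x) / poch B n := by
    rw [div_eq_div_iff hxn hn, ← hback, hfront, mul_comm]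
  have hα : (ρ + lam - N + v - 1) / 2 + 1 = A := by rw [← hA]; ring
  have hQ := poch_mul_hahn N n ((ρ - lam - N - v - 1) / 2) (hα.symm ▸ hA0)
  rw [hα, show (ρ + lam - N + v - 1) / 2 + (ρ - lam - N - v - 1) / 2 + 1 = ρ - N by ring] at hQ
  rw [← hratio, ← hQ, pHat, hA, show n + (lam - ρ - N + 1 + v) / 2 = B + n by rw [← hB]; ring,
    show -(x : ℝ) + (lam - ρ + N + 1 + v) / 2 = B + (N - x) by rw [← hB]; ring]
  ring

variable {M : ℕ} {N : Fin M → ℕ} {ρ v : ℝ}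

lemma capacity_eq_add_add (k : Fin M) : capacity N = sumLT N k + N k + sumGE N (k + 1) := by
  rw [capacity, ← sumLT_add_sumGE N k, sumGE_eq, add_assoc]

/-- The numbers of holes of a configuration. -/
def Conf.holes (ξ : Conf N) : Fin M → ℕ := fun k => N k - ξ k

lemma sumGE_holes (ξ : Conf N) (k : ℕ) : sumGE ξ.holes k + sumGE ξ.val k = sumGE N k := by
  rw [sumGE, sumGE, sumGE, ← Finset.sum_add_distrib]
  refine Finset.sum_congr rfl fun j _ => ?_
  split_ifs
  · exact Nat.sub_add_cancel (conf_le ξ j)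
  · rfl

lemma total_le_capacity (η : Conf N) : total η ≤ capacity N :=
  Finset.sum_le_sum fun j _ => conf_le η j

lemma sum_holes (ξ : Conf N) : ∑ j, ξ.holes j = capacity N - total ξ := by
  have h : ∑ j, ξ.holes j + total ξ = capacity N := by
    have h := sumGE_holes ξ 0
    simp only [sumGE_zero] at h
    exact h
  omega

/-- The first parameter of `hahnProd` in its relation to the duality function `PHat`. -/
def paramA (N : Fin M → ℕ) (ρ v : ℝ) : ℝ := (v + ρ - capacity N + 1) / 2

/-- The parameter dual to `paramA`, which governs the normalization of `PHat`. -/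
def paramB (N : Fin M → ℕ) (ρ v : ℝ) : ℝ := (v - ρ - capacity N + 1) / 2

lemma paramA_sub (N : Fin M → ℕ) (ρ v : ℝ) : paramA N ρ v - ρ = paramB N ρ v := by
  rw [paramA, paramB]
  ring

lemma poch_shift_ne_zero {a : ℝ} {m n S : ℕ} (h : ∀ i < S, a + i ≠ 0) (hmn : m + n ≤ S) :
    poch (a + m) n ≠ 0 :=
  poch_ne_zero fun i hi => by
    rw [add_assoc, ← Nat.cast_add]
    exact h _ (by omega)

lemma HahnGeneric.poch_paramA_add_ne_zero (h : HahnGeneric N ρ v) {m n : ℕ}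
    (hmn : m + n ≤ capacity N) : poch (paramA N ρ v + m) n ≠ 0 :=
  poch_shift_ne_zero (fun i hi hzero => h.1 i hi (by rw [paramA] at hzero; linarith)) hmn

lemma HahnGeneric.poch_paramA_ne_zero (h : HahnGeneric N ρ v) {n : ℕ} (hn : n ≤ capacity N) :
    poch (paramA N ρ v) n ≠ 0 := by
  simpa using h.poch_paramA_add_ne_zero (m := 0) (by simpa using hn)

lemma HahnGeneric.poch_paramB_add_ne_zero_site (h : HahnGeneric N ρ v) (k : Fin M) {m n : ℕ}
    (hmn : m + n ≤ capacity N + N k) : poch (paramB N ρ v + m) n ≠ 0 :=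
  poch_shift_ne_zero (fun i hi hzero => h.2 k i hi (by rw [paramB] at hzero; linarith)) hmn

lemma HahnGeneric.poch_paramB_add_ne_zero (h : HahnGeneric N ρ v) {m n : ℕ}
    (hmn : m + n ≤ capacity N) : poch (paramB N ρ v + m) n ≠ 0 := by
  rcases isEmpty_or_nonempty (Fin M) with hM | ⟨⟨k⟩⟩
  · obtain rfl : n = 0 := by
      have : capacity N = 0 := by simp [capacity]
      omega
    simp
  · exact h.poch_paramB_add_ne_zero_site k (by omega)

lemma HahnGeneric.poch_paramB_ne_zero (h : HahnGeneric N ρ v) {n : ℕ} (hn : n ≤ capacity N) :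
    poch (paramB N ρ v) n ≠ 0 := by
  simpa using h.poch_paramB_add_ne_zero (m := 0) (by simpa using hn)

lemma site_paramA_eq (ρ v : ℝ) (η ξ : Conf N) (k : Fin M) :
    (hPlus ρ ξ ((k : ℕ) + 1) + hMinus (0 : ℝ) η k - N k + v + 1) / 2 =
      paramA N ρ v + (sumLT η.val k + sumGE ξ.val (k + 1) : ℕ) := by
  rw [hPlus_eq, hMinus_eq, paramA, capacity_eq_add_add k]
  push_cast
  ring

lemma site_paramB_eq (ρ v : ℝ) (η ξ : Conf N) (k : Fin M) :
    (hMinus (0 : ℝ) η k - hPlus ρ ξ ((k : ℕ) + 1) - N k + 1 + v) / 2 =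
      paramB N ρ v + (sumLT η.val k + sumGE ξ.holes (k + 1) : ℕ) := by
  have hholes := congrArg (Nat.cast (R := ℝ)) (sumGE_holes ξ (k + 1))
  rw [hPlus_eq, hMinus_eq, paramB, capacity_eq_add_add k]
  push_cast at hholes ⊢
  linear_combination -hholes

lemma sumLT_add_sumGE_val_add_le (η ξ : Conf N) (k : Fin M) :
    sumLT η.val k + sumGE ξ.val (k + 1) + ξ k ≤ capacity N := by
  have hη : sumLT η.val k ≤ sumLT N k := sumLT_mono (conf_le η) k
  have hξ : sumGE ξ.val (k + 1) ≤ sumGE N (k + 1) := sumGE_mono (conf_le ξ) (k + 1)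
  have hξk := conf_le ξ k
  rw [capacity_eq_add_add k]
  omega

lemma sumLT_add_sumGE_holes_add_le (η ξ : Conf N) (k : Fin M) :
    sumLT η.val k + sumGE ξ.holes (k + 1) + (N k + η k) ≤ capacity N + N k := by
  have hη : sumLT η.val k ≤ sumLT N k := sumLT_mono (conf_le η) k
  have hholes := sumGE_holes ξ (k + 1)
  have hηk := conf_le η k
  rw [capacity_eq_add_add k]
  omega

lemma HahnGeneric.poch_site_ne_zero (h : HahnGeneric N ρ v) (η ξ : Conf N) (k : Fin M) :
    poch ((hPlus ρ ξ ((k : ℕ) + 1) + hMinus (0 : ℝ) η k - N k + v + 1) / 2) (ξ k) ≠ 0 := by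
  rw [site_paramA_eq]
  exact h.poch_paramA_add_ne_zero (sumLT_add_sumGE_val_add_le η ξ k)

lemma HahnGeneric.poch_site_denominator_ne_zero (h : HahnGeneric N ρ v) (η ξ : Conf N)
    (k : Fin M) :
    poch (-((ξ k : ℕ) : ℝ) + (hMinus (0 : ℝ) η k - hPlus ρ ξ ((k : ℕ) + 1) + N k + 1 + v) / 2)
      ((ξ k : ℕ) + (η k : ℕ)) ≠ 0 := by
  have hξ := conf_le ξ k
  have hle := sumLT_add_sumGE_holes_add_le η ξ k
  have hparam := site_paramB_eq ρ v η ξ k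
  convert h.poch_paramB_add_ne_zero_site k
    (m := sumLT η.val k + sumGE ξ.holes (k + 1) + (N k - ξ k)) (n := ξ k + η k) (by omega) using 2
  rw [Nat.cast_add, Nat.cast_sub hξ, ← add_assoc, ← hparam]
  ring

lemma HahnGeneric.pHat_eq (h : HahnGeneric N ρ v) (η ξ : Conf N) (k : Fin M) :
    pHat (η k) (ξ k) (hMinus (0 : ℝ) η k) (hPlus ρ ξ ((k : ℕ) + 1)) v (N k) =
      poch (paramB N ρ v) (sumLT η.val k + sumGE ξ.holes k) /
        poch (paramB N ρ v) (sumLT η.val (k + 1) + sumGE ξ.holes (k + 1)) *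
      hahnFactor ρ (paramA N ρ v) η ξ k := by
  have hcurrent : sumLT η.val k + sumGE ξ.holes k =
      sumLT η.val k + sumGE ξ.holes (k + 1) + (N k - ξ k) := by
    rw [sumGE_eq, Conf.holes]
    ring
  have hnext : sumLT η.val (k + 1) + sumGE ξ.holes (k + 1) =
      sumLT η.val k + sumGE ξ.holes (k + 1) + η k := by
    rw [sumLT_succ, Conf.val_apply]
    ring
  have hle := sumLT_add_sumGE_holes_add_le η ξ k
  have hpoch : poch (paramB N ρ v) (sumLT η.val k + sumGE ξ.holes (k + 1)) ≠ 0 := by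
    simpa using h.poch_paramB_add_ne_zero_site k (m := 0)
      (n := sumLT η.val k + sumGE ξ.holes (k + 1)) (by omega)
  rw [hcurrent, hnext, poch_add _ (sumLT η.val k + sumGE ξ.holes (k + 1)),
    poch_add _ (sumLT η.val k + sumGE ξ.holes (k + 1)), mul_div_mul_left _ _ hpoch, hahnFactor,
    pHat_eq_hahnQ (conf_le ξ k) (site_paramA_eq ρ v η ξ k) (site_paramB_eq ρ v η ξ k)
      (h.poch_paramA_add_ne_zero (sumLT_add_sumGE_val_add_le η ξ k))
      (h.poch_paramB_add_ne_zero_site k hle)]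

lemma prod_div_succ (F : ℕ → ℝ) (hF : ∀ k ≤ M, F k ≠ 0) :
    ∏ k : Fin M, F k / F (k + 1) = F 0 / F M := by
  rw [Fin.prod_univ_eq_prod_range (fun k => F k / F (k + 1))]
  induction M with
  | zero => simp [hF 0 le_rfl]
  | succ M ih =>
    rw [Finset.prod_range_succ, ih fun k hk => hF k (by omega),
      div_mul_div_cancel₀ (hF M (by omega))]

lemma HahnGeneric.PHat_eq (h : HahnGeneric N ρ v) (η ξ : Conf N) :
    PHat N ρ v η ξ = (poch (paramB N ρ v) (total η))⁻¹ *
      poch (paramB N ρ v) (capacity N - total ξ) * hahnProd ρ (paramA N ρ v) η ξ := by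
  rw [PHat, Finset.prod_congr rfl fun k _ => h.pHat_eq η ξ k, Finset.prod_mul_distrib, hahnProd,
    prod_div_succ fun k => poch (paramB N ρ v) (sumLT η.val k + sumGE ξ.holes k)]
  · simp only [sumLT_zero, zero_add, sumGE_zero, sumLT_self, sumGE_self, add_zero, sum_holes]
    rw [show ∑ j, η.val j = total η from rfl, div_eq_inv_mul]
  · intro k _
    have hη : sumLT η.val k ≤ sumLT N k := sumLT_mono (conf_le η) k
    have hξ : sumGE ξ.holes k ≤ sumGE N k := sumGE_mono (fun j => Nat.sub_le _ _) k
    have hcapacity : sumLT N k + sumGE N k = capacity N := sumLT_add_sumGE N k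
    exact h.poch_paramB_ne_zero (by omega)

lemma isDuality_PHat (h : HahnGeneric N ρ v) (hρ : DynRatesDefined N ρ) :
    IsDuality (sepGenerator N) (dynGenerator N ρ) (PHat N ρ v) :=
  isDuality_of_eq_hahnProd _ hρ (fun m => (poch (paramB N ρ v) m)⁻¹)
    (fun m => poch (paramB N ρ v) (capacity N - m)) h.PHat_eq

end HahnReduction

/-! ## Orthogonality of Hahn polynomials -/

section OneSite

lemma sum_birthDeath_mul_eq_neg_dirichlet (N : ℕ) {w birth death : ℕ → ℝ}
    (hbalance : ∀ n < N, w n * birth n = w (n + 1) * death (n + 1))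
    (hbirth : birth N = 0) (hdeath : death 0 = 0) (f g : ℕ → ℝ) :
    ∑ n ∈ Finset.range (N + 1),
        w n * (birth n * (f (n + 1) - f n) + death n * (f (n - 1) - f n)) * g n =
      -∑ n ∈ Finset.range N, w n * birth n * ((f (n + 1) - f n) * (g (n + 1) - g n)) := by
  have hbirths : ∑ n ∈ Finset.range (N + 1), w n * birth n * (f (n + 1) - f n) * g n =
      ∑ n ∈ Finset.range N, w n * birth n * (f (n + 1) - f n) * g n := by
    simp [Finset.sum_range_succ, hbirth]
  have hdeaths : ∑ n ∈ Finset.range (N + 1), w n * death n * (f (n - 1) - f n) * g n =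
      ∑ n ∈ Finset.range N, w (n + 1) * death (n + 1) * (f n - f (n + 1)) * g (n + 1) := by
    simp [Finset.sum_range_succ', hdeath]
  calc _ = ∑ n ∈ Finset.range (N + 1), w n * birth n * (f (n + 1) - f n) * g n +
        ∑ n ∈ Finset.range (N + 1), w n * death n * (f (n - 1) - f n) * g n := by
        rw [← Finset.sum_add_distrib]
        exact Finset.sum_congr rfl fun n _ => by ring
    _ = _ := by
        rw [hbirths, hdeaths, ← Finset.sum_add_distrib, ← Finset.sum_neg_distrib]
        refine Finset.sum_congr rfl fun n hn => ?_
        rw [← hbalance n (Finset.mem_range.1 hn)]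
        ring

lemma sum_choose_mul_poch_mul_poch (N : ℕ) (a b : ℝ) :
    ∑ n ∈ Finset.range (N + 1), (N.choose n : ℝ) * ((-1) ^ n * poch a n * poch (b + n) (N - n)) =
      poch (b - a) N := by
  induction N generalizing a b with
  | zero => simp
  | succ N ih =>
    have hsplit := Finset.sum_choose_succ_mul
      (fun n m => (-1 : ℝ) ^ n * poch a n * poch (b + n) m) N
    beta_reduce at hsplit
    rw [hsplit, poch_succ_left, ← Finset.sum_add_distrib, show b - a + 1 = b + 1 - a by ring,
      ← ih, Finset.mul_sum]
    refine Finset.sum_congr rfl fun n hn => ?_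
    rw [Nat.sub_add_comm (Finset.mem_range_succ_iff.1 hn), poch_succ_left, poch_succ, pow_succ,
      add_right_comm, Nat.cast_succ, ← add_assoc, add_right_comm b]
    ring

/-- The weight `(-1)^m (a)_m (b + m)_{S - m}`, which is proportional to `omegaP`. -/
def signedMass (S : ℕ) (a b : ℝ) (m : ℕ) : ℝ := (-1) ^ m * poch a m * poch (b + m) (S - m)

/-- The value `(b + S - x)_x (a)_x`, which is proportional to the inverse of `omegaPR`. -/
def normFactor (S : ℕ) (a b : ℝ) (x : ℕ) : ℝ := poch (b + (S - x)) x * poch a x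

/-- The bilinear form with respect to which the Hahn polynomials are orthogonal, evaluated at the
polynomials of degree `x` and `y`. -/
def hahnInner (N x y : ℕ) (ρ a : ℝ) : ℝ :=
  ∑ n ∈ Finset.range (N + 1), (N.choose n : ℝ) * signedMass N a (a - ρ) n *
    (hahnQ N n x (ρ - N) a * hahnQ N n y (ρ - N) a)

lemma hahnInner_comm (N x y : ℕ) (ρ a : ℝ) : hahnInner N x y ρ a = hahnInner N y x ρ a := by
  simp only [hahnInner, mul_comm (hahnQ N _ x _ _)]

lemma hahnInner_zero_zero (N : ℕ) (ρ a : ℝ) : hahnInner N 0 0 ρ a = poch (-ρ) N := by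
  simp only [hahnInner, signedMass, hahnQ_zero, mul_one]
  rw [sum_choose_mul_poch_mul_poch, sub_sub_cancel_left]

lemma hahnQ_succ_sub (N n x : ℕ) (c a : ℝ) :
    hahnQ (N + 1) (n + 1) x c a - hahnQ (N + 1) n x c a =
      -(x * (x + c) * hahnQ N n (x - 1) (c + 2) (a + 1)) / (N + 1) := by
  rw [eq_div_iff N.cast_add_one_ne_zero, mul_comm, hahnQ, hahnQ, bernsteinCoeff_succ_sub,
    derivative_jacobi, map_neg, map_smul, smul_eq_mul, hahnQ]

lemma signedMass_succ_mul {N n : ℕ} (hn : n ≤ N) (a b : ℝ) :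
    signedMass (N + 1) a b n * (a + n) = a * (b + N) * signedMass N (a + 1) b n := by
  have hpoch := poch_succ_left a n
  rw [poch_succ] at hpoch
  rw [signedMass, signedMass, Nat.sub_add_comm hn, poch_succ, Nat.cast_sub hn]
  linear_combination (-1) ^ n * (poch (b + n) (N - n) * (b + N)) * hpoch

lemma signedMass_detailed_balance {N n : ℕ} (hn : n < N) (a b : ℝ) :
    (N.choose n : ℝ) * signedMass N a b n * ((a + n) * (N - n)) =
      N.choose (n + 1) * signedMass N a b (n + 1) * ((n + 1 : ℕ) * (1 - b - (n + 1 : ℕ))) := by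
  have hchoose := choose_succ_mul_succ N n
  obtain ⟨m, rfl⟩ := Nat.exists_eq_add_of_lt hn
  rw [signedMass, signedMass, show n + m + 1 - n = m + 1 by omega, poch_succ_left, poch_succ,
    show n + m + 1 - (n + 1) = m by omega, pow_succ, show b + (n + 1 : ℕ) = b + n + 1 by
      push_cast; ring]
  push_cast at hchoose ⊢
  linear_combination -(-1) ^ n * poch a n * (a + n) * (b + n) * poch (b + n + 1) m * hchoose

lemma choose_succ_mul_signedMass_succ {N n : ℕ} (hn : n ≤ N) (a b : ℝ) :
    ((N + 1).choose n : ℝ) * signedMass (N + 1) a b n * ((a + n) * ((N + 1 : ℕ) - n)) =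
      (N + 1) * (a * (b + N)) * (N.choose n * signedMass N (a + 1) b n) := by
  have hmass := signedMass_succ_mul hn a b
  have hchoose := congrArg (Nat.cast (R := ℝ)) (Nat.choose_mul_succ_eq N n)
  push_cast [Nat.cast_sub (hn.trans N.le_succ)] at hchoose ⊢
  linear_combination (N + 1 - n) * ((N + 1).choose n : ℝ) * hmass -
    a * (b + N) * signedMass N (a + 1) b n * hchoose

/-- Summation by parts, since the differences of a Hahn polynomial are Hahn polynomials of lower
degree on one state fewer. -/
lemma mul_hahnInner_succ {N x : ℕ} (hx : x ≤ N + 1) (y : ℕ) {c ρ : ℝ} (hc : ρ - (N + 1 : ℕ) = c)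
    (a : ℝ) :
    x * (x + c) * hahnInner (N + 1) x y ρ a =
      x * (x + c) * (y * (y + c)) / (N + 1) * (a * (a - ρ + N)) *
        hahnInner N (x - 1) (y - 1) (ρ + 1) (a + 1) := by
  have hshift : ρ + 1 - N = c + 2 := by rw [← hc]; push_cast; ring
  have heigen : ∀ n ∈ Finset.range (N + 1 + 1),
      (a + n) * ((N + 1 : ℕ) - n) * (hahnQ (N + 1) (n + 1) x c a - hahnQ (N + 1) n x c a) +
        n * (1 - (a - ρ) - n) * (hahnQ (N + 1) (n - 1) x c a - hahnQ (N + 1) n x c a) =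
      -(x * (x + c) * hahnQ (N + 1) n x c a) := fun n hn => by
    rw [← hahnQ_difference a (Finset.mem_range_succ_iff.1 hn) hx c, ← hc]
    ring
  have hdirichlet := sum_birthDeath_mul_eq_neg_dirichlet (N + 1)
    (w := fun n => ((N + 1).choose n : ℝ) * signedMass (N + 1) a (a - ρ) n)
    (birth := fun n => (a + n) * ((N + 1 : ℕ) - n))
    (death := fun n => n * (1 - (a - ρ) - n))
    (fun n hn => signedMass_detailed_balance hn a (a - ρ)) (by simp) (by simp)
    (fun n => hahnQ (N + 1) n x c a) (fun n => hahnQ (N + 1) n y c a)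
  calc x * (x + c) * hahnInner (N + 1) x y ρ a
      = ∑ n ∈ Finset.range (N + 1),
          ((N + 1).choose n : ℝ) * signedMass (N + 1) a (a - ρ) n *
            ((a + n) * ((N + 1 : ℕ) - n)) *
          ((hahnQ (N + 1) (n + 1) x c a - hahnQ (N + 1) n x c a) *
            (hahnQ (N + 1) (n + 1) y c a - hahnQ (N + 1) n y c a)) := by
        rw [← neg_neg (∑ n ∈ Finset.range (N + 1), _), ← hdirichlet, hahnInner, hc, Finset.mul_sum,
          ← Finset.sum_neg_distrib]
        refine Finset.sum_congr rfl fun n hn => ?_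
        rw [heigen n hn]
        ring
    _ = _ := by
        rw [hahnInner, Finset.mul_sum, add_sub_add_right_eq_sub, hshift]
        refine Finset.sum_congr rfl fun n hn => ?_
        rw [choose_succ_mul_signedMass_succ (Finset.mem_range_succ_iff.1 hn), hahnQ_succ_sub,
          hahnQ_succ_sub]
        have hN : (N + 1 : ℝ) * (N + 1 : ℝ)⁻¹ = 1 := mul_inv_cancel₀ N.cast_add_one_ne_zero
        simp only [div_eq_mul_inv]
        linear_combination (a * (a - ρ + N) * (N.choose n * signedMass N (a + 1) (a - ρ) n) *
          (x * (x + c) * hahnQ N n (x - 1) (c + 2) (a + 1)) *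
          (y * (y + c) * hahnQ N n (y - 1) (c + 2) (a + 1)) * (N + 1 : ℝ)⁻¹) * hN

lemma add_intCast_ne_zero {N : ℕ} {ρ : ℝ} (hρ : ∀ j : ℤ, |j| ≤ N → ρ ≠ j) {i : ℤ}
    (hi : |i| ≤ N) : ρ + i ≠ 0 := fun h =>
  hρ (-i) (by rwa [abs_neg]) (by rw [Int.cast_neg]; linarith)

lemma succ_mul_poch_neg (ρ : ℝ) (N : ℕ) :
    (ρ + 1) * poch (-ρ) (N + 1) = -(poch (-(ρ + 1)) N * ((ρ + 1 - N) * (ρ - N))) := by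
  have hleft := poch_succ_left (-(ρ + 1)) (N + 1)
  rw [poch_succ, poch_succ, show -(ρ + 1) + 1 = -ρ by ring] at hleft
  push_cast at hleft
  linear_combination hleft

lemma WHatSite_succ_succ {N x : ℕ} {ρ : ℝ} (hx : x ≤ N)
    (hρ : ∀ j : ℤ, |j| ≤ (N + 1 : ℕ) → ρ ≠ j) :
    WHatSite (x + 1) (N + 1) ρ * ((x + 1) * (x + (ρ - N))) =
      (N + 1) * WHatSite x N (ρ + 1) := by
  have hρ_add {i : ℤ} {r : ℝ} (hi : |i| ≤ (N + 1 : ℕ)) (hr : r = ρ + i) : r ≠ 0 :=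
    hr ▸ add_intCast_ne_zero hρ hi
  have hbase : ρ - N - 1 ≠ 0 := hρ_add (i := -N - 1) (by grind) (by push_cast; ring)
  have hbase' : ρ + 1 - N ≠ 0 := hρ_add (i := 1 - N) (by grind) (by push_cast; ring)
  have hsucc : ρ + 1 ≠ 0 := hρ_add (i := 1) (by grind) (by push_cast; ring)
  have hneg : poch (-ρ) (N + 1) ≠ 0 := poch_ne_zero fun i hi => by
    rw [← neg_ne_zero]
    exact hρ_add (i := -i) (by grind) (by push_cast; ring)
  have hmid : ρ - N ≠ 0 := hρ_add (i := -N) (by grind) (by push_cast; ring)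
  have hhigh : poch (ρ + 1 + 1) x ≠ 0 := poch_ne_zero fun i hi =>
    hρ_add (i := i + 2) (by grind) (by push_cast; ring)
  have hpoch := succ_mul_poch_neg ρ N
  have hneg' : poch (-(ρ + 1)) N ≠ 0 := fun h =>
    mul_ne_zero hsucc hneg (by rw [hpoch, h, zero_mul, neg_zero])
  have hlow : poch (ρ + 1 - N) x = poch (ρ - N) x * (ρ - N + x) / (ρ - N) := by
    rw [eq_div_iff hmid, ← poch_succ, poch_succ_left, mul_comm, sub_add_eq_add_sub]
  have hchoose : ((N + 1).choose (x + 1) : ℝ) = (N + 1) * N.choose x / (x + 1) := by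
    rw [eq_div_iff x.cast_add_one_ne_zero]
    exact_mod_cast (Nat.add_one_mul_choose_eq N x).symm
  rw [WHatSite, WHatSite, poch_succ_left, poch_succ_left (ρ + 1), pow_succ, hchoose, hlow,
    mul_right_comm (ρ + 1), hpoch, Nat.cast_succ, Nat.cast_succ, ← sub_sub ρ, sub_add_cancel]
  field_simp
  ring

lemma WHatSite_ne_zero {N x : ℕ} (hx : x ≤ N) {ρ : ℝ} (hρ : ∀ j : ℤ, |j| ≤ N → ρ ≠ j) :
    WHatSite x N ρ ≠ 0 := by
  have hρ_add {i : ℤ} {r : ℝ} (hi : |i| ≤ N) (hr : r = ρ + i) : r ≠ 0 :=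
    hr ▸ add_intCast_ne_zero hρ hi
  have hchoose : (N.choose x : ℝ) ≠ 0 := Nat.cast_ne_zero.2 (Nat.choose_pos hx).ne'
  have hneg : poch (-ρ) N ≠ 0 := poch_ne_zero fun i hi => by
    rw [← neg_ne_zero]
    exact hρ_add (i := -i) (by grind) (by push_cast; ring)
  have hlow : poch (ρ - N) x ≠ 0 := poch_ne_zero fun i hi =>
    hρ_add (i := i - N) (by grind) (by push_cast; ring)
  have hhigh : poch (ρ + 1) x ≠ 0 := poch_ne_zero fun i hi =>
    hρ_add (i := i + 1) (by grind) (by push_cast; ring)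
  have hmid : 2 * x + ρ - N ≠ 0 := hρ_add (i := 2 * x - N) (by grind) (by push_cast; ring)
  have hbase : ρ - N ≠ 0 := hρ_add (i := -N) (by grind) (by push_cast; ring)
  rw [WHatSite]
  positivity

lemma WHatSite_zero {N : ℕ} {ρ : ℝ} (hρ : ρ - N ≠ 0) : WHatSite 0 N ρ = (poch (-ρ) N)⁻¹ := by
  simp [WHatSite, hρ]

lemma normFactor_succ_succ (N x : ℕ) (a b : ℝ) :
    normFactor (N + 1) a b (x + 1) = a * (b + N) * normFactor N (a + 1) b x := by
  rw [normFactor, normFactor, poch_succ_left a, poch_succ, Nat.cast_succ, Nat.cast_succ,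
    add_sub_add_right_eq_sub, add_assoc b, sub_add_cancel]
  ring

lemma hahnInner_succ_left {N x : ℕ} {ρ : ℝ} (hx : x ≤ N) (hxρ : x + (ρ - N) ≠ 0) (y : ℕ) (a : ℝ) :
    hahnInner (N + 1) (x + 1) y ρ a = y * (y + (ρ - N - 1)) / (N + 1) * (a * (a - ρ + N)) *
      hahnInner N x (y - 1) (ρ + 1) (a + 1) := by
  have hc : ρ - (N + 1 : ℕ) = ρ - N - 1 := by push_cast; ring
  have hx0 : ((x + 1 : ℕ) : ℝ) ≠ 0 := Nat.cast_ne_zero.2 x.succ_ne_zero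
  have heigenvalue : ((x + 1 : ℕ) : ℝ) + (ρ - N - 1) ≠ 0 := by
    convert hxρ using 1
    push_cast
    ring
  refine mul_left_cancel₀ (mul_ne_zero hx0 heigenvalue) ?_
  rw [mul_hahnInner_succ (x := x + 1) (by omega) y hc, Nat.add_sub_cancel]
  ring

lemma hahnInner_eq {N : ℕ} {ρ : ℝ} (hρ : ∀ j : ℤ, |j| ≤ N → ρ ≠ j) {x y : ℕ} (hx : x ≤ N)
    (hy : y ≤ N) (a : ℝ) :
    hahnInner N x y ρ a = if x = y then normFactor N a (a - ρ) x / WHatSite x N ρ else 0 := by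
  have hbase : ρ - N ≠ 0 := sub_ne_zero.2 (by exact_mod_cast hρ N (by simp))
  induction N generalizing ρ a x y with
  | zero =>
    obtain ⟨rfl, rfl⟩ : x = 0 ∧ y = 0 := by omega
    simp [hahnInner_zero_zero, normFactor, WHatSite_zero hbase]
  | succ N ih =>
    have hlower {z : ℕ} (hz : z ≤ N) : z + (ρ - N) ≠ 0 := by
      convert add_intCast_ne_zero hρ (i := z - N) (by grind) using 1
      push_cast
      ring
    rcases x with _ | x <;> rcases y with _ | y
    · simp [hahnInner_zero_zero, normFactor, WHatSite_zero hbase]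
    · simp [hahnInner_comm _ 0, hahnInner_succ_left (Nat.le_of_succ_le_succ hy)
        (hlower (Nat.le_of_succ_le_succ hy))]
    · simp [hahnInner_succ_left (Nat.le_of_succ_le_succ hx)
        (hlower (Nat.le_of_succ_le_succ hx))]
    · have hx := Nat.le_of_succ_le_succ hx
      have hy := Nat.le_of_succ_le_succ hy
      have hshift : ∀ j : ℤ, |j| ≤ N → ρ + 1 ≠ j := fun j hj h =>
        hρ (j - 1) (by grind) (by push_cast; linarith)
      have hbase' : ρ + 1 - N ≠ 0 := sub_ne_zero.2 (by exact_mod_cast hshift N (by simp))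
      rw [hahnInner_succ_left hx (hlower hx), Nat.add_sub_cancel, ih hshift hx hy _ hbase',
        add_sub_add_right_eq_sub]
      simp only [add_left_inj]
      split_ifs with hxy
      · subst hxy
        have hW := WHatSite_succ_succ hx hρ
        have hW0 := WHatSite_ne_zero hx hshift
        have hW1 := WHatSite_ne_zero (Nat.succ_le_succ hx) hρ
        have hN : (N + 1 : ℝ) ≠ 0 := N.cast_add_one_ne_zero
        rw [normFactor_succ_succ, mul_div_assoc', div_eq_div_iff hW0 hW1]
        field_simp
        push_cast
        linear_combination (a * (a - ρ + N) * normFactor N (a + 1) (a - ρ) x) * hW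
      · exact mul_zero _

end OneSite

/-! ## Orthogonality and reversibility -/

section Orthogonality

section LastSite

variable {M : ℕ} {N : Fin (M + 1) → ℕ}

/-- The capacities of all sites but the last one. -/
abbrev initCap (N : Fin (M + 1) → ℕ) : Fin M → ℕ := fun k => N k.castSucc

/-- The configuration on all sites but the last one. -/
def initConf (η : Conf N) : Conf (initCap N) := fun k => η k.castSucc

/-- The configuration with a new last site. -/
def snocConf (η : Conf (initCap N)) (n : Fin (N (Fin.last M) + 1)) : Conf N :=
  Fin.snoc (α := fun k => Fin (N k + 1)) η n

lemma initConf_snocConf (η : Conf (initCap N)) (n : Fin (N (Fin.last M) + 1)) :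
    initConf (snocConf η n) = η := by
  funext k
  simp [initConf, snocConf]

lemma snocConf_last (η : Conf (initCap N)) (n : Fin (N (Fin.last M) + 1)) :
    snocConf η n (Fin.last M) = n := by
  simp [snocConf]

lemma sum_conf_succ (F : Conf N → ℝ) :
    ∑ η, F η = ∑ η : Conf (initCap N), ∑ n : Fin (N (Fin.last M) + 1), F (snocConf η n) := by
  rw [← Equiv.sum_comp (Fin.snocEquiv fun k => Fin (N k + 1)) F, Fintype.sum_prod_type_right]
  rfl

lemma conf_ext_init_last {ξ ξ' : Conf N} (hinit : initConf ξ = initConf ξ')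
    (hlast : (ξ (Fin.last M) : ℕ) = ξ' (Fin.last M)) : ξ = ξ' :=
  funext fun k => Fin.lastCases (Fin.ext hlast) (congrFun hinit) k

lemma total_succ (η : Conf N) : total η = total (initConf η) + η (Fin.last M) := by
  rw [total, Fin.sum_univ_castSucc]
  rfl

lemma capacity_succ (N : Fin (M + 1) → ℕ) :
    capacity N = capacity (initCap N) + N (Fin.last M) := by
  rw [capacity, Fin.sum_univ_castSucc]
  rfl

lemma sumLT_init (η : Conf N) {k : ℕ} (hk : k ≤ M) :
    sumLT η.val k = sumLT (initConf η).val k := by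
  rw [sumLT, Fin.sum_univ_castSucc, if_neg (by simpa using hk), add_zero]
  rfl

lemma sumGE_init (η : Conf N) {k : ℕ} (hk : k ≤ M) :
    sumGE η.val k = sumGE (initConf η).val k + η (Fin.last M) := by
  rw [sumGE, Fin.sum_univ_castSucc, if_pos (by simpa using hk)]
  rfl

lemma hPlus_top (ρ : ℝ) (ξ : Conf N) : hPlus ρ ξ (M + 1) = ρ := by
  rw [hPlus_eq, sumGE_self, sumGE_self]
  simp

lemma hPlus_last (ρ : ℝ) (ξ : Conf N) :
    hPlus ρ ξ M = ρ + (2 * ((ξ (Fin.last M) : ℕ) : ℝ) - N (Fin.last M)) := by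
  have h := hPlus_succ ρ ξ (Fin.last M)
  rwa [Fin.val_last, hPlus_top] at h

lemma hPlus_init (ρ : ℝ) (ξ : Conf N) {k : ℕ} (hk : k ≤ M) :
    hPlus ρ ξ k = hPlus (hPlus ρ ξ M) (initConf ξ) k := by
  rw [hPlus_last, hPlus, Fin.sum_univ_castSucc, if_pos (by simpa using hk), hPlus, add_assoc,
    add_comm (Finset.sum _ _)]
  rfl

lemma hahnProd_succ (ρ a : ℝ) (η ξ : Conf N) :
    hahnProd ρ a η ξ =
      hahnProd (hPlus ρ ξ M) (a + (ξ (Fin.last M) : ℕ)) (initConf η) (initConf ξ) *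
        hahnQ (N (Fin.last M)) (η (Fin.last M)) (ξ (Fin.last M)) (ρ - N (Fin.last M))
          (a + total (initConf η)) := by
  rw [hahnProd, Fin.prod_univ_castSucc, hahnProd]
  congr 1
  · refine Finset.prod_congr rfl fun k _ => ?_
    rw [hahnFactor, hahnFactor, Fin.val_castSucc, hPlus_init ρ ξ (by omega),
      sumLT_init η (by omega), sumGE_init ξ (by omega), ← add_assoc, add_comm _ (ξ _ : ℕ),
      Nat.cast_add, ← add_assoc]
    rfl
  · rw [hahnFactor, Fin.val_last, hPlus_top, sumGE_self, sumLT_init η le_rfl, sumLT_self]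
    rfl

lemma wHat_snocConf (η : Conf (initCap N)) (n : Fin (N (Fin.last M) + 1)) :
    wHat N (snocConf η n) = wHat (initCap N) η * ((N (Fin.last M)).choose n : ℝ) := by
  rw [wHat, Fin.prod_univ_castSucc, snocConf_last]
  exact congrArg (wHat (initCap N) · * _) (initConf_snocConf η n)

lemma WHatR_succ (ρ : ℝ) (ξ : Conf N) :
    WHatR N ρ ξ = WHatR (initCap N) (hPlus ρ ξ M) (initConf ξ) *
      WHatSite (ξ (Fin.last M)) (N (Fin.last M)) ρ := by
  rw [WHatR, Fin.prod_univ_castSucc, Fin.val_last, hPlus_top, WHatR]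
  refine congrArg (· * _) (Finset.prod_congr rfl fun k _ => ?_)
  rw [Fin.val_castSucc, hPlus_init ρ ξ (by omega)]
  rfl

end LastSite

lemma signedMass_add {S N m n : ℕ} (hm : m ≤ S) (hn : n ≤ N) (a b : ℝ) :
    signedMass (S + N) a b (m + n) = signedMass S a (b + N) m * signedMass N (a + m) (b + m) n := by
  have hpoch := poch_add (b + m + n) (N - n) (S - m)
  rw [Nat.cast_sub hn, show b + m + n + (N - n : ℝ) = b + N + m by ring] at hpoch
  rw [signedMass, signedMass, signedMass, show S + N - (m + n) = N - n + (S - m) by omega,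
    Nat.cast_add, ← add_assoc, hpoch, poch_add, pow_add]
  ring

lemma signedMass_mul_normFactor {S m : ℕ} (hm : m ≤ S) (N x : ℕ) (a b : ℝ) :
    signedMass S a (b + N) m * normFactor N (a + m) (b + m) x =
      signedMass S (a + x) (b + N - x) m * normFactor (S + N) a b x := by
  have hpoch_left := poch_add a m x
  have hpoch_right := poch_add (b + N - x + m) (S - m) x
  rw [add_comm m x, poch_add] at hpoch_left
  rw [add_comm (S - m) x, poch_add, Nat.cast_sub hm] at hpoch_right
  rw [show b + N - x + m + (S - m : ℝ) = b + (S + N - x) by ring,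
    show b + N - x + m + x = b + N + m by ring] at hpoch_right
  rw [signedMass, signedMass, normFactor, normFactor, Nat.cast_add,
    show b + m + (N - x : ℝ) = b + N - x + m by ring]
  linear_combination (-1) ^ m * poch a x * poch (a + x) m * hpoch_right -
    (-1) ^ m * poch (b + N + m) (S - m) * poch (b + N - x + m) x * hpoch_left

lemma normFactor_add (S N x y : ℕ) (a b : ℝ) :
    normFactor S (a + x) (b + N - x) y * normFactor (S + N) a b x =
      normFactor (S + N) a b (y + x) := by
  have hpoch := poch_add a x y
  have hpoch' := poch_add (b + (S + N - (y + x))) y x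
  rw [add_comm x y] at hpoch
  rw [normFactor, normFactor, normFactor, Nat.cast_add, Nat.cast_add, hpoch, hpoch',
    show b + N - x + (S - y : ℝ) = b + (S + N - (y + x)) by ring,
    show b + (S + N - (y + x)) + (y : ℝ) = b + (S + N - x) by ring]
  ring

section

variable {M : ℕ} {N : Fin (M + 1) → ℕ}

lemma sum_last_hahnProd (ρ a : ℝ) (η : Conf (initCap N)) (ξ ξ' : Conf N) :
    ∑ n, wHat N (snocConf η n) * signedMass (capacity N) a (a - ρ) (total (snocConf η n)) *
        (hahnProd ρ a (snocConf η n) ξ * hahnProd ρ a (snocConf η n) ξ') =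
      wHat (initCap N) η *
        (signedMass (capacity (initCap N)) a (a - ρ + N (Fin.last M)) (total η) *
          hahnInner (N (Fin.last M)) (ξ (Fin.last M)) (ξ' (Fin.last M)) ρ (a + total η)) *
        (hahnProd (hPlus ρ ξ M) (a + (ξ (Fin.last M) : ℕ)) η (initConf ξ) *
          hahnProd (hPlus ρ ξ' M) (a + (ξ' (Fin.last M) : ℕ)) η (initConf ξ')) := by
  rw [hahnInner, ← Fin.sum_univ_eq_sum_range fun n => ((N (Fin.last M)).choose n : ℝ) *
    signedMass (N (Fin.last M)) (a + total η) (a + total η - ρ) n *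
      (hahnQ (N (Fin.last M)) n (ξ (Fin.last M)) (ρ - N (Fin.last M)) (a + total η) *
        hahnQ (N (Fin.last M)) n (ξ' (Fin.last M)) (ρ - N (Fin.last M)) (a + total η)),
    Finset.mul_sum, Finset.mul_sum, Finset.sum_mul]
  refine Finset.sum_congr rfl fun n _ => ?_
  rw [wHat_snocConf, hahnProd_succ, hahnProd_succ, total_succ, initConf_snocConf, snocConf_last,
    capacity_succ, signedMass_add (total_le_capacity η) (Nat.lt_succ_iff.1 n.isLt),
    sub_add_eq_add_sub a ρ (total η)]
  ring

end

/-- The bilinear form with respect to which the nested products `hahnProd` are orthogonal,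
evaluated at the products with dual variables `ξ` and `ξ'`. -/
def hahnProdInner {M : ℕ} {N : Fin M → ℕ} (ρ a : ℝ) (ξ ξ' : Conf N) : ℝ :=
  ∑ η, wHat N η * signedMass (capacity N) a (a - ρ) (total η) *
    (hahnProd ρ a η ξ * hahnProd ρ a η ξ')

lemma add_last_sub_hPlus_last {M : ℕ} {N : Fin (M + 1) → ℕ} (ρ a : ℝ) (ξ : Conf N) :
    a + (ξ (Fin.last M) : ℕ) - hPlus ρ ξ M =
      a - ρ + N (Fin.last M) - (ξ (Fin.last M) : ℕ) := by
  rw [hPlus_last]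
  ring

lemma hahnProdInner_succ {M : ℕ} {N : Fin (M + 1) → ℕ} {ρ : ℝ}
    (hρ : ∀ j : ℤ, |j| ≤ (N (Fin.last M) : ℤ) → ρ ≠ j) (a : ℝ) (ξ ξ' : Conf N) :
    hahnProdInner ρ a ξ ξ' =
      if (ξ (Fin.last M) : ℕ) = ξ' (Fin.last M) then
        hahnProdInner (hPlus ρ ξ M) (a + (ξ (Fin.last M) : ℕ)) (initConf ξ) (initConf ξ') *
          (normFactor (capacity N) a (a - ρ) (ξ (Fin.last M)) /
            WHatSite (ξ (Fin.last M)) (N (Fin.last M)) ρ)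
      else 0 := by
  rw [hahnProdInner, sum_conf_succ]
  simp only [sum_last_hahnProd,
    hahnInner_eq hρ (conf_le ξ (Fin.last M)) (conf_le ξ' (Fin.last M))]
  split_ifs with hlast
  swap
  · simp
  have hheight : hPlus ρ ξ' M = hPlus ρ ξ M := by rw [hPlus_last, hPlus_last, hlast]
  rw [hahnProdInner, Finset.sum_mul]
  refine Finset.sum_congr rfl fun η _ => ?_
  rw [hheight, ← hlast, add_last_sub_hPlus_last, capacity_succ, mul_div_assoc',
    add_sub_right_comm a, signedMass_mul_normFactor (total_le_capacity η)]
  ring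

theorem hahnProdInner_eq {M : ℕ} {N : Fin M → ℕ} {ρ : ℝ}
    (hρ : ∀ j : ℤ, |j| ≤ (capacity N : ℤ) → ρ ≠ j) (a : ℝ) (ξ ξ' : Conf N) :
    hahnProdInner ρ a ξ ξ' =
      if ξ = ξ' then normFactor (capacity N) a (a - ρ) (total ξ) / WHatR N ρ ξ else 0 := by
  induction M generalizing ρ a with
  | zero =>
    obtain rfl : ξ = ξ' := Subsingleton.elim _ _
    simp [hahnProdInner, hahnProd, total, capacity, wHat, WHatR, normFactor, signedMass]
  | succ M ih =>
    have hcapacity := capacity_succ N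
    have hx := conf_le ξ (Fin.last M)
    have hlevel : ∀ j : ℤ, |j| ≤ (capacity (initCap N) : ℤ) → hPlus ρ ξ M ≠ j := fun j hj h => by
      refine hρ (j - 2 * (ξ (Fin.last M) : ℕ) + N (Fin.last M)) (by grind) ?_
      rw [hPlus_last] at h
      push_cast
      linarith
    rw [hahnProdInner_succ fun j hj => hρ j (by omega)]
    by_cases hlast : (ξ (Fin.last M) : ℕ) = ξ' (Fin.last M)
    · rw [if_pos hlast, ih hlevel, add_last_sub_hPlus_last, ite_mul, zero_mul, div_mul_div_comm,
        hcapacity, normFactor_add, ← hcapacity, ← total_succ, ← WHatR_succ]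
      exact if_congr ⟨fun h => conf_ext_init_last h hlast, fun h => h ▸ rfl⟩ rfl rfl
    · rw [if_neg hlast, if_neg fun h => hlast (by rw [h])]

end Orthogonality

section Reversibility

variable {M : ℕ} {N : Fin M → ℕ}

lemma isReversible_sep (g : ℕ → ℝ) :
    IsReversible (sepGenerator N) fun η => g (total η) * wHat N η := by
  refine isReversible_of_detailed_balance (properRates_sep N) fun η k l hl hmove => ?_
  have hkl := ne_of_val_eq_val_add_one hl
  have hlocal := hmove.localChange hkl
  have hoff : ∀ j ∈ (Finset.univ.erase k).erase l,
      ((N j).choose (move η k l j) : ℝ) = (N j).choose (η j) := fun j hj => by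
    obtain ⟨hjl, hjk, -⟩ := by simpa only [Finset.mem_erase] using hj
    rw [hlocal.eq_off j hjk hjl]
  obtain ⟨n, hn⟩ := Nat.exists_eq_add_of_lt hmove.1
  rw [zero_add] at hn
  have hchoose_source := choose_succ_mul_succ (N k) n
  have hchoose_target := choose_succ_mul_succ (N l) (η l)
  rw [hlocal.total_eq hkl, wHat, wHat, prod_eq_mul_mul_prod_erase hkl,
    prod_eq_mul_mul_prod_erase hkl, Finset.prod_congr rfl hoff, move_apply_source,
    move_apply_target hkl hmove.2, hn, Nat.add_sub_cancel]
  push_cast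
  linear_combination g (total η) *
    (∏ j ∈ (Finset.univ.erase k).erase l, ((N j).choose (η j) : ℝ)) *
    ((N l).choose (η l) * ((N l : ℝ) - (η l : ℕ)) * hchoose_source -
      (N k).choose n * ((N k : ℝ) - n) * hchoose_target)

lemma sum_mul_apply_symm {Ω : Type*} [Fintype Ω] [DecidableEq Ω] {L : (Ω → ℝ) →ₗ[ℝ] Ω → ℝ}
    {μ : Ω → ℝ} (hμ : IsReversible L μ) (f g : Ω → ℝ) :
    ∑ η, μ η * g η * L f η = ∑ η, μ η * f η * L g η := by
  have hexpand (f : Ω → ℝ) (η : Ω) : L f η = ∑ η', f η' * L (Pi.single η' 1) η := by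
    have hsingle (η' : Ω) : (fun j => if η' = j then (1 : ℝ) else 0) = Pi.single η' 1 := by
      funext j
      simp only [Pi.single_apply, eq_comm]
    rw [L.pi_apply_eq_sum_univ f]
    simp only [hsingle, Finset.sum_apply, Pi.smul_apply, smul_eq_mul]
  simp only [hexpand f, hexpand g, Finset.mul_sum]
  rw [Finset.sum_comm]
  refine Finset.sum_congr rfl fun η _ => Finset.sum_congr rfl fun η' _ => ?_
  linear_combination g η' * f η * hμ η' η

/-- By orthogonality the indicator function of a state `ξ'` is a superposition of the functions
`D η`, on which duality turns `L'` into the self-adjoint operator `L`. -/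
lemma isReversible_of_isDuality {Ω Ω' : Type*} [Fintype Ω] [DecidableEq Ω] [DecidableEq Ω']
    {L : (Ω → ℝ) →ₗ[ℝ] Ω → ℝ} {L' : (Ω' → ℝ) →ₗ[ℝ] Ω' → ℝ} {D : Ω → Ω' → ℝ} {μ : Ω → ℝ}
    {W : Ω' → ℝ} (hD : IsDuality L L' D) (hμ : IsReversible L μ) (hW : ∀ ξ, W ξ ≠ 0)
    (horth : ∀ ξ ξ', ∑ η, D η ξ * D η ξ' * μ η = (if ξ = ξ' then 1 else 0) / W ξ) :
    IsReversible L' W := by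
  have hsingle (ξ' : Ω') : Pi.single ξ' 1 = W ξ' • ∑ η, (μ η * D η ξ') • D η := by
    funext ξ
    have h := horth ξ' ξ
    rw [eq_div_iff (hW ξ'), mul_comm] at h
    simp only [Pi.single_apply, eq_comm (a := ξ), Pi.smul_apply, Finset.sum_apply, smul_eq_mul]
    rw [← h]
    exact congrArg _ (Finset.sum_congr rfl fun η _ => by ring)
  have hrate (ξ ξ' : Ω') :
      L' (Pi.single ξ' 1) ξ = W ξ' * ∑ η, μ η * D η ξ' * L (fun η' => D η' ξ) η := by
    rw [hsingle, map_smul, map_sum]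
    simp only [map_smul, Pi.smul_apply, Finset.sum_apply, smul_eq_mul]
    exact congrArg _ (Finset.sum_congr rfl fun η _ => by rw [hD η ξ])
  intro ξ ξ'
  rw [hrate, hrate, sum_mul_apply_symm hμ]
  ring

/-- The generator of a nearest neighbour particle system as a linear map. -/
def jumpGeneratorHom (right left : Conf N → Fin M → Fin M → ℝ) :
    (Conf N → ℝ) →ₗ[ℝ] Conf N → ℝ where
  toFun := jumpGenerator right left
  map_add' f g := by
    funext η
    simp only [jumpGenerator, Pi.add_apply, ← Finset.sum_add_distrib]
    refine Finset.sum_congr rfl fun k _ => Finset.sum_congr rfl fun l _ => ?_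
    split_ifs <;> ring
  map_smul' c f := by
    funext η
    simp only [jumpGenerator, Pi.smul_apply, smul_eq_mul, RingHom.id_apply, Finset.mul_sum]
    refine Finset.sum_congr rfl fun k _ => Finset.sum_congr rfl fun l _ => ?_
    split_ifs <;> ring

lemma dual_orthogonality {Ω : Type*} [Fintype Ω] [DecidableEq Ω] {P : Ω → Ω → ℝ} {w W : Ω → ℝ}
    (hW : ∀ ξ, W ξ ≠ 0)
    (horth : ∀ ξ ξ', ∑ η, P η ξ * P η ξ' * w η = (if ξ = ξ' then 1 else 0) / W ξ) (η η' : Ω) :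
    ∑ ξ, P η ξ * P η' ξ * W ξ = (if η = η' then 1 else 0) / w η := by
  have hleft : (Matrix.of fun ξ η => W ξ * P η ξ * w η) * (Matrix.of P : Matrix Ω Ω ℝ) = 1 := by
    ext ξ ξ'
    have h := horth ξ ξ'
    rw [eq_div_iff (hW ξ)] at h
    rw [Matrix.mul_apply, Matrix.one_apply, ← h, Finset.sum_mul]
    exact Finset.sum_congr rfl fun η _ => by simp only [Matrix.of_apply]; ring
  have hright (η η' : Ω) : (∑ ξ, P η ξ * P η' ξ * W ξ) * w η' = if η = η' then 1 else 0 := by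
    have h := congrArg (fun A : Matrix Ω Ω ℝ => A η η') (mul_eq_one_comm.1 hleft)
    rw [Matrix.mul_apply, Matrix.one_apply] at h
    rw [← h, Finset.sum_mul]
    exact Finset.sum_congr rfl fun ξ _ => by simp only [Matrix.of_apply]; ring
  have hw : w η' ≠ 0 := fun h => by simpa [h] using hright η' η'
  rw [eq_div_of_mul_eq hw (hright η η')]
  split_ifs with h
  · rw [h]
  · simp

end Reversibility

section HahnOrthogonality

variable {M : ℕ} {N : Fin M → ℕ} {ρ v : ℝ}

lemma hPlus_add_ne_zero (hρ : ∀ j : ℤ, |j| ≤ (capacity N : ℤ) → ρ ≠ j) (ξ : Conf N) (k : ℕ)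
    {i : ℤ} (hi : |i| ≤ sumLT N k) : hPlus ρ ξ k + i ≠ 0 := by
  intro h
  have hξ : sumGE ξ.val k ≤ sumGE N k := sumGE_mono (conf_le ξ) k
  have hcapacity : sumLT N k + sumGE N k = capacity N := sumLT_add_sumGE N k
  rw [hPlus_eq] at h
  refine hρ (sumGE N k - 2 * sumGE ξ.val k - i) (by grind) ?_
  push_cast
  linarith

lemma dynRatesDefined_of_ne_intCast (hρ : ∀ j : ℤ, |j| ≤ (capacity N : ℤ) → ρ ≠ j) :
    DynRatesDefined N ρ := fun ξ k l hl => by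
  have hne (hk : 0 < N k) (i : ℤ) (hi : |i| ≤ 1) : hPlus ρ ξ l + i ≠ 0 := by
    refine hPlus_add_ne_zero hρ ξ l (hi.trans ?_)
    rw [hl, sumLT_succ]
    omega
  have hξ := conf_le ξ k
  refine ⟨fun hpos _ => ⟨?_, ?_⟩, fun _ hlt => ⟨?_, ?_⟩⟩
  · simpa using hne (by omega) 0 (by simp)
  · simpa using hne (by omega) 1 (by simp)
  · simpa using hne (by omega) 0 (by simp)
  · simpa [← sub_eq_add_neg] using hne (by omega) (-1) (by simp)

lemma WHatR_ne_zero (hρ : ∀ j : ℤ, |j| ≤ (capacity N : ℤ) → ρ ≠ j) (ξ : Conf N) :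
    WHatR N ρ ξ ≠ 0 := by
  refine Finset.prod_ne_zero_iff.2 fun k _ => WHatSite_ne_zero (conf_le ξ k) fun j hj h => ?_
  refine hPlus_add_ne_zero hρ ξ (k + 1) (i := -j) ?_ (by rw [h]; push_cast; ring)
  rw [abs_neg, sumLT_succ]
  push_cast
  omega

lemma HahnGeneric.omegaP_eq (h : HahnGeneric N ρ v) {m : ℕ} (hm : m ≤ capacity N) :
    omegaP (capacity N) ρ v m * (poch (paramB N ρ v) m)⁻¹ ^ 2 =
      signedMass (capacity N) (paramA N ρ v) (paramB N ρ v) m /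
        poch (paramB N ρ v) (capacity N) ^ 2 := by
  have hpoch := poch_add (paramB N ρ v) m (capacity N - m)
  rw [Nat.add_sub_cancel' hm] at hpoch
  have hprod := h.poch_paramB_ne_zero le_rfl
  rw [hpoch] at hprod ⊢
  have hleft := left_ne_zero_of_mul hprod
  have hright := right_ne_zero_of_mul hprod
  rw [omegaP, signedMass, show (ρ - capacity N + v + 1) / 2 = paramA N ρ v by rw [paramA]; ring,
    ← paramB, add_comm (m : ℝ)]
  field_simp

lemma omegaPR_eq {m : ℕ} (hm : m ≤ capacity N) :
    omegaPR (capacity N) ρ v m =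
      poch (paramB N ρ v + (capacity N - m : ℕ)) m / poch (paramA N ρ v) m := by
  rw [omegaPR, paramA, paramB, Nat.cast_sub hm]
  congr 2
  ring

lemma HahnGeneric.omegaPR_ne_zero (h : HahnGeneric N ρ v) {m : ℕ} (hm : m ≤ capacity N) :
    omegaPR (capacity N) ρ v m ≠ 0 := by
  rw [omegaPR_eq hm]
  exact div_ne_zero (h.poch_paramB_add_ne_zero (by omega)) (h.poch_paramA_ne_zero hm)

lemma HahnGeneric.omegaPR_mul_normFactor (h : HahnGeneric N ρ v) {m : ℕ} (hm : m ≤ capacity N) :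
    omegaPR (capacity N) ρ v m *
        (normFactor (capacity N) (paramA N ρ v) (paramB N ρ v) m *
          poch (paramB N ρ v) (capacity N - m) ^ 2) =
      poch (paramB N ρ v) (capacity N) ^ 2 := by
  have hpoch := poch_add (paramB N ρ v) (capacity N - m) m
  have hA := h.poch_paramA_ne_zero hm
  rw [Nat.sub_add_cancel hm] at hpoch
  rw [omegaPR_eq hm, normFactor, ← Nat.cast_sub hm, hpoch]
  field_simp

lemma PHat_orthogonal (h : HahnGeneric N ρ v) (hρ : ∀ j : ℤ, |j| ≤ (capacity N : ℤ) → ρ ≠ j)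
    (ξ ξ' : Conf N) :
    ∑ η : Conf N, PHat N ρ v η ξ * PHat N ρ v η ξ' *
        (omegaP (capacity N) ρ v (total η) * wHat N η) =
      (if ξ = ξ' then 1 else 0) / (omegaPR (capacity N) ρ v (total ξ) * WHatR N ρ ξ) := by
  have hterm (η : Conf N) : PHat N ρ v η ξ * PHat N ρ v η ξ' *
      (omegaP (capacity N) ρ v (total η) * wHat N η) =
      poch (paramB N ρ v) (capacity N - total ξ) * poch (paramB N ρ v) (capacity N - total ξ') /
        poch (paramB N ρ v) (capacity N) ^ 2 *
      (wHat N η * signedMass (capacity N) (paramA N ρ v) (paramA N ρ v - ρ) (total η) *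
        (hahnProd ρ (paramA N ρ v) η ξ * hahnProd ρ (paramA N ρ v) η ξ')) := by
    have homega := h.omegaP_eq (total_le_capacity η)
    rw [h.PHat_eq, h.PHat_eq, paramA_sub]
    linear_combination poch (paramB N ρ v) (capacity N - total ξ) *
      poch (paramB N ρ v) (capacity N - total ξ') * hahnProd ρ (paramA N ρ v) η ξ *
      hahnProd ρ (paramA N ρ v) η ξ' * wHat N η * homega
  rw [Finset.sum_congr rfl fun η _ => hterm η, ← Finset.mul_sum, ← hahnProdInner,
    hahnProdInner_eq hρ, paramA_sub]
  split_ifs with hξ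
  · subst hξ
    have hnorm := h.omegaPR_mul_normFactor (total_le_capacity ξ)
    have hpoch := pow_ne_zero 2 (h.poch_paramB_ne_zero le_rfl)
    rw [div_mul_div_comm, div_eq_div_iff (mul_ne_zero hpoch (WHatR_ne_zero hρ ξ))
      (mul_ne_zero (h.omegaPR_ne_zero (total_le_capacity ξ)) (WHatR_ne_zero hρ ξ))]
    linear_combination WHatR N ρ ξ * hnorm
  · rw [mul_zero, zero_div]

lemma isReversible_dyn (h : HahnGeneric N ρ v) (hρ : ∀ j : ℤ, |j| ≤ (capacity N : ℤ) → ρ ≠ j) :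
    IsReversible (dynGenerator N ρ) fun ξ =>
      omegaPR (capacity N) ρ v (total ξ) * WHatR N ρ ξ :=
  isReversible_of_isDuality (L := jumpGeneratorHom _ _) (L' := jumpGeneratorHom _ _)
    (isDuality_PHat h (dynRatesDefined_of_ne_intCast hρ)) (isReversible_sep _)
    (fun ξ => mul_ne_zero (h.omegaPR_ne_zero (total_le_capacity ξ)) (WHatR_ne_zero hρ ξ))
    (PHat_orthogonal h hρ)

end HahnOrthogonality

/-! ## Krawtchouk polynomials -/

section Krawtchouk

open Polynomial

/-- The Bernstein coefficients of `(1 - b X) ^ x`. This is the Krawtchouk polynomial of degree `n`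
in `x`, with `b = 1 / p`. -/
def krawQ (N n x : ℕ) (b : ℝ) : ℝ := bernsteinCoeff N n ((1 - b • X) ^ x)

lemma krawQ_zero (N n : ℕ) (b : ℝ) : krawQ N n 0 b = 1 := by
  rw [krawQ, pow_zero, bernsteinCoeff_one]

lemma krawQ_eq_sum (N n x : ℕ) (b : ℝ) :
    krawQ N n x b =
      ∑ j ∈ Finset.range (x + 1), (n.choose j : ℝ) / N.choose j * ((-b) ^ j * x.choose j) := by
  rw [krawQ, sub_eq_neg_add, add_pow, map_sum]
  refine Finset.sum_congr rfl fun j _ => ?_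
  rw [one_pow, mul_one, ← neg_smul, _root_.smul_pow, mul_comm, ← nsmul_eq_mul,
    ← Nat.cast_smul_eq_nsmul ℝ, map_smul, map_smul, bernsteinCoeff_X_pow]
  simp only [smul_eq_mul]
  ring

lemma krawtchouk_eq_krawQ (N n x : ℕ) (p : ℝ) : krawtchouk n x p N = krawQ N n x (1 / p) := by
  rw [krawQ_eq_sum, krawtchouk,
    Finset.sum_subset (Finset.range_mono (Nat.succ_le_succ (le_max_left n x))),
    Finset.sum_subset (Finset.range_mono (Nat.succ_le_succ (le_max_right n x)))]
  · refine Finset.sum_congr rfl fun j _ => ?_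
    have hj : (j.factorial : ℝ) ≠ 0 := Nat.cast_ne_zero.2 j.factorial_ne_zero
    rw [← poch_neg_div_poch_neg, poch_neg_natCast x, neg_pow (1 / p)]
    field_simp
  · intro j _ hj
    have hxj : x < j := by simpa using hj
    rw [Nat.choose_eq_zero_of_lt hxj, Nat.cast_zero, mul_zero, mul_zero]
  · intro j _ hj
    rw [poch_neg_natCast n, Nat.choose_eq_zero_of_lt (by simpa using hj)]
    simp only [Nat.cast_zero, mul_zero, zero_mul, zero_div]

lemma natDegree_one_sub_smul_X_pow_le (b : ℝ) (x : ℕ) :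
    ((1 - b • X : ℝ[X]) ^ x).natDegree ≤ x :=
  (natDegree_pow_le_of_le x (by compute_degree)).trans_eq (mul_one x)

lemma derivative_one_sub_smul_X_pow (b : ℝ) (x : ℕ) :
    derivative ((1 - b • X : ℝ[X]) ^ x) = -((b * x) • (1 - b • X) ^ (x - 1)) := by
  rw [derivative_pow]
  simp only [map_natCast, derivative_sub, derivative_one, map_smul, derivative_X, zero_sub, mul_neg,
    Algebra.mul_smul_comm, mul_one, neg_inj]
  algebra

lemma natCast_smul_eq_mul_pow_pred (b : ℝ) (x : ℕ) :
    (x : ℝ) • (1 - b • X : ℝ[X]) ^ x = (1 - b • X) * ((x : ℝ) • (1 - b • X) ^ (x - 1)) := by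
  cases x with
  | zero => simp
  | succ x => rw [Nat.add_sub_cancel, pow_succ]; algebra

section Relations

variable {N n : ℕ}

lemma mul_krawQ (hn : n ≤ N) (x : ℕ) (v : ℝ) :
    (1 + v) * (n * krawQ N n x (1 + v)) =
      (N - x) * (krawQ N n x (1 + v) - krawQ N n (x + 1) (1 + v)) +
        v * x * (krawQ N n x (1 + v) - krawQ N n (x - 1) (1 + v)) := by
  have hpoly : (1 + v) • (X * ((N : ℝ) • (1 - (1 + v) • X) ^ x +
        (1 - X) * derivative ((1 - (1 + v) • X) ^ x))) =
      (N - x : ℝ) • ((1 - (1 + v) • X) ^ x - (1 - (1 + v) • X) ^ (x + 1)) +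
        (v * x) • ((1 - (1 + v) • X) ^ x - (1 - (1 + v) • X : ℝ[X]) ^ (x - 1)) := by
    have hpred := natCast_smul_eq_mul_pow_pred (1 + v) x
    rw [derivative_one_sub_smul_X_pow, pow_succ]
    linear_combination (norm := algebra) ((1 + v) • X - v • 1) * hpred
  simpa only [krawQ, map_add, map_sub, map_smul, smul_eq_mul, bernsteinCoeff_X_mul_add hn]
    using congrArg (bernsteinCoeff N n) hpoly

lemma mul_krawQ_pred (hn : n ≤ N) (x : ℕ) (v : ℝ) :
    (1 + v) * (n * krawQ N (n - 1) x (1 + v)) =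
      (N - x) * (krawQ N n x (1 + v) - krawQ N n (x + 1) (1 + v)) +
        x * (krawQ N n (x - 1) (1 + v) - krawQ N n x (1 + v)) := by
  have hpoly : (1 + v) • (X * ((N : ℝ) • (1 - (1 + v) • X) ^ x -
        X * derivative ((1 - (1 + v) • X) ^ x))) =
      (N - x : ℝ) • ((1 - (1 + v) • X) ^ x - (1 - (1 + v) • X) ^ (x + 1)) +
        (x : ℝ) • ((1 - (1 + v) • X) ^ (x - 1) - (1 - (1 + v) • X : ℝ[X]) ^ x) := by
    have hpred := natCast_smul_eq_mul_pow_pred (1 + v) x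
    rw [derivative_one_sub_smul_X_pow, pow_succ]
    linear_combination (norm := algebra) ((1 + v) • X + 1) * hpred
  simpa only [krawQ, map_add, map_sub, map_smul, smul_eq_mul, bernsteinCoeff_X_mul_sub hn]
    using congrArg (bernsteinCoeff N n) hpoly

lemma sub_mul_krawQ_succ {x : ℕ} (hn : n ≤ N) (hx : x ≤ N) (v : ℝ) :
    (1 + v) * ((N - n) * krawQ N (n + 1) x (1 + v)) =
      (N - x) * (krawQ N n (x + 1) (1 + v) + v * krawQ N n x (1 + v)) -
        v * x * (krawQ N n x (1 + v) + v * krawQ N n (x - 1) (1 + v)) := by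
  have hpoly : (1 + v) • ((1 - X) * ((N : ℝ) • (1 - (1 + v) • X) ^ x +
        (1 - X) * derivative ((1 - (1 + v) • X) ^ x))) =
      (N - x : ℝ) • ((1 - (1 + v) • X) ^ (x + 1) + v • (1 - (1 + v) • X) ^ x) -
        (v * x) • ((1 - (1 + v) • X) ^ x + v • (1 - (1 + v) • X : ℝ[X]) ^ (x - 1)) := by
    have hpred := natCast_smul_eq_mul_pow_pred (1 + v) x
    rw [derivative_one_sub_smul_X_pow, pow_succ]
    linear_combination (norm := algebra) ((2 * v + 1) • 1 - (1 + v) • X) * hpred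
  simpa only [krawQ, map_add, map_sub, map_smul, smul_eq_mul,
    bernsteinCoeff_one_sub_X_mul_add hn ((natDegree_one_sub_smul_X_pow_le _ x).trans hx)]
    using congrArg (bernsteinCoeff N n) hpoly

lemma krawQ_succ_sub (N n x : ℕ) (b : ℝ) :
    (N + 1) * (krawQ (N + 1) (n + 1) x b - krawQ (N + 1) n x b) =
      -(b * x * krawQ N n (x - 1) b) := by
  rw [krawQ, krawQ, bernsteinCoeff_succ_sub, derivative_one_sub_smul_X_pow, map_neg, map_smul,
    smul_eq_mul, krawQ]

lemma krawQ_difference {x : ℕ} (hx : x ≤ N) (n : ℕ) (v : ℝ) :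
    (N - n) * (krawQ N (n + 1) x (1 + v) - krawQ N n x (1 + v)) +
        n * v * (krawQ N (n - 1) x (1 + v) - krawQ N n x (1 + v)) =
      -((1 + v) * x * krawQ N n x (1 + v)) := by
  have hpoly : (1 - X) * derivative ((1 - (1 + v) • X) ^ x) -
      v • (X * derivative ((1 - (1 + v) • X) ^ x)) =
      -(((1 + v) * x) • (1 - (1 + v) • X : ℝ[X]) ^ x) := by
    have hpred := natCast_smul_eq_mul_pow_pred (1 + v) x
    rw [derivative_one_sub_smul_X_pow]
    linear_combination (norm := algebra) (1 + v) • hpred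
  have hbern := congrArg (bernsteinCoeff N n) hpoly
  simp only [map_sub, map_neg, map_smul, smul_eq_mul, bernsteinCoeff_X_mul_derivative,
    bernsteinCoeff_one_sub_X_mul_derivative ((natDegree_one_sub_smul_X_pow_le _ x).trans hx)]
    at hbern
  simp only [krawQ]
  linear_combination hbern

end Relations

lemma krawQ_mul_krawQ_duality {N₁ N₂ x₁ x₂ n₁ n₂ : ℕ} (hx₁ : x₁ ≤ N₁) (hx₂ : x₂ ≤ N₂)
    (hn₁ : n₁ ≤ N₁) (hn₂ : n₂ ≤ N₂) {v : ℝ} (hv : 1 + v ≠ 0) :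
    n₁ * ((N₂ : ℝ) - n₂) *
        (krawQ N₁ (n₁ - 1) x₁ (1 + v) * krawQ N₂ (n₂ + 1) x₂ (1 + v) -
          krawQ N₁ n₁ x₁ (1 + v) * krawQ N₂ n₂ x₂ (1 + v)) +
      n₂ * ((N₁ : ℝ) - n₁) *
        (krawQ N₁ (n₁ + 1) x₁ (1 + v) * krawQ N₂ (n₂ - 1) x₂ (1 + v) -
          krawQ N₁ n₁ x₁ (1 + v) * krawQ N₂ n₂ x₂ (1 + v)) =
    x₁ * ((N₂ : ℝ) - x₂) *
        (krawQ N₁ n₁ (x₁ - 1) (1 + v) * krawQ N₂ n₂ (x₂ + 1) (1 + v) -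
          krawQ N₁ n₁ x₁ (1 + v) * krawQ N₂ n₂ x₂ (1 + v)) +
      x₂ * ((N₁ : ℝ) - x₁) *
        (krawQ N₁ n₁ (x₁ + 1) (1 + v) * krawQ N₂ n₂ (x₂ - 1) (1 + v) -
          krawQ N₁ n₁ x₁ (1 + v) * krawQ N₂ n₂ x₂ (1 + v)) := by
  have hpred₁ := mul_krawQ_pred hn₁ x₁ v
  have hpred₂ := mul_krawQ_pred hn₂ x₂ v
  have hmul₁ := mul_krawQ hn₁ x₁ v
  have hmul₂ := mul_krawQ hn₂ x₂ v
  have hsucc₁ := sub_mul_krawQ_succ hn₁ hx₁ v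
  have hsucc₂ := sub_mul_krawQ_succ hn₂ hx₂ v
  apply mul_left_cancel₀ (pow_ne_zero 2 hv)
  set K₁ := krawQ N₁ n₁ x₁ (1 + v)
  set K₂ := krawQ N₂ n₂ x₂ (1 + v)
  linear_combination (1 + v) * (N₂ - n₂) * krawQ N₂ (n₂ + 1) x₂ (1 + v) * hpred₁ +
    (1 + v) * (N₁ - n₁) * krawQ N₁ (n₁ + 1) x₁ (1 + v) * hpred₂ +
    ((N₁ - x₁) * (K₁ - krawQ N₁ n₁ (x₁ + 1) (1 + v)) +
      x₁ * (krawQ N₁ n₁ (x₁ - 1) (1 + v) - K₁)) * hsucc₂ +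
    ((N₂ - x₂) * (K₂ - krawQ N₂ n₂ (x₂ + 1) (1 + v)) +
      x₂ * (krawQ N₂ n₂ (x₂ - 1) (1 + v) - K₂)) * hsucc₁ -
    (1 + v) * (N₂ - 2 * n₂) * K₂ * hmul₁ - (1 + v) * N₁ * K₁ * hmul₂ +
    2 * ((N₁ - x₁) * (K₁ - krawQ N₁ n₁ (x₁ + 1) (1 + v)) +
      v * x₁ * (K₁ - krawQ N₁ n₁ (x₁ - 1) (1 + v))) * hmul₂

/-- The bilinear form with respect to which the Krawtchouk polynomials with `p = 1 / (1 + v)` are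
orthogonal, evaluated at the polynomials with the arguments `x` and `y`. -/
def krawInner (N x y : ℕ) (v : ℝ) : ℝ :=
  ∑ n ∈ Finset.range (N + 1), (N.choose n : ℝ) * v⁻¹ ^ n *
    (krawQ N n x (1 + v) * krawQ N n y (1 + v))

lemma krawInner_comm (N x y : ℕ) (v : ℝ) : krawInner N x y v = krawInner N y x v := by
  simp only [krawInner, mul_comm]

lemma krawInner_zero_zero (N : ℕ) (v : ℝ) : krawInner N 0 0 v = (1 + v⁻¹) ^ N := by
  simp [krawInner, krawQ_zero, add_comm (1 : ℝ), add_pow, mul_comm]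

lemma krawInner_succ_left {N x : ℕ} (hx : x ≤ N) (y : ℕ) {v : ℝ} (hv : v ≠ 0) (hv' : 1 + v ≠ 0) :
    krawInner (N + 1) (x + 1) y v = y * (1 + v) / (N + 1) * krawInner N x (y - 1) v := by
  have heigen := krawQ_difference (Nat.succ_le_succ hx) (v := v)
  have hdirichlet := sum_birthDeath_mul_eq_neg_dirichlet (N + 1)
    (w := fun n => ((N + 1).choose n : ℝ) * v⁻¹ ^ n)
    (birth := fun n => (N + 1 : ℕ) - n) (death := fun n => n * v)
    (fun n _ => by
      have hchoose := choose_succ_mul_succ (N + 1) n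
      rw [pow_succ]
      push_cast at hchoose ⊢
      field_simp
      linear_combination -hchoose) (sub_self _) (by simp)
    (fun n => krawQ (N + 1) n (x + 1) (1 + v)) (fun n => krawQ (N + 1) n y (1 + v))
  simp only [heigen] at hdirichlet
  have hx0 : (x + 1 : ℝ) ≠ 0 := x.cast_add_one_ne_zero
  have hN : (N + 1 : ℝ) ≠ 0 := N.cast_add_one_ne_zero
  refine mul_left_cancel₀ (mul_ne_zero hv' hx0) ?_
  calc (1 + v) * (x + 1) * krawInner (N + 1) (x + 1) y v
      = ∑ n ∈ Finset.range (N + 1), ((N + 1).choose n : ℝ) * v⁻¹ ^ n * ((N + 1 : ℕ) - n) *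
          ((krawQ (N + 1) (n + 1) (x + 1) (1 + v) - krawQ (N + 1) n (x + 1) (1 + v)) *
            (krawQ (N + 1) (n + 1) y (1 + v) - krawQ (N + 1) n y (1 + v))) := by
        rw [← neg_neg (∑ n ∈ Finset.range (N + 1), _), ← hdirichlet, krawInner, Finset.mul_sum,
          ← Finset.sum_neg_distrib]
        refine Finset.sum_congr rfl fun n _ => ?_
        push_cast
        ring
    _ = _ := by
        rw [krawInner, Finset.mul_sum, Finset.mul_sum]
        refine Finset.sum_congr rfl fun n hn => ?_
        have hchoose := congrArg (Nat.cast (R := ℝ)) (Nat.choose_mul_succ_eq N n)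
        push_cast [Nat.cast_sub ((Finset.mem_range_succ_iff.1 hn).trans N.le_succ)] at hchoose
        have hleft := krawQ_succ_sub N n (x + 1) (1 + v)
        have hright := krawQ_succ_sub N n y (1 + v)
        rw [Nat.add_sub_cancel] at hleft
        push_cast at hleft ⊢
        rw [mul_comm, ← eq_div_iff hN] at hleft hright
        rw [mul_right_comm _ (v⁻¹ ^ n), ← hchoose, hleft, hright]
        field_simp

lemma krawInner_eq {N x y : ℕ} (hx : x ≤ N) (hy : y ≤ N) {v : ℝ} (hv : v ≠ 0) (hv' : 1 + v ≠ 0) :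
    krawInner N x y v = if x = y then (1 + v⁻¹) ^ N * v ^ x / N.choose x else 0 := by
  induction N generalizing x y with
  | zero =>
    obtain ⟨rfl, rfl⟩ : x = 0 ∧ y = 0 := by omega
    simp [krawInner_zero_zero]
  | succ N ih =>
    rcases x with _ | x <;> rcases y with _ | y
    · simp [krawInner_zero_zero]
    · simp [krawInner_comm _ 0, krawInner_succ_left (Nat.le_of_succ_le_succ hy) _ hv hv']
    · simp [krawInner_succ_left (Nat.le_of_succ_le_succ hx) _ hv hv']
    · have hx := Nat.le_of_succ_le_succ hx
      have hy := Nat.le_of_succ_le_succ hy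
      rw [krawInner_succ_left hx _ hv hv', Nat.add_sub_cancel, ih hx hy]
      simp only [add_left_inj]
      split_ifs with hxy
      · subst hxy
        have hchoose : ((N + 1).choose (x + 1) : ℝ) = (N + 1) * N.choose x / (x + 1) := by
          rw [eq_div_iff x.cast_add_one_ne_zero]
          exact_mod_cast (Nat.add_one_mul_choose_eq N x).symm
        have hpos : (N.choose x : ℝ) ≠ 0 := Nat.cast_ne_zero.2 (Nat.choose_pos hx).ne'
        have hinv : (1 + v⁻¹) * v = 1 + v := by rw [add_mul, inv_mul_cancel₀ hv, one_mul, add_comm]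
        rw [hchoose, pow_succ (1 + v⁻¹), pow_succ v, mul_mul_mul_comm, hinv]
        generalize (1 + v⁻¹) ^ N = c
        push_cast
        field_simp
      · exact mul_zero _

section Products

variable {M : ℕ} {N : Fin M → ℕ} {v : ℝ}

lemma KHat_eq (hv : 0 < v) (η ξ : Conf N) :
    KHat N v η ξ = v ^ (-(total η : ℝ) / 2) * ∏ k, krawQ (N k) (η k) (ξ k) (1 + v) := by
  simp only [KHat, kHat, krawtchouk_eq_krawQ, one_div_one_div]
  rw [Finset.prod_mul_distrib, ← Real.rpow_sum_of_pos hv, total, Nat.cast_sum,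
    ← Finset.sum_neg_distrib, Finset.sum_div]

lemma isDuality_KHat (hv : 0 < v) : IsDuality (sepGenerator N) (sepGenerator N) (KHat N v) := by
  refine isDuality_of_local (properRates_sep N) (properRates_sep N) fun η ξ k l hl => ?_
  have hkl := ne_of_val_eq_val_add_one hl
  refine ⟨v ^ (-(total η : ℝ) / 2) * ∏ j ∈ (Finset.univ.erase k).erase l,
      krawQ (N j) (η j) (ξ j) (1 + v),
    fun x₁ x₂ n₁ n₂ => krawQ (N k) n₁ x₁ (1 + v) * krawQ (N l) n₂ x₂ (1 + v),
    fun η' ξ' hη hξ => ?_, ?_⟩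
  · have hoff : ∏ j ∈ (Finset.univ.erase k).erase l, krawQ (N j) (η' j) (ξ' j) (1 + v) =
        ∏ j ∈ (Finset.univ.erase k).erase l, krawQ (N j) (η j) (ξ j) (1 + v) := by
      refine Finset.prod_congr rfl fun j hj => ?_
      obtain ⟨hjl, hjk, -⟩ := by simpa only [Finset.mem_erase] using hj
      rw [hη.eq_off j hjk hjl, hξ.eq_off j hjk hjl]
    rw [KHat_eq hv, hη.total_eq hkl, prod_eq_mul_mul_prod_erase hkl, hoff]
    ring
  · exact krawQ_mul_krawQ_duality (conf_le ξ k) (conf_le ξ l) (conf_le η k) (conf_le η l)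
      (by positivity)

lemma wHat_ne_zero (η : Conf N) : wHat N η ≠ 0 :=
  Finset.prod_ne_zero_iff.2 fun k _ => Nat.cast_ne_zero.2 (Nat.choose_pos (conf_le η k)).ne'

lemma omegaK_ne_zero (hv : 0 < v) (S x : ℕ) : omegaK S v x ≠ 0 := by
  unfold omegaK
  positivity

lemma sum_prod_krawQ (ξ ξ' : Conf N) (v : ℝ) :
    ∑ η : Conf N, wHat N η * v⁻¹ ^ total η *
      ((∏ k, krawQ (N k) (η k) (ξ k) (1 + v)) * ∏ k, krawQ (N k) (η k) (ξ' k) (1 + v)) =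
      ∏ k, krawInner (N k) (ξ k) (ξ' k) v := by
  simp only [wHat, total, ← Finset.prod_pow_eq_pow_sum, ← Finset.prod_mul_distrib, krawInner,
    ← Fin.sum_univ_eq_sum_range (fun n => ((N _).choose n : ℝ) * v⁻¹ ^ n *
      (krawQ (N _) n _ (1 + v) * krawQ (N _) n _ (1 + v)))]
  rw [Finset.prod_univ_sum, Fintype.piFinset_univ]

lemma KHat_orthogonal (hv : 0 < v) (ξ ξ' : Conf N) :
    ∑ η : Conf N, KHat N v η ξ * KHat N v η ξ' * wHat N η =
      (if ξ = ξ' then 1 else 0) / (omegaK (capacity N) v (total ξ) * wHat N ξ) := by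
  have hsq (m : ℕ) : v ^ (-(m : ℝ) / 2) * v ^ (-(m : ℝ) / 2) = v⁻¹ ^ m := by
    rw [← Real.rpow_add hv, add_halves, Real.rpow_neg hv.le, Real.rpow_natCast, inv_pow]
  have hterm (η : Conf N) : KHat N v η ξ * KHat N v η ξ' * wHat N η =
      wHat N η * v⁻¹ ^ total η *
        ((∏ k, krawQ (N k) (η k) (ξ k) (1 + v)) * ∏ k, krawQ (N k) (η k) (ξ' k) (1 + v)) := by
    rw [KHat_eq hv, KHat_eq hv, ← hsq]
    ring
  rw [Finset.sum_congr rfl fun η _ => hterm η, sum_prod_krawQ]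
  simp only [krawInner_eq (conf_le ξ _) (conf_le ξ' _) hv.ne' (by positivity : 1 + v ≠ 0)]
  split_ifs with h
  · subst h
    simp only [if_true]
    rw [Finset.prod_div_distrib, Finset.prod_mul_distrib, Finset.prod_pow_eq_pow_sum,
      Finset.prod_pow_eq_pow_sum, ← wHat, ← total, ← capacity, omegaK, zpow_neg, zpow_natCast,
      one_div v]
    field_simp
  · rw [zero_div]
    obtain ⟨k, hk⟩ := Function.ne_iff.1 h
    exact Finset.prod_eq_zero (Finset.mem_univ k) (if_neg fun e => hk (Fin.ext e))

end Products

end Krawtchouk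

/-! ## The limit `q → 1` -/

section ClassicalLimit

open Filter

lemma eventually_pos_ne_one : ∀ᶠ q : ℝ in 𝓝[≠] 1, 0 < q ∧ q ≠ 1 :=
  (eventually_nhdsWithin_of_eventually_nhds (lt_mem_nhds one_pos)).and self_mem_nhdsWithin

lemma one_sub_sq_ne_zero {q : ℝ} (hq : 0 < q) (hq1 : q ≠ 1) : 1 - q ^ 2 ≠ 0 :=
  sub_ne_zero.2 fun h => hq1 ((pow_eq_one_iff_of_nonneg hq.le two_ne_zero).1 h.symm)

lemma tendsto_rpow_sub_one_div (s : ℝ) :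
    Tendsto (fun q : ℝ => (q ^ s - 1) / (q - 1)) (𝓝[≠] 1) (𝓝 s) := by
  have hslope := (Real.hasDerivAt_rpow_const (x := 1) (p := s) (Or.inl one_ne_zero)).tendsto_slope
  rw [Real.one_rpow, mul_one] at hslope
  refine hslope.congr fun q => ?_
  rw [slope_def_field, Real.one_rpow]

lemma tendsto_one_sub_rpow_div (s : ℝ) :
    Tendsto (fun q : ℝ => (1 - q ^ (2 * s)) / (1 - q ^ 2)) (𝓝[≠] 1) (𝓝 s) := by
  have hratio := (tendsto_rpow_sub_one_div (2 * s)).div (tendsto_rpow_sub_one_div 2) two_ne_zero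
  rw [mul_div_cancel_left₀ s two_ne_zero] at hratio
  refine hratio.congr' ?_
  filter_upwards [eventually_pos_ne_one] with q ⟨_, hq1⟩
  rw [Pi.div_apply, div_div_div_cancel_right₀ (sub_ne_zero.2 hq1), Real.rpow_two,
    ← neg_sub 1 (q ^ (2 * s)), ← neg_sub 1 (q ^ 2), neg_div_neg_eq]

lemma tendsto_rpow_one (s : ℝ) : Tendsto (fun q : ℝ => q ^ s) (𝓝[≠] 1) (𝓝 1) := by
  have hcont := (Real.continuousAt_rpow_const 1 s (Or.inl one_ne_zero)).tendsto
  rw [Real.one_rpow] at hcont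
  exact hcont.mono_left nhdsWithin_le_nhds

lemma tendsto_sq_zpow_one (m : ℤ) : Tendsto (fun q : ℝ => (q ^ 2) ^ m) (𝓝[≠] 1) (𝓝 1) := by
  have hcont : ContinuousAt (fun q : ℝ => (q ^ 2) ^ m) 1 :=
    (continuousAt_id.pow 2).zpow₀ m (Or.inl (by norm_num))
  simpa using hcont.tendsto.mono_left nhdsWithin_le_nhds

lemma tendsto_sq_pow_one (j : ℕ) : Tendsto (fun q : ℝ => (q ^ 2) ^ j) (𝓝[≠] 1) (𝓝 1) := by
  simpa using tendsto_sq_zpow_one j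

lemma tendsto_qPoch (s : ℝ) (n : ℕ) :
    Tendsto (fun q : ℝ => qPoch (q ^ (2 * s)) (q ^ 2) n / (1 - q ^ 2) ^ n) (𝓝[≠] 1)
      (𝓝 (poch s n)) := by
  rw [poch_eq_prod]
  refine (tendsto_finsetProd (Finset.range n) fun i _ =>
    tendsto_one_sub_rpow_div (s + i)).congr' ?_
  filter_upwards [eventually_pos_ne_one] with q ⟨hq, _⟩
  rw [Finset.prod_div_distrib, Finset.prod_const, Finset.card_range, qPoch]
  congr 1
  refine Finset.prod_congr rfl fun i _ => ?_
  rw [mul_add, Real.rpow_add hq, ← pow_mul, ← Real.rpow_natCast q (2 * i)]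
  push_cast
  rfl

lemma tendsto_qPoch_self (n : ℕ) :
    Tendsto (fun q : ℝ => qPoch (q ^ 2) (q ^ 2) n / (1 - q ^ 2) ^ n) (𝓝[≠] 1)
      (𝓝 (n.factorial : ℝ)) := by
  simpa [poch, ascPochhammer_eval_one] using tendsto_qPoch 1 n

lemma tendsto_qPoch_zpow_neg (m n : ℕ) :
    Tendsto (fun q : ℝ => qPoch ((q ^ 2) ^ (-(m : ℤ))) (q ^ 2) n / (1 - q ^ 2) ^ n) (𝓝[≠] 1)
      (𝓝 (poch (-(m : ℝ)) n)) := by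
  refine (tendsto_qPoch (-(m : ℝ)) n).congr' ?_
  filter_upwards [eventually_pos_ne_one] with q ⟨hq, _⟩
  congr 2
  rw [mul_neg, Real.rpow_neg hq.le, zpow_neg, zpow_natCast, ← pow_mul, ← Real.rpow_natCast]
  push_cast
  rfl

lemma tendsto_qBinom {x N : ℕ} (hx : x ≤ N) :
    Tendsto (fun q : ℝ => qBinom (q ^ 2) N x) (𝓝[≠] 1) (𝓝 (N.choose x : ℝ)) := by
  have hlim := (tendsto_qPoch_self N).div ((tendsto_qPoch_self x).mul (tendsto_qPoch_self (N - x)))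
    (mul_ne_zero (Nat.cast_ne_zero.2 x.factorial_ne_zero)
      (Nat.cast_ne_zero.2 (N - x).factorial_ne_zero))
  rw [← Nat.cast_choose ℝ hx] at hlim
  refine hlim.congr' ?_
  filter_upwards [eventually_pos_ne_one] with q ⟨hq, hq1⟩
  rw [Pi.div_apply, div_mul_div_comm, ← pow_add, Nat.add_sub_cancel' hx,
    div_div_div_cancel_right₀ (pow_ne_zero N (one_sub_sq_ne_zero hq hq1)), qBinom]

lemma poch_ne_zero_of_le {a : ℝ} {m n : ℕ} (h : poch a n ≠ 0) (hmn : m ≤ n) : poch a m ≠ 0 := by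
  rw [← Nat.add_sub_cancel' hmn, poch_add] at h
  exact left_ne_zero_of_mul h

lemma poch_neg_natCast_mul_factorial_ne_zero {N j : ℕ} (h : j ≤ N) :
    poch (-(N : ℝ)) j * j.factorial ≠ 0 := by
  have hfactorial : (j.factorial : ℝ) ≠ 0 := Nat.cast_ne_zero.2 j.factorial_ne_zero
  rw [poch_neg_natCast]
  exact mul_ne_zero (mul_ne_zero (pow_ne_zero _ (neg_ne_zero.2 one_ne_zero))
    (mul_ne_zero hfactorial (Nat.cast_ne_zero.2 (Nat.choose_pos h).ne'))) hfactorial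

lemma tendsto_qHahn {n N : ℕ} (hn : n ≤ N) (x : ℕ) {α : ℝ} (β : ℝ) (hα : poch (α + 1) n ≠ 0) :
    Tendsto (fun q : ℝ => qHahn n x (q ^ (2 * α)) (q ^ (2 * β)) N (q ^ 2)) (𝓝[≠] 1)
      (𝓝 (hahn n x α β N)) := by
  refine tendsto_finsetSum _ fun j hj => ?_
  have hjn : j ≤ n := Finset.mem_range_succ_iff.1 hj
  have hden : poch (α + 1) j * poch (-(N : ℝ)) j * j.factorial ≠ 0 := by
    rw [mul_assoc]
    exact mul_ne_zero (poch_ne_zero_of_le hα hjn)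
      (poch_neg_natCast_mul_factorial_ne_zero (hjn.trans hn))
  have hlim := ((((tendsto_qPoch_zpow_neg n j).mul (tendsto_qPoch (n + α + β + 1) j)).mul
    (tendsto_qPoch_zpow_neg x j)).div (((tendsto_qPoch (α + 1) j).mul
    (tendsto_qPoch_zpow_neg N j)).mul (tendsto_qPoch_self j)) hden).mul (tendsto_sq_pow_one j)
  rw [mul_one] at hlim
  refine hlim.congr' ?_
  filter_upwards [eventually_pos_ne_one] with q ⟨hq, hq1⟩
  have hr := pow_ne_zero j (one_sub_sq_ne_zero hq hq1)
  have hnum : q ^ (2 * ((n : ℝ) + α + β + 1)) = q ^ (2 * α) * q ^ (2 * β) * (q ^ 2) ^ (n + 1) := by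
    rw [← pow_mul, ← Real.rpow_natCast, ← Real.rpow_add hq, ← Real.rpow_add hq]
    push_cast
    ring_nf
  have hα_succ : q ^ (2 * (α + 1)) = q ^ (2 * α) * q ^ 2 := by
    rw [← Real.rpow_two, ← Real.rpow_add hq, mul_add, mul_one]
  simp only [Pi.div_apply, hnum, hα_succ, div_mul_div_comm]
  rw [div_div_div_cancel_right₀ (mul_ne_zero (mul_ne_zero hr hr) hr)]

lemma tendsto_qKrawtchouk {n N : ℕ} (hn : n ≤ N) (x : ℕ) (v h : ℝ) :
    Tendsto (fun q : ℝ => qKrawtchouk n x (v * q ^ (2 * h)) N (q ^ 2)) (𝓝[≠] 1)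
      (𝓝 (krawtchouk n x (1 / (1 + v)) N)) := by
  refine tendsto_finsetSum _ fun j hj => ?_
  have hjn : j ≤ n := Finset.mem_range_succ_iff.1 hj
  have hv : Tendsto
      (fun q : ℝ => qPoch (-(v * q ^ (2 * h)) * (q ^ 2) ^ ((x : ℤ) - (N : ℤ))) (q ^ 2) j)
      (𝓝[≠] 1) (𝓝 (∏ _i ∈ Finset.range j, (1 - -(v * 1) * 1 * 1))) :=
    tendsto_finsetProd _ fun i _ => tendsto_const_nhds.sub
      ((((tendsto_rpow_one (2 * h)).const_mul v).neg.mul (tendsto_sq_zpow_one _)).mul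
        (tendsto_sq_pow_one i))
  simp only [mul_one, sub_neg_eq_add, Finset.prod_const, Finset.card_range] at hv
  have hlim := ((((tendsto_qPoch_zpow_neg n j).mul (tendsto_qPoch_zpow_neg x j)).mul hv).div
    ((tendsto_qPoch_zpow_neg N j).mul (tendsto_qPoch_self j))
    (poch_neg_natCast_mul_factorial_ne_zero (hjn.trans hn))).mul (tendsto_sq_pow_one j)
  rw [mul_one, mul_div_right_comm] at hlim
  rw [one_div_one_div]
  refine hlim.congr' ?_
  filter_upwards [eventually_pos_ne_one] with q ⟨hq, hq1⟩
  have hr := pow_ne_zero j (one_sub_sq_ne_zero hq hq1)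
  have hzero : qPoch (0 : ℝ) (q ^ 2) j = 1 := by simp [qPoch]
  simp only [Pi.div_apply, hzero, mul_one]
  rw [div_mul_div_comm, div_mul_div_comm, div_mul_eq_mul_div _ _ (qPoch _ _ _),
    div_div_div_cancel_right₀ (mul_ne_zero hr hr)]

section Krawtchouk

lemma neg_one_pow_mul_kSite {q v : ℝ} (hq : 0 < q) (hq1 : q ≠ 1) (hv : 0 < v) (n x : ℕ) (h : ℝ)
    (N : ℕ) :
    (-1) ^ n * kSite n x (Real.logb q v / 2 + h) N q =
      v ^ (-(n : ℝ) / 2) * (q ^ (-(n : ℝ) * h) * q ^ ((n : ℝ) * (N - 1) / 2)) *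
        qKrawtchouk n x (v * q ^ (2 * h)) N (q ^ 2) := by
  have hlog : q ^ Real.logb q v = v := Real.rpow_logb hq hq1 hv
  have hparam : q ^ (2 * (Real.logb q v / 2 + h)) = v * q ^ (2 * h) := by
    rw [mul_add, mul_div_cancel₀ _ (two_ne_zero' ℝ), Real.rpow_add hq, hlog]
  have hprefactor : q ^ (-(n : ℝ) * (Real.logb q v / 2 + h)) =
      v ^ (-(n : ℝ) / 2) * q ^ (-(n : ℝ) * h) := by
    rw [mul_add, Real.rpow_add hq, mul_div_left_comm, Real.rpow_mul hq.le, hlog]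
  have hsign : (-1 : ℝ) ^ n * (-1) ^ n = 1 := by rw [← mul_pow, neg_mul_neg, one_mul, one_pow]
  simp only [kSite, hparam, hprefactor, ← mul_assoc, hsign, one_mul]

lemma tendsto_kSite {v : ℝ} (hv : 0 < v) {n N : ℕ} (hn : n ≤ N) (x : ℕ) (h : ℝ) :
    Tendsto (fun q : ℝ => (-1) ^ n * kSite n x (Real.logb q v / 2 + h) N q) (𝓝[≠] 1)
      (𝓝 (kHat n x v N)) := by
  have hlim := (((tendsto_rpow_one (-(n : ℝ) * h)).mul
    (tendsto_rpow_one ((n : ℝ) * (N - 1) / 2))).const_mul (v ^ (-(n : ℝ) / 2))).mul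
    (tendsto_qKrawtchouk hn x v h)
  rw [mul_one, mul_one] at hlim
  refine hlim.congr' ?_
  filter_upwards [eventually_pos_ne_one] with q ⟨hq, hq1⟩
  exact (neg_one_pow_mul_kSite hq hq1 hv n x h N).symm

lemma tendsto_KR {M : ℕ} {N : Fin M → ℕ} {v : ℝ} (hv : 0 < v) (η ξ : Conf N) :
    Tendsto (fun q : ℝ => (-1) ^ total η * KR N (Real.logb q v / 2) q η ξ) (𝓝[≠] 1)
      (𝓝 (KHat N v η ξ)) := by
  have hlim := (tendsto_rpow_one (-uExp η / 2)).mul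
    (tendsto_finsetProd Finset.univ fun k _ =>
      tendsto_kSite hv (conf_le η k) (ξ k) (hPlus 0 ξ ((k : ℕ) + 1)))
  rw [one_mul] at hlim
  refine hlim.congr fun q => ?_
  have hshift (k : ℕ) : Real.logb q v / 2 + hPlus 0 ξ k = hPlus (Real.logb q v / 2) ξ k := by
    simp [hPlus]
  simp only [hshift]
  rw [Finset.prod_mul_distrib, Finset.prod_pow_eq_pow_sum, mul_left_comm, KR, total]

end Krawtchouk

section ShiftedParameter

/-- The shift `i π / (2 log q)` of the dynamic parameter: the exponent of `q` that gives `i`. -/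
def shift (q : ℝ) : ℂ := Complex.I * Real.pi / (2 * Real.log q)

lemma shiftedRho_eq (ρ q : ℝ) : shiftedRho ρ q = ρ + shift q := rfl

lemma ofReal_qPoch (a q : ℝ) (n : ℕ) : ((qPoch a q n : ℝ) : ℂ) = qPoch (a : ℂ) (q : ℂ) n := by
  simp [qPoch]

lemma ofReal_qHahn (n x : ℕ) (α β : ℝ) (N : ℕ) (q : ℝ) :
    ((qHahn n x α β N q : ℝ) : ℂ) = qHahn n x (α : ℂ) (β : ℂ) N (q : ℂ) := by
  simp [qHahn, ofReal_qPoch]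

lemma ofReal_qBinom (q : ℝ) (n x : ℕ) : ((qBinom q n x : ℝ) : ℂ) = qBinom (q : ℂ) n x := by
  simp [qBinom, ofReal_qPoch]

lemma cpow_eq_ofReal_rpow {q : ℝ} (hq : 0 < q) {c : ℂ} {s : ℝ} (hc : c = s) :
    (q : ℂ) ^ c = ((q ^ s : ℝ) : ℂ) := by
  rw [hc, Complex.ofReal_cpow hq.le]

variable {q : ℝ}

lemma cpow_shift (hq : 0 < q) (hq1 : q ≠ 1) : (q : ℂ) ^ shift q = Complex.I := by
  have hlog : (Real.log q : ℂ) ≠ 0 :=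
    Complex.ofReal_ne_zero.2 (Real.log_ne_zero_of_pos_of_ne_one hq hq1)
  rw [Complex.cpow_def_of_ne_zero (Complex.ofReal_ne_zero.2 hq.ne'), ← Complex.ofReal_log hq.le,
    show (Real.log q : ℂ) * shift q = Real.pi / 2 * Complex.I by rw [shift]; field_simp,
    Complex.exp_pi_div_two_mul_I]

lemma cpow_add_shift (hq : 0 < q) (hq1 : q ≠ 1) (s : ℂ) :
    (q : ℂ) ^ (s + shift q) = Complex.I * (q : ℂ) ^ s := by
  rw [Complex.cpow_add _ _ (Complex.ofReal_ne_zero.2 hq.ne'), cpow_shift hq hq1, mul_comm]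

lemma cpow_add_two_mul_shift (hq : 0 < q) (hq1 : q ≠ 1) (s : ℂ) :
    (q : ℂ) ^ (s + 2 * shift q) = -(q : ℂ) ^ s := by
  rw [two_mul, ← add_assoc, cpow_add_shift hq hq1, cpow_add_shift hq hq1, ← mul_assoc,
    Complex.I_mul_I, neg_one_mul]

lemma cpow_sub_two_mul_shift (hq : 0 < q) (hq1 : q ≠ 1) (s : ℂ) :
    (q : ℂ) ^ (s - 2 * shift q) = -(q : ℂ) ^ s := by
  rw [← neg_eq_iff_eq_neg, ← cpow_add_two_mul_shift hq hq1, sub_add_cancel]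

lemma pSite_shiftedRho (hq : 0 < q) (hq1 : q ≠ 1) (n x : ℕ) (lam ρ v : ℝ) (N : ℕ) :
    pSite n x lam (shiftedRho ρ q) (Complex.I * (q : ℂ) ^ (v : ℂ)) N q =
      ((q ^ (n * v - n * (n + ρ + lam - N)) *
        (qPoch (q ^ (2 * ((ρ + lam - N + v + 1) / 2))) (q ^ 2) x *
          qPoch (q ^ (2 * (n + (lam - ρ - N + 1 + v) / 2))) (q ^ 2) N /
          qPoch (q ^ (2 * (-x + (lam - ρ + N + 1 + v) / 2))) (q ^ 2) (x + n)) *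
        qHahn x n (q ^ (2 * ((ρ + lam - N + v - 1) / 2)))
          (q ^ (2 * ((ρ - lam - N - v - 1) / 2))) N (q ^ 2) : ℝ) : ℂ) := by
  have hq0 : (q : ℂ) ≠ 0 := Complex.ofReal_ne_zero.2 hq.ne'
  have hmul {a b : ℂ} {s : ℝ} (h : a + b = s) : (q : ℂ) ^ a * (q : ℂ) ^ b = ((q ^ s : ℝ) : ℂ) := by
    rw [← Complex.cpow_add _ _ hq0, cpow_eq_ofReal_rpow hq h]
  have hpow : ((q : ℂ) ^ (v + shift q)) ^ n =
      ((q ^ (n * v - n * (n + ρ + lam - N)) : ℝ) : ℂ) *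
        (q : ℂ) ^ ((n : ℂ) * (n + shiftedRho ρ q + lam - N)) := by
    rw [← Complex.cpow_nat_mul, ← cpow_eq_ofReal_rpow hq rfl, ← Complex.cpow_add _ _ hq0,
      shiftedRho_eq]
    push_cast
    ring_nf
  have hfirst : (q : ℂ) ^ (v + shift q - 2 * shift q) * (q : ℂ) ^ (shiftedRho ρ q + lam - N + 1) =
      ((q ^ (2 * ((ρ + lam - N + v + 1) / 2)) : ℝ) : ℂ) :=
    hmul (by rw [shiftedRho_eq]; push_cast; ring)
  have hsecond : (q : ℂ) ^ (v + shift q) * (q : ℂ) ^ (2 * n - shiftedRho ρ q + lam - N + 1) =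
      ((q ^ (2 * (n + (lam - ρ - N + 1 + v) / 2)) : ℝ) : ℂ) :=
    hmul (by rw [shiftedRho_eq]; push_cast; ring)
  have hdenominator :
      (q : ℂ) ^ (v + shift q) * (q : ℂ) ^ (-2 * x - shiftedRho ρ q + lam + N + 1) =
        ((q ^ (2 * (-x + (lam - ρ + N + 1 + v) / 2)) : ℝ) : ℂ) :=
    hmul (by rw [shiftedRho_eq]; push_cast; ring)
  have hα : (q : ℂ) ^ (v + shift q - 2 * shift q) * (q : ℂ) ^ (shiftedRho ρ q + lam - N - 1) =
      ((q ^ (2 * ((ρ + lam - N + v - 1) / 2)) : ℝ) : ℂ) :=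
    hmul (by rw [shiftedRho_eq]; push_cast; ring)
  have hβ : (q : ℂ) ^ (-(v + shift q)) * (q : ℂ) ^ (shiftedRho ρ q - lam - N - 1) =
      ((q ^ (2 * ((ρ - lam - N - v - 1) / 2)) : ℝ) : ℂ) :=
    hmul (by rw [shiftedRho_eq]; push_cast; ring)
  rw [pSite, ← cpow_add_shift hq hq1, ← Complex.cpow_neg, ← cpow_sub_two_mul_shift hq hq1, hfirst,
    hsecond, hdenominator, hα, hβ, hpow, mul_right_comm _ _ (_ * _), mul_comm _ ((q : ℂ) ^ _),
    mul_div_mul_left _ _ ((Complex.cpow_ne_zero_iff).2 (Or.inl hq0))]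
  simp only [Complex.ofReal_mul, Complex.ofReal_div, ofReal_qPoch, ofReal_qHahn, Complex.ofReal_pow]
  ring

lemma WSite_shiftedRho (hq : 0 < q) (hq1 : q ≠ 1) (x N : ℕ) (ρ : ℝ) :
    WSite x N (shiftedRho ρ q) q =
      (((1 - q ^ (2 * (2 * x + ρ - N))) / (1 - q ^ (2 * (ρ - N))) *
        (qPoch (q ^ (2 * (ρ - N))) (q ^ 2) x / qPoch (q ^ (2 * (ρ + 1))) (q ^ 2) x) *
        ((-1) ^ x * q ^ (-(x : ℝ) * (2 * ρ + 1 + x - 2 * N)) /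
          qPoch (q ^ (2 * -ρ)) (q ^ 2) N) * qBinom (q ^ 2) N x : ℝ) : ℂ) := by
  have hneg {c : ℂ} {s : ℝ} (hc : c = s + 2 * shift q) : (q : ℂ) ^ c = -((q ^ s : ℝ) : ℂ) := by
    rw [hc, cpow_add_two_mul_shift hq hq1, cpow_eq_ofReal_rpow hq rfl]
  have hheight : (q : ℂ) ^ (4 * x + 2 * shiftedRho ρ q - 2 * N) =
      -((q ^ (2 * (2 * x + ρ - N)) : ℝ) : ℂ) :=
    hneg (by rw [shiftedRho_eq]; push_cast; ring)
  have hbase : (q : ℂ) ^ (2 * shiftedRho ρ q - 2 * N) = -((q ^ (2 * (ρ - N)) : ℝ) : ℂ) :=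
    hneg (by rw [shiftedRho_eq]; push_cast; ring)
  have hdenominator : (q : ℂ) ^ (2 * shiftedRho ρ q + 2) = -((q ^ (2 * (ρ + 1)) : ℝ) : ℂ) :=
    hneg (by rw [shiftedRho_eq]; push_cast; ring)
  have hreflected : (q : ℂ) ^ (-2 * shiftedRho ρ q) = -((q ^ (2 * -ρ) : ℝ) : ℂ) := by
    rw [← cpow_eq_ofReal_rpow hq rfl, ← cpow_sub_two_mul_shift hq hq1, shiftedRho_eq]
    push_cast
    ring_nf
  have hpower : (q : ℂ) ^ (-(x : ℂ) * (2 * shiftedRho ρ q + 1 + x - 2 * N)) =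
      (-1) ^ x * ((q ^ (-(x : ℝ) * (2 * ρ + 1 + x - 2 * N)) : ℝ) : ℂ) := by
    have hsign : (q : ℂ) ^ (-(2 * shift q)) = -1 := by
      simpa using cpow_sub_two_mul_shift hq hq1 0
    rw [← cpow_eq_ofReal_rpow hq rfl, ← hsign, ← Complex.cpow_nat_mul,
      ← Complex.cpow_add _ _ (Complex.ofReal_ne_zero.2 hq.ne'), shiftedRho_eq]
    push_cast
    ring_nf
  rw [WSite, hheight, hbase, hdenominator, hreflected, hpower]
  simp only [Complex.ofReal_mul, Complex.ofReal_div, Complex.ofReal_sub, Complex.ofReal_one,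
    ofReal_qPoch, ofReal_qBinom, Complex.ofReal_pow, Complex.ofReal_neg, neg_neg, ← sub_eq_add_neg]

end ShiftedParameter

lemma tendsto_pSite {n x N : ℕ} (hx : x ≤ N) {lam ρ v : ℝ}
    (hA : poch ((ρ + lam - N + v + 1) / 2) x ≠ 0)
    (hB : poch (-x + (lam - ρ + N + 1 + v) / 2) (x + n) ≠ 0) :
    Tendsto (fun q : ℝ => (1 - (q : ℂ) ^ 2) ^ n / (1 - (q : ℂ) ^ 2) ^ N *
      pSite n x lam (shiftedRho ρ q) (Complex.I * (q : ℂ) ^ (v : ℂ)) N q) (𝓝[≠] 1)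
      (𝓝 ((pHat n x lam ρ v N : ℝ) : ℂ)) := by
  have hα : poch ((ρ + lam - N + v - 1) / 2 + 1) x ≠ 0 := by
    rwa [show (ρ + lam - N + v - 1) / 2 + 1 = (ρ + lam - N + v + 1) / 2 by ring]
  have hlim := ((tendsto_rpow_one (n * v - n * (n + ρ + lam - N))).mul
    (((tendsto_qPoch ((ρ + lam - N + v + 1) / 2) x).mul
      (tendsto_qPoch (n + (lam - ρ - N + 1 + v) / 2) N)).div
      (tendsto_qPoch (-x + (lam - ρ + N + 1 + v) / 2) (x + n)) hB)).mul
    (tendsto_qHahn hx n ((ρ - lam - N - v - 1) / 2) hα)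
  rw [one_mul] at hlim
  refine ((Complex.continuous_ofReal.tendsto _).comp hlim).congr' ?_
  filter_upwards [eventually_pos_ne_one] with q ⟨hq, hq1⟩
  have hr := one_sub_sq_ne_zero hq hq1
  have hscale (a b c d f : ℝ) :
      a * (b / (1 - q ^ 2) ^ x * (c / (1 - q ^ 2) ^ N) / (d / (1 - q ^ 2) ^ (x + n))) * f =
        (1 - q ^ 2) ^ n / (1 - q ^ 2) ^ N * (a * (b * c / d) * f) := by
    rw [pow_add]
    field_simp
  rw [pSite_shiftedRho hq hq1, Function.comp_apply]
  simp only [Pi.div_apply, hscale]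
  push_cast
  rfl

lemma tendsto_WSite {x N : ℕ} (hx : x ≤ N) {ρ : ℝ} (hρ : ρ - N ≠ 0) (hden : poch (ρ + 1) x ≠ 0)
    (hden' : poch (-ρ) N ≠ 0) :
    Tendsto (fun q : ℝ => (1 - (q : ℂ) ^ 2) ^ N * WSite x N (shiftedRho ρ q) q) (𝓝[≠] 1)
      (𝓝 ((WHatSite x N ρ : ℝ) : ℂ)) := by
  have hlim := ((((tendsto_one_sub_rpow_div (2 * x + ρ - N)).div
    (tendsto_one_sub_rpow_div (ρ - N)) hρ).mul
      ((tendsto_qPoch (ρ - N) x).div (tendsto_qPoch (ρ + 1) x) hden)).mul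
      (((tendsto_rpow_one (-(x : ℝ) * (2 * ρ + 1 + x - 2 * N))).const_mul ((-1) ^ x)).div
        (tendsto_qPoch (-ρ) N) hden')).mul (tendsto_qBinom hx)
  have hvalue : (2 * x + ρ - N) / (ρ - N) * (poch (ρ - N) x / poch (ρ + 1) x) *
      ((-1) ^ x * 1 / poch (-ρ) N) * N.choose x = WHatSite x N ρ := by
    rw [WHatSite]
    field_simp
  rw [hvalue] at hlim
  refine ((Complex.continuous_ofReal.tendsto _).comp hlim).congr' ?_
  filter_upwards [eventually_pos_ne_one] with q ⟨hq, hq1⟩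
  have hr := one_sub_sq_ne_zero hq hq1
  rw [WSite_shiftedRho hq hq1, ← Complex.ofReal_pow, ← Complex.ofReal_one, ← Complex.ofReal_sub,
    ← Complex.ofReal_pow, ← Complex.ofReal_mul, Function.comp_apply]
  simp only [Pi.div_apply]
  rw [div_div_div_cancel_right₀ hr, div_div_div_cancel_right₀ (pow_ne_zero x hr),
    div_div_eq_mul_div]
  ring_nf

section Products

variable {M : ℕ} {N : Fin M → ℕ}

lemma hPlus_shiftedRho (ρ q : ℝ) (ξ : Conf N) (k : ℕ) :
    hPlus (shiftedRho ρ q) ξ k = shiftedRho (hPlus ρ ξ k) q := by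
  simp only [hPlus, shiftedRho, Complex.ofReal_add, Complex.ofReal_sum]
  rw [add_right_comm]
  congr 2
  refine Finset.sum_congr rfl fun j _ => ?_
  split_ifs <;> simp

lemma ofReal_hMinus_zero (η : Conf N) (k : ℕ) :
    ((hMinus (0 : ℝ) η k : ℝ) : ℂ) = hMinus (0 : ℂ) η k := by
  simp only [hMinus, Complex.ofReal_add, Complex.ofReal_sum, Complex.ofReal_zero]
  congr 1
  refine Finset.sum_congr rfl fun j _ => ?_
  split_ifs <;> simp

lemma tendsto_PR {ρ v : ℝ} (h : HahnGeneric N ρ v) (η ξ : Conf N) :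
    Tendsto
      (fun q : ℝ => (1 - (q : ℂ) ^ 2) ^ ((total η : ℤ) - (capacity N : ℤ)) *
        PR N (shiftedRho ρ q) (Complex.I * (q : ℂ) ^ (v : ℂ)) q η ξ)
      (𝓝[≠] 1) (𝓝 ((PHat N ρ v η ξ : ℝ) : ℂ)) := by
  rw [PHat, Complex.ofReal_prod]
  refine (tendsto_finsetProd Finset.univ fun k _ => tendsto_pSite (conf_le ξ k)
    (h.poch_site_ne_zero η ξ k) (h.poch_site_denominator_ne_zero η ξ k)).congr' ?_
  filter_upwards [eventually_pos_ne_one] with q ⟨hq, hq1⟩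
  have hr : (1 : ℂ) - (q : ℂ) ^ 2 ≠ 0 := by exact_mod_cast one_sub_sq_ne_zero hq hq1
  rw [zpow_sub₀ hr, zpow_natCast, zpow_natCast, total, capacity, ← Finset.prod_pow_eq_pow_sum,
    ← Finset.prod_pow_eq_pow_sum, ← Finset.prod_div_distrib, PR, ← Finset.prod_mul_distrib]
  simp only [hPlus_shiftedRho, ofReal_hMinus_zero]

lemma tendsto_WR {ρ : ℝ} (hρ : ∀ j : ℤ, |j| ≤ (capacity N : ℤ) → ρ ≠ j) (ξ : Conf N) :
    Tendsto (fun q : ℝ => (1 - (q : ℂ) ^ 2) ^ capacity N * WR N (shiftedRho ρ q) q ξ)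
      (𝓝[≠] 1) (𝓝 ((WHatR N ρ ξ : ℝ) : ℂ)) := by
  rw [WHatR, Complex.ofReal_prod]
  have hheight (k : Fin M) (i : ℤ) (hi : |i| ≤ N k) : hPlus ρ ξ (k + 1) + i ≠ 0 := by
    refine hPlus_add_ne_zero hρ ξ (k + 1) (hi.trans ?_)
    rw [sumLT_succ]
    omega
  have hsite (k : Fin M) := by
    have hξ := conf_le ξ k
    refine tendsto_WSite (ρ := hPlus ρ ξ (k + 1)) hξ ?_ (poch_ne_zero fun i hi => ?_)
      (poch_ne_zero fun i hi => ?_)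
    · simpa [← sub_eq_add_neg] using hheight k (-N k) (by simp)
    · simpa [add_assoc] using hheight k (1 + i) (by rw [abs_of_nonneg (by positivity)]; omega)
    · rw [neg_add_eq_sub, ← neg_sub, neg_ne_zero]
      simpa [← sub_eq_add_neg] using hheight k (-i) (by rw [abs_neg, Nat.abs_cast]; omega)
  refine (tendsto_finsetProd Finset.univ fun k _ => hsite k).congr fun q => ?_
  rw [capacity, ← Finset.prod_pow_eq_pow_sum, WR, ← Finset.prod_mul_distrib]
  simp only [hPlus_shiftedRho]

end Products

end ClassicalLimit

end ExclusionDuality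

end

theorem mainTheorem10 {M : ℕ} (N : Fin M → ℕ) (hN : ∀ k, 1 ≤ N k) :
    -- the dynamic process and Hahn polynomials
    (∀ ρ v : ℝ, HahnGeneric N ρ v →
      (∀ η ξ : Conf N,
        Filter.Tendsto
          (fun q : ℝ => (1 - (q : ℂ) ^ 2) ^ ((total η : ℤ) - (capacity N : ℤ)) *
            PR N (shiftedRho ρ q) (Complex.I * (q : ℂ) ^ (v : ℂ)) q η ξ)
          (𝓝[≠] 1) (𝓝 ((PHat N ρ v η ξ : ℝ) : ℂ))) ∧
      (DynRatesDefined N ρ → IsDuality (sepGenerator N) (dynGenerator N ρ) (PHat N ρ v)) ∧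
      ((∀ j : ℤ, |j| ≤ (capacity N : ℤ) → ρ ≠ j) →
        (∀ ξ : Conf N,
          Filter.Tendsto
            (fun q : ℝ => (1 - (q : ℂ) ^ 2) ^ capacity N * WR N (shiftedRho ρ q) q ξ)
            (𝓝[≠] 1) (𝓝 ((WHatR N ρ ξ : ℝ) : ℂ))) ∧
        IsReversible (sepGenerator N) (fun η => omegaP (capacity N) ρ v (total η) * wHat N η) ∧
        IsReversible (dynGenerator N ρ)
          (fun ξ => omegaPR (capacity N) ρ v (total ξ) * WHatR N ρ ξ) ∧
        (∀ ξ ξ' : Conf N,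
          ∑ η : Conf N, PHat N ρ v η ξ * PHat N ρ v η ξ' *
              (omegaP (capacity N) ρ v (total η) * wHat N η) =
            (if ξ = ξ' then 1 else 0) /
              (omegaPR (capacity N) ρ v (total ξ) * WHatR N ρ ξ)) ∧
        (∀ η η' : Conf N,
          ∑ ξ : Conf N, PHat N ρ v η ξ * PHat N ρ v η' ξ *
              (omegaPR (capacity N) ρ v (total ξ) * WHatR N ρ ξ) =
            (if η = η' then 1 else 0) /
              (omegaP (capacity N) ρ v (total η) * wHat N η)))) ∧
    -- self-duality and Krawtchouk polynomials
    (∀ v : ℝ, 0 < v →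
      (∀ η ξ : Conf N,
        Filter.Tendsto
          (fun q : ℝ => (-1) ^ total η * KR N (Real.logb q v / 2) q η ξ)
          (𝓝[≠] 1) (𝓝 (KHat N v η ξ))) ∧
      IsDuality (sepGenerator N) (sepGenerator N) (KHat N v) ∧
      IsReversible (sepGenerator N) (wHat N) ∧
      IsReversible (sepGenerator N) (fun ξ => omegaK (capacity N) v (total ξ) * wHat N ξ) ∧
      (∀ ξ ξ' : Conf N,
        ∑ η : Conf N, KHat N v η ξ * KHat N v η ξ' * wHat N η =
          (if ξ = ξ' then 1 else 0) / (omegaK (capacity N) v (total ξ) * wHat N ξ)) ∧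
      (∀ η η' : Conf N,
        ∑ ξ : Conf N, KHat N v η ξ * KHat N v η' ξ *
            (omegaK (capacity N) v (total ξ) * wHat N ξ) =
          (if η = η' then 1 else 0) / wHat N η)) := by
  refine ⟨fun ρ v h => ⟨tendsto_PR h, isDuality_PHat h, fun hρ => ⟨tendsto_WR hρ,
      isReversible_sep _, isReversible_dyn h hρ, PHat_orthogonal h hρ, ?_⟩⟩,
    fun v hv => ⟨tendsto_KR hv, isDuality_KHat hv, ?_, isReversible_sep _,
      KHat_orthogonal hv, ?_⟩⟩
  · exact dual_orthogonality
      (fun ξ => mul_ne_zero (h.omegaPR_ne_zero (total_le_capacity ξ)) (WHatR_ne_zero hρ ξ))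
      (PHat_orthogonal h hρ)
  · simpa using isReversible_sep (N := N) fun _ => 1
  · exact dual_orthogonality
      (fun ξ => mul_ne_zero (omegaK_ne_zero hv _ _) (wHat_ne_zero ξ)) (KHat_orthogonal hv)
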